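/- **Setting.** Let $n,\nu,r\ge 0$ be integers and $m_1,m_2,p_1,p_2\ge0$ even integers, $m=m_1+m_2$. Put $J_{(2k)}=I_k\otimes\begin{bmatrix}0&1\\-1&0\end{bmatrix}$, $J_1=J_{(m_1)}$, $J_2=J_{(m_2)}$, $J=\mathrm{diag}(J_1,J_2)$. Fix $\theta>0$; real antisymmetric nonsingular $\Theta_1\in\mathbb R^{n\times n}$, $\Theta_2\in\mathbb R^{\nu\times\nu}$, $\Theta=\mathrm{diag}(\Theta_1,\Theta_2)$; a symmetric $R_1\in\mathbb R^{n\times n}$; $M_1\in\mathbb R^{m_1\times n}$, $L_1\in\mathbb R^{p_2\times n}$; matrices $D\in\mathbb R^{p_1\times m_1}$, $d\in\mathbb R^{p_2\times m_2}$ consisting of conjugate pairs of rows of permutation matrices, so that $\widetilde J_1=DJ_1D^{\rm T}=J_{(p_1)}$ and $\widetilde J_2=dJ_2d^{\rm T}=J_{(p_2)}$; weights $N\in\mathbb R^{r\times n}$, $K\in\mathbb R^{r\times p_2}$. The plant matrices are $$A=2\Theta_1(R_1+M_1^{\rm T}J_1M_1+L_1^{\rm T}\widetilde J_2L_1),\quad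 B=2\Theta_1M_1^{\rm T},\quad C=2DJ_1M_1,\quad E=2\Theta_1L_1^{\rm T}.$$ A coherent controller is given by $(R_2,M_2,L_2)$ with $R_2\in\mathbb R^{\nu\times\nu}$ symmetric, $M_2\in\mathbb R^{m_2\times\nu}$, $L_2\in\mathbb R^{p_1\times\nu}$, through $$a=2\Theta_2(R_2+M_2^{\rm T}J_2M_2+L_2^{\rm T}\widetilde J_1L_2),\quad b=2\Theta_2M_2^{\rm T},\quad c=2dJ_2M_2,\quad e=2\Theta_2L_2^{\rm T},$$ and the closed-loop system $dX=\mathcal AX\,dt+\mathcal B\,dW$, $Z=\mathcal CX$ has $$\mathcal A=\begin{bmatrix}A&Ec\\eC&a\end{bmatrix},\quad\mathcal B=\begin{bmatrix}B&Ed\\eD&b\end{bmatrix},\quad\mathcal C=\begin{bmatrix}N&Kc\end{bmatrix}.$$ **Cost.** When $\mathcal A$ is Hurwitz, the process $Z$ in the invariant Gaussian state under vacuum fields has the quantum covariance function $P(s-t)+i\Lambda(s-t)$, where for $\tau\ge0$ $$P(\tau)=\mathcal Ce^{\tau\mathcal A}\mathcal P\mathcal C^{\rm T},\quad \Lambda(\tau)=\mathcal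 Ce^{\tau\mathcal A}\Theta\mathcal C^{\rm T},\quad P(-\tau)=P(\tau)^{\rm T},\quad\Lambda(-\tau)=-\Lambda(\tau)^{\rm T},\quad \mathcal P=\int_0^\infty e^{t\mathcal A}\mathcal B\mathcal B^{\rm T}e^{t\mathcal A^{\rm T}}dt .$$ Let $\Phi(\lambda)=\int_{\mathbb R}e^{-i\lambda t}P(t)\,dt$, $\Psi(\lambda)=\int_{\mathbb R}e^{-i\lambda t}\Lambda(t)\,dt$. The quadratic-exponential functional (QEF) rate is the functional $$\Upsilon_\theta=-\frac1{4\pi}\int_{\mathbb R}\ln\det D_\theta(\lambda)\,d\lambda,\qquad D_\theta=\cos(\theta\Psi)-\theta\,\Phi\,\mathrm{sinc}(\theta\Psi).$$ The controller is *feasible* if $\mathcal A$ is Hurwitz and $\theta\sup_{\lambda}\lambda_{\max}(\Phi(\lambda)\,\mathrm{tanc}(\theta\Psi(\lambda)))<1$. It is *admissible* if, moreover, for all sufficiently large $T$ the integral operator on $L^2([0,T],\mathbb C^r)$ with kernel $\Lambda(s-t)$ is injective. Here $\mathrm{sinc}\,z=\frac{\sin z}z$, $\mathrm{tanc}\,z=\frac{\tan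 z}z$. **Core matrix.** For arbitrary $(\mathcal A,\mathcal B,\mathcal C)$ let $G=(i\lambda I-\mathcal A)^{-1}$, $F=\mathcal CG\mathcal B$, $S=\frac1{\sqrt2}(I_m+iJ)^{\rm T}$, and extend $\Upsilon_\theta$ to a function of $(\mathcal A,\mathcal B,\mathcal C)$ by putting $\Phi=FF^*$, $\Psi=FJF^*$ in the formula for $\Upsilon_\theta$. With $\phi(u)=\frac{e^u-1}u$ let $$\Delta_\theta=I_m-\theta SF^*\phi(2i\theta\Psi)FS,\quad\phi_\theta=\phi(2i\theta\Psi)FS\Delta_\theta^{-1}S,\quad\psi_\theta=\varpi_\theta FJ,\quad\varpi_\theta=\Big(\phi\Big(\begin{bmatrix}2i\theta\Psi&0\\FS\Delta_\theta^{-1}SF^*&2i\theta\Psi\end{bmatrix}\Big)\Big)_{21},$$ $$\chi_\theta=\frac1{2\pi}\int_{\mathbb R}\mathrm{Re}\,\mathfrak P\Big(\begin{bmatrix}G^*\mathcal C^{\rm T}\\I_r\end{bmatrix}(\phi_\theta+2i\theta\psi_\theta)\begin{bmatrix}\mathcal B^{\rm T}G^*&I_m\end{bmatrix}\Big)d\lambda,$$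 where $\mathfrak P$ replaces the bottom right $r\times m$ block by $0$, and let $$\Gamma_1=\begin{bmatrix}0&E\\I_\nu&0\\0&K\end{bmatrix},\qquad\Gamma_2=\begin{bmatrix}0&I_\nu&0&0\\0&0&0&I_{m_2}\\C&0&D&0\end{bmatrix}.$$ **Theorem.** For every stabilizing controller ($\mathcal A$ Hurwitz) the rate $\Upsilon_\theta$ coincides with the value at $(a,b,c,e)$ of the composite function $(a,b,c,e)\mapsto(\mathcal A,\mathcal B,\mathcal C)\mapsto\Upsilon_\theta$. Let $(R_2,M_2,L_2)$ be admissible. Then $\det D_\theta(\lambda)$ is real and positive for all $\lambda\in\mathbb R$, the integrals defining $\Upsilon_\theta$ and $\chi_\theta$ converge absolutely, and the partial Fréchet derivatives (identified with matrices through $\langle\alpha,\beta\rangle=\mathrm{Tr}(\alpha^{\rm T}\beta)$) of $\Upsilon_\theta$ with respect to $a,b,c,e$, taken as independent variables, exist and are the blocks of $$\theta\,\Gamma_1^{\rm T}\chi_\theta\Gamma_2^{\rm T}=\begin{bmatrix}\partial_a\Upsilon_\theta&\partial_b\Upsilon_\theta&\partial_e\Upsilon_\theta\\\partial_c\Upsilon_\theta&*&*\end{bmatrix}.$$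 As a function of $(R_2,M_2,L_2)$ (with $R_2$ in the space of symmetric matrices), $\Upsilon_\theta$ is Fréchet differentiable there, with $$\begin{aligned}\partial_{R_2}\Upsilon_\theta&=-2\,\mathbf S(\Theta_2\partial_a\Upsilon_\theta),\\ \partial_{M_2}\Upsilon_\theta&=2\big(2J_2M_2\mathbf A(\Theta_2\partial_a\Upsilon_\theta)+(\partial_b\Upsilon_\theta)^{\rm T}\Theta_2-J_2d^{\rm T}\partial_c\Upsilon_\theta\big),\\ \partial_{L_2}\Upsilon_\theta&=2\big(2\widetilde J_1L_2\mathbf A(\Theta_2\partial_a\Upsilon_\theta)+(\partial_e\Upsilon_\theta)^{\rm T}\Theta_2\big),\end{aligned}$$ where $\mathbf S(\mu)=\frac12(\mu+\mu^{\rm T})$, $\mathbf A(\mu)=\frac12(\mu-\mu^{\rm T})$. If, moreover, $(R_2,M_2,L_2)$ is a local minimum of $\Upsilon_\theta$ on the set of feasible controllers, then $$\mathbf S(\Theta_2\partial_a\Upsilon_\theta)=0,\quad 2J_2M_2\mathbf A(\Theta_2\partial_a\Upsilon_\theta)+(\partial_b\Upsilon_\theta)^{\rm T}\Theta_2-J_2d^{\rm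 T}\partial_c\Upsilon_\theta=0,\quad 2\widetilde J_1L_2\mathbf A(\Theta_2\partial_a\Upsilon_\theta)+(\partial_e\Upsilon_\theta)^{\rm T}\Theta_2=0.$$ -/

import Mathlib

open Matrix MeasureTheory Filter Topology
open scoped Kronecker ComplexConjugate

noncomputable section

namespace CoherentQEF

/-! ### Matrices: complexification, symmetric matrices, entire functions, Frobenius gradients -/

section General

variable {l m n : Type*} [Fintype l] [Fintype m] [Fintype n]

/-- A real matrix regarded as a complex one. -/
def toC (A : Matrix m n ℝ) : Matrix m n ℂ := A.map Complex.ofReal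

/-- The space of real symmetric matrices. -/
def symMat (n : Type*) : Submodule ℝ (Matrix n n ℝ) where
  carrier := {A | Aᵀ = A}
  add_mem' := fun {A B} hA hB => by
    simp only [Set.mem_ofPred_eq] at hA hB ⊢
    rw [Matrix.transpose_add, hA, hB]
  zero_mem' := by simp
  smul_mem' := fun c A hA => by
    simp only [Set.mem_ofPred_eq] at hA ⊢
    rw [Matrix.transpose_smul, hA]

/-- The symmetrizer `(A + Aᵀ) / 2`. -/
def symPart (A : Matrix n n ℝ) : Matrix n n ℝ := (1 / 2 : ℝ) • (A + Aᵀ)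

/-- The antisymmetrizer `(A - Aᵀ) / 2`. -/
def asymPart (A : Matrix n n ℝ) : Matrix n n ℝ := (1 / 2 : ℝ) • (A - Aᵀ)

/-- All eigenvalues have negative real parts. -/
def IsHurwitz [DecidableEq n] (A : Matrix n n ℝ) : Prop :=
  ∀ z ∈ spectrum ℂ (toC A), z.re < 0

/-- `cos A`. -/
def matCos [DecidableEq n] (A : Matrix n n ℂ) : Matrix n n ℂ :=
  ∑' k : ℕ, ((-1 : ℂ) ^ k / ((2 * k).factorial : ℂ)) • A ^ (2 * k)

/-- `sinc A`, where `sinc z = sin z / z`, `sinc 0 = 1`. -/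
def matSinc [DecidableEq n] (A : Matrix n n ℂ) : Matrix n n ℂ :=
  ∑' k : ℕ, ((-1 : ℂ) ^ k / ((2 * k + 1).factorial : ℂ)) • A ^ (2 * k)

/-- `tanc A`, where `tanc z = tan z / z`, `tanc 0 = 1` (used for matrices with `cos A` invertible). -/
def matTanc [DecidableEq n] (A : Matrix n n ℂ) : Matrix n n ℂ :=
  (matCos A)⁻¹ * matSinc A

/-- `φ(A)`, where `φ(u) = (exp u - 1) / u`, `φ(0) = 1`. -/
def matPhi [DecidableEq n] (A : Matrix n n ℂ) : Matrix n n ℂ :=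
  ∑' k : ℕ, (1 / ((k + 1).factorial : ℂ)) • A ^ k

/-- The linear functional `X ↦ ⟨g, X⟩ = Tr (gᵀ X)` on real matrices. -/
def frob (g : Matrix m n ℝ) : Matrix m n ℝ →L[ℝ] ℝ :=
  LinearMap.toContinuousLinearMap
    { toFun := fun X => (gᵀ * X).trace
      map_add' := fun X Y => by rw [Matrix.mul_add, Matrix.trace_add]
      map_smul' := fun c X => by simp }

/-- `f` is Frechet differentiable at `X` and its derivative, identified with a matrix through the
Frobenius inner product, is `g`. -/
def HasFrobGradAt (f : Matrix m n ℝ → ℝ) (g X : Matrix m n ℝ) : Prop :=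
  HasFDerivAt f (frob g) X

/-- The same for functions on the space of symmetric matrices; the gradient is symmetric. -/
def HasSymGradAt (f : symMat n → ℝ) (g : Matrix n n ℝ) (X : symMat n) : Prop :=
  g ∈ symMat n ∧ HasFDerivAt f ((frob g).comp (symMat n).subtypeL) X

/-- The Fourier transform `∫ exp (-i λ t) K(t) dt` of a real matrix-valued function, entrywise. -/
def fourierMat (K : ℝ → Matrix m n ℝ) (lam : ℝ) : Matrix m n ℂ :=
  Matrix.of fun i j => ∫ t : ℝ, Complex.exp (-Complex.I * lam * t) * (K t i j : ℂ)

end General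

/-! ### The QEF rate in the frequency domain -/

section Rate

variable {r : Type*} [Fintype r] [DecidableEq r]

/-- `D_θ(λ) = cos (θ Ψ(λ)) - θ Φ(λ) sinc (θ Ψ(λ))`. -/
def Dmat (θ : ℝ) (Φ Ψ : ℝ → Matrix r r ℂ) (lam : ℝ) : Matrix r r ℂ :=
  matCos ((θ : ℂ) • Ψ lam) - (θ : ℂ) • (Φ lam * matSinc ((θ : ℂ) • Ψ lam))

/-- `ln det D_θ(λ)`. -/
def logDetD (θ : ℝ) (Φ Ψ : ℝ → Matrix r r ℂ) (lam : ℝ) : ℝ :=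
  Real.log (Dmat θ Φ Ψ lam).det.re

/-- `-(1 / 4π) ∫ ln det D_θ(λ) dλ`. -/
def rate (θ : ℝ) (Φ Ψ : ℝ → Matrix r r ℂ) : ℝ :=
  -(1 / (4 * Real.pi)) * ∫ lam : ℝ, logDetD θ Φ Ψ lam

/-- The constraint `θ sup_λ λ_max (Φ(λ) tanc (θ Ψ(λ))) < 1`. -/
def SpecConstraint (θ : ℝ) (Φ Ψ : ℝ → Matrix r r ℂ) : Prop :=
  ∃ c < (1 : ℝ), ∀ lam x : ℝ,
    (x : ℂ) ∈ spectrum ℂ (Φ lam * matTanc ((θ : ℂ) • Ψ lam)) → θ * x ≤ c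

end Rate

/-! ### State-space systems `(𝒜, ℬ, 𝒞)` driven by fields with Ito matrix `I + i J` -/

section StateSpace

variable {x w r : Type*} [Fintype x] [DecidableEq x] [Fintype w] [DecidableEq w]
  [Fintype r] [DecidableEq r]

/-- The two-point commutator kernel `V`. -/
def kernelV (Θ 𝒜 : Matrix x x ℝ) (τ : ℝ) : Matrix x x ℝ :=
  if 0 ≤ τ then NormedSpace.exp (τ • 𝒜) * Θ else Θ * NormedSpace.exp (-τ • 𝒜ᵀ)

/-- `Λ(τ) = 𝒞 V(τ) 𝒞ᵀ`, the imaginary part of the quantum covariance function of `Z = 𝒞 X`. -/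
def kernelLam (Θ 𝒜 : Matrix x x ℝ) (𝒞 : Matrix r x ℝ) (τ : ℝ) : Matrix r r ℝ :=
  𝒞 * kernelV Θ 𝒜 τ * 𝒞ᵀ

/-- The controllability Gramian `∫₀^∞ exp(t𝒜) ℬ ℬᵀ exp(t𝒜ᵀ) dt`: the one-point covariance matrix
of the invariant Gaussian state under vacuum fields. -/
def gramian (𝒜 : Matrix x x ℝ) (ℬ : Matrix x w ℝ) : Matrix x x ℝ :=
  Matrix.of fun i j => ∫ t in Set.Ioi (0 : ℝ),
    (NormedSpace.exp (t • 𝒜) * ℬ * ℬᵀ * NormedSpace.exp (t • 𝒜ᵀ)) i j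

/-- The real part `P` of the quantum covariance function of `Z = 𝒞 X` in the invariant state. -/
def kernelP (𝒜 : Matrix x x ℝ) (ℬ : Matrix x w ℝ) (𝒞 : Matrix r x ℝ) (τ : ℝ) : Matrix r r ℝ :=
  if 0 ≤ τ then 𝒞 * NormedSpace.exp (τ • 𝒜) * gramian 𝒜 ℬ * 𝒞ᵀ
  else 𝒞 * gramian 𝒜 ℬ * NormedSpace.exp (-τ • 𝒜ᵀ) * 𝒞ᵀ

/-- The integral operator on `L²([0,T], ℂ^r)` with kernel `Λ(s - t)` has trivial kernel. -/
def InjOnHorizon (Λ : ℝ → Matrix r r ℝ) (T : ℝ) : Prop :=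
  ∀ f : ℝ → EuclideanSpace ℂ r, MemLp f 2 (volume.restrict (Set.Icc 0 T)) →
    (∀ᵐ s ∂(volume.restrict (Set.Icc 0 T)), ∀ j : r,
      ∫ t in Set.Icc 0 T, ∑ k : r, (Λ (s - t) j k : ℂ) * f t k = 0) →
    f =ᵐ[volume.restrict (Set.Icc 0 T)] 0

/-- `G(iλ) = (iλ I - 𝒜)⁻¹`. -/
def Gtf (𝒜 : Matrix x x ℝ) (lam : ℝ) : Matrix x x ℂ :=
  ((Complex.I * lam) • (1 : Matrix x x ℂ) - toC 𝒜)⁻¹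

/-- `F(iλ) = 𝒞 G(iλ) ℬ`. -/
def Ftf (𝒜 : Matrix x x ℝ) (ℬ : Matrix x w ℝ) (𝒞 : Matrix r x ℝ) (lam : ℝ) : Matrix r w ℂ :=
  toC 𝒞 * Gtf 𝒜 lam * toC ℬ

/-- `F(iλ) F(iλ)*`. -/
def PhiTf (𝒜 : Matrix x x ℝ) (ℬ : Matrix x w ℝ) (𝒞 : Matrix r x ℝ) (lam : ℝ) : Matrix r r ℂ :=
  Ftf 𝒜 ℬ 𝒞 lam * (Ftf 𝒜 ℬ 𝒞 lam)ᴴ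

/-- `F(iλ) J F(iλ)*`. -/
def PsiTf (J : Matrix w w ℝ) (𝒜 : Matrix x x ℝ) (ℬ : Matrix x w ℝ) (𝒞 : Matrix r x ℝ)
    (lam : ℝ) : Matrix r r ℂ :=
  Ftf 𝒜 ℬ 𝒞 lam * toC J * (Ftf 𝒜 ℬ 𝒞 lam)ᴴ

/-- The QEF rate as a function of arbitrary matrices `(𝒜, ℬ, 𝒞)`, not necessarily physically
realizable. -/
def rateTf (J : Matrix w w ℝ) (θ : ℝ) (𝒜 : Matrix x x ℝ) (ℬ : Matrix x w ℝ)
    (𝒞 : Matrix r x ℝ) : ℝ :=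
  rate θ (PhiTf 𝒜 ℬ 𝒞) (PsiTf J 𝒜 ℬ 𝒞)

/-- The square root `S = Ωᵀ / √2` of `Ωᵀ = I - i J`. -/
def Sroot (J : Matrix w w ℝ) : Matrix w w ℂ :=
  ((1 / Real.sqrt 2 : ℝ) : ℂ) • ((1 : Matrix w w ℂ) + Complex.I • toC J)ᵀ

/-- `Σ_θ = S F* φ(2iθΨ) F S`. -/
def SigmaTf (J : Matrix w w ℝ) (θ : ℝ) (𝒜 : Matrix x x ℝ) (ℬ : Matrix x w ℝ)
    (𝒞 : Matrix r x ℝ) (lam : ℝ) : Matrix w w ℂ :=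
  Sroot J * (Ftf 𝒜 ℬ 𝒞 lam)ᴴ * matPhi ((2 * Complex.I * θ) • PsiTf J 𝒜 ℬ 𝒞 lam) *
    Ftf 𝒜 ℬ 𝒞 lam * Sroot J

/-- `Δ_θ = I - θ Σ_θ`. -/
def DeltaTf (J : Matrix w w ℝ) (θ : ℝ) (𝒜 : Matrix x x ℝ) (ℬ : Matrix x w ℝ)
    (𝒞 : Matrix r x ℝ) (lam : ℝ) : Matrix w w ℂ :=
  1 - (θ : ℂ) • SigmaTf J θ 𝒜 ℬ 𝒞 lam

/-- `φ_θ = φ(2iθΨ) F S Δ_θ⁻¹ S`. -/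
def phiTh (J : Matrix w w ℝ) (θ : ℝ) (𝒜 : Matrix x x ℝ) (ℬ : Matrix x w ℝ)
    (𝒞 : Matrix r x ℝ) (lam : ℝ) : Matrix r w ℂ :=
  matPhi ((2 * Complex.I * θ) • PsiTf J 𝒜 ℬ 𝒞 lam) * Ftf 𝒜 ℬ 𝒞 lam * Sroot J *
    (DeltaTf J θ 𝒜 ℬ 𝒞 lam)⁻¹ * Sroot J

/-- `ϖ_θ`: the bottom left block of `φ` of the block matrix
`[2iθΨ, 0; F S Δ_θ⁻¹ S F*, 2iθΨ]`. -/
def varpiTh (J : Matrix w w ℝ) (θ : ℝ) (𝒜 : Matrix x x ℝ) (ℬ : Matrix x w ℝ)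
    (𝒞 : Matrix r x ℝ) (lam : ℝ) : Matrix r r ℂ :=
  (matPhi (Matrix.fromBlocks
    ((2 * Complex.I * θ) • PsiTf J 𝒜 ℬ 𝒞 lam) 0
    (Ftf 𝒜 ℬ 𝒞 lam * Sroot J * (DeltaTf J θ 𝒜 ℬ 𝒞 lam)⁻¹ * Sroot J * (Ftf 𝒜 ℬ 𝒞 lam)ᴴ)
    ((2 * Complex.I * θ) • PsiTf J 𝒜 ℬ 𝒞 lam))).toBlocks₂₁

/-- `ψ_θ = ϖ_θ F J`. -/
def psiTh (J : Matrix w w ℝ) (θ : ℝ) (𝒜 : Matrix x x ℝ) (ℬ : Matrix x w ℝ)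
    (𝒞 : Matrix r x ℝ) (lam : ℝ) : Matrix r w ℂ :=
  varpiTh J θ 𝒜 ℬ 𝒞 lam * Ftf 𝒜 ℬ 𝒞 lam * toC J

/-- Replacement of the bottom right block by zero. -/
def zeroBR {R : Type*} [Zero R] (A : Matrix (x ⊕ r) (x ⊕ w) R) : Matrix (x ⊕ r) (x ⊕ w) R :=
  Matrix.fromBlocks A.toBlocks₁₁ A.toBlocks₁₂ A.toBlocks₂₁ 0

/-- The (real) integrand of the core matrix. -/
def coreIntegrand (J : Matrix w w ℝ) (θ : ℝ) (𝒜 : Matrix x x ℝ) (ℬ : Matrix x w ℝ)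
    (𝒞 : Matrix r x ℝ) (lam : ℝ) : Matrix (x ⊕ r) (x ⊕ w) ℝ :=
  (zeroBR
    (Matrix.fromRows ((Gtf 𝒜 lam)ᴴ * (toC 𝒞)ᵀ) (1 : Matrix r r ℂ) *
      (phiTh J θ 𝒜 ℬ 𝒞 lam + (2 * Complex.I * θ) • psiTh J θ 𝒜 ℬ 𝒞 lam) *
      Matrix.fromCols ((toC ℬ)ᵀ * (Gtf 𝒜 lam)ᴴ) (1 : Matrix w w ℂ))).map Complex.re

/-- The core matrix `χ_θ`. -/
def core (J : Matrix w w ℝ) (θ : ℝ) (𝒜 : Matrix x x ℝ) (ℬ : Matrix x w ℝ)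
    (𝒞 : Matrix r x ℝ) : Matrix (x ⊕ r) (x ⊕ w) ℝ :=
  Matrix.of fun i j => (1 / (2 * Real.pi)) * ∫ lam : ℝ, coreIntegrand J θ 𝒜 ℬ 𝒞 lam i j

end StateSpace

/-! ### The plant, the controller and the closed-loop system -/

/-- Field channels come in conjugate pairs: `Pair k` indexes `2 k` of them. -/
abbrev Pair (k : ℕ) : Type := Fin k × Fin 2

/-- `I ⊗ [0, 1; -1, 0]`, with `k` diagonal blocks. -/
def Jmat (k : ℕ) : Matrix (Pair k) (Pair k) ℝ :=
  (1 : Matrix (Fin k) (Fin k) ℝ) ⊗ₖ !![0, 1; -1, 0]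

/-- The matrix consists of conjugate pairs of rows of a permutation matrix: the pair `a` of its rows
selects the pair `σ a` of channels. -/
def IsFeedthrough {q k : ℕ} (D : Matrix (Pair q) (Pair k) ℝ) : Prop :=
  ∃ σ : Fin q ↪ Fin k, ∀ a i b j, D (a, i) (b, j) = if σ a = b ∧ i = j then 1 else 0

/-- The fixed data: a quantum plant with `n` variables, `m₁ = 2 k₁` input and `p₁ = 2 q₁` output
channels, the CCR matrix `Θ₂` and the feedthrough matrix `d` of the controller (with `ν` variables,
`m₂ = 2 k₂` input and `p₂ = 2 q₂` output channels), and the weights `N`, `K` of the criterion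
process `Z = N x + K c ξ`. -/
structure Setup (n ν k₁ k₂ q₁ q₂ r : ℕ) where
  Θ₁ : Matrix (Fin n) (Fin n) ℝ
  Θ₂ : Matrix (Fin ν) (Fin ν) ℝ
  R₁ : Matrix (Fin n) (Fin n) ℝ
  M₁ : Matrix (Pair k₁) (Fin n) ℝ
  L₁ : Matrix (Pair q₂) (Fin n) ℝ
  D : Matrix (Pair q₁) (Pair k₁) ℝ
  d : Matrix (Pair q₂) (Pair k₂) ℝ
  N : Matrix (Fin r) (Fin n) ℝ
  K : Matrix (Fin r) (Pair q₂) ℝ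
  Θ₁_antisymm : Θ₁ᵀ = -Θ₁
  Θ₂_antisymm : Θ₂ᵀ = -Θ₂
  Θ₁_det : Θ₁.det ≠ 0
  Θ₂_det : Θ₂.det ≠ 0
  R₁_symm : R₁ᵀ = R₁
  D_feed : IsFeedthrough D
  d_feed : IsFeedthrough d

/-- Triples `(R₂, M₂, L₂)` of energy and coupling matrices of the controller. -/
abbrev Controller (ν k₂ q₁ : ℕ) : Type :=
  symMat (Fin ν) × Matrix (Pair k₂) (Fin ν) ℝ × Matrix (Pair q₁) (Fin ν) ℝ

namespace Setup

variable {n ν k₁ k₂ q₁ q₂ r : ℕ} (S : Setup n ν k₁ k₂ q₁ q₂ r)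

/-- `J̃₁ = D J₁ Dᵀ`. -/
def Jt₁ : Matrix (Pair q₁) (Pair q₁) ℝ := S.D * Jmat k₁ * S.Dᵀ

/-- `J̃₂ = d J₂ dᵀ`. -/
def Jt₂ : Matrix (Pair q₂) (Pair q₂) ℝ := S.d * Jmat k₂ * S.dᵀ

/-- The plant matrix `A`. -/
def A : Matrix (Fin n) (Fin n) ℝ :=
  (2 : ℝ) • (S.Θ₁ * (S.R₁ + S.M₁ᵀ * Jmat k₁ * S.M₁ + S.L₁ᵀ * S.Jt₂ * S.L₁))

/-- The plant matrix `B`. -/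
def B : Matrix (Fin n) (Pair k₁) ℝ := (2 : ℝ) • (S.Θ₁ * S.M₁ᵀ)

/-- The plant matrix `C`. -/
def C : Matrix (Pair q₁) (Fin n) ℝ := (2 : ℝ) • (S.D * Jmat k₁ * S.M₁)

/-- The plant matrix `E`. -/
def E : Matrix (Fin n) (Pair q₂) ℝ := (2 : ℝ) • (S.Θ₁ * S.L₁ᵀ)

/-- The controller matrix `a`. -/
def a (c : Controller ν k₂ q₁) : Matrix (Fin ν) (Fin ν) ℝ :=
  (2 : ℝ) • (S.Θ₂ * ((c.1 : Matrix (Fin ν) (Fin ν) ℝ) + c.2.1ᵀ * Jmat k₂ * c.2.1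
    + c.2.2ᵀ * S.Jt₁ * c.2.2))

/-- The controller matrix `b`. -/
def b (c : Controller ν k₂ q₁) : Matrix (Fin ν) (Pair k₂) ℝ := (2 : ℝ) • (S.Θ₂ * c.2.1ᵀ)

/-- The controller matrix `c`. -/
def c (c : Controller ν k₂ q₁) : Matrix (Pair q₂) (Fin ν) ℝ := (2 : ℝ) • (S.d * Jmat k₂ * c.2.1)

/-- The controller matrix `e`. -/
def e (c : Controller ν k₂ q₁) : Matrix (Fin ν) (Pair q₁) ℝ := (2 : ℝ) • (S.Θ₂ * c.2.2ᵀ)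

/-- The CCR matrix of the closed-loop system. -/
def Θ : Matrix (Fin n ⊕ Fin ν) (Fin n ⊕ Fin ν) ℝ := Matrix.fromBlocks S.Θ₁ 0 0 S.Θ₂

/-- The imaginary part of the Ito matrix of the external fields. -/
def J (k₁ k₂ : ℕ) : Matrix (Pair k₁ ⊕ Pair k₂) (Pair k₁ ⊕ Pair k₂) ℝ :=
  Matrix.fromBlocks (Jmat k₁) 0 0 (Jmat k₂)

/-- `𝒜`, as a function of independent matrices `a`, `c`, `e`. -/
def clA (a : Matrix (Fin ν) (Fin ν) ℝ) (c : Matrix (Pair q₂) (Fin ν) ℝ)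
    (e : Matrix (Fin ν) (Pair q₁) ℝ) : Matrix (Fin n ⊕ Fin ν) (Fin n ⊕ Fin ν) ℝ :=
  Matrix.fromBlocks S.A (S.E * c) (e * S.C) a

/-- `ℬ`, as a function of independent matrices `b`, `e`. -/
def clB (b : Matrix (Fin ν) (Pair k₂) ℝ) (e : Matrix (Fin ν) (Pair q₁) ℝ) :
    Matrix (Fin n ⊕ Fin ν) (Pair k₁ ⊕ Pair k₂) ℝ :=
  Matrix.fromBlocks S.B (S.E * S.d) (e * S.D) b

/-- `𝒞`, as a function of `c`. -/
def clC (c : Matrix (Pair q₂) (Fin ν) ℝ) : Matrix (Fin r) (Fin n ⊕ Fin ν) ℝ :=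
  Matrix.fromCols S.N (S.K * c)

/-- `𝒜` for a given controller. -/
def 𝒜 (u : Controller ν k₂ q₁) : Matrix (Fin n ⊕ Fin ν) (Fin n ⊕ Fin ν) ℝ :=
  S.clA (S.a u) (S.c u) (S.e u)

/-- `ℬ` for a given controller. -/
def ℬ (u : Controller ν k₂ q₁) : Matrix (Fin n ⊕ Fin ν) (Pair k₁ ⊕ Pair k₂) ℝ :=
  S.clB (S.b u) (S.e u)

/-- `𝒞` for a given controller. -/
def 𝒞 (u : Controller ν k₂ q₁) : Matrix (Fin r) (Fin n ⊕ Fin ν) ℝ :=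
  S.clC (S.c u)

/-- `Λ` for the closed-loop system. -/
def Lam (u : Controller ν k₂ q₁) : ℝ → Matrix (Fin r) (Fin r) ℝ :=
  kernelLam S.Θ (S.𝒜 u) (S.𝒞 u)

/-- `P` for the closed-loop system. -/
def P (u : Controller ν k₂ q₁) : ℝ → Matrix (Fin r) (Fin r) ℝ :=
  kernelP (S.𝒜 u) (S.ℬ u) (S.𝒞 u)

/-- `Φ`, the Fourier transform of `P`. -/
def Phi (u : Controller ν k₂ q₁) : ℝ → Matrix (Fin r) (Fin r) ℂ := fourierMat (S.P u)

/-- `Ψ`, the Fourier transform of `Λ`. -/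
def Psi (u : Controller ν k₂ q₁) : ℝ → Matrix (Fin r) (Fin r) ℂ := fourierMat (S.Lam u)

/-- The QEF rate `Υ_θ` of the closed-loop system in the invariant Gaussian state. -/
def Ups (θ : ℝ) (u : Controller ν k₂ q₁) : ℝ := rate θ (S.Phi u) (S.Psi u)

/-- The QEF rate as a function of independent controller matrices `a`, `b`, `c`, `e`. -/
def UpsTf (θ : ℝ) (a : Matrix (Fin ν) (Fin ν) ℝ) (b : Matrix (Fin ν) (Pair k₂) ℝ)
    (c : Matrix (Pair q₂) (Fin ν) ℝ) (e : Matrix (Fin ν) (Pair q₁) ℝ) : ℝ :=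
  rateTf (J k₁ k₂) θ (S.clA a c e) (S.clB b e) (S.clC c)

/-- The controller is stabilizing and satisfies the spectral constraint: the feasible set of the
risk-sensitive control problem `Υ_θ → inf`. -/
def Feasible (θ : ℝ) (u : Controller ν k₂ q₁) : Prop :=
  IsHurwitz (S.𝒜 u) ∧ SpecConstraint θ (S.Phi u) (S.Psi u)

/-- Admissible controllers: feasible, with a completely noncommutative process `Z`. -/
def Admissible (θ : ℝ) (u : Controller ν k₂ q₁) : Prop :=
  S.Feasible θ u ∧ ∀ᶠ T : ℝ in atTop, InjOnHorizon (S.Lam u) T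

/-- `Γ₁`. -/
def Γ₁ : Matrix ((Fin n ⊕ Fin ν) ⊕ Fin r) (Fin ν ⊕ Pair q₂) ℝ :=
  Matrix.fromRows (Matrix.fromBlocks 0 S.E 1 0) (Matrix.fromCols 0 S.K)

/-- `Γ₂`. -/
def Γ₂ : Matrix (Fin ν ⊕ (Pair k₂ ⊕ Pair q₁)) ((Fin n ⊕ Fin ν) ⊕ (Pair k₁ ⊕ Pair k₂)) ℝ :=
  Matrix.fromRows (Matrix.fromCols (Matrix.fromCols 0 1) 0)
    (Matrix.fromRows (Matrix.fromCols 0 (Matrix.fromCols 0 1))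
      (Matrix.fromCols (Matrix.fromCols S.C 0) (Matrix.fromCols S.D 0)))

/-- `θ Γ₁ᵀ χ_θ Γ₂ᵀ`. -/
def derMat (θ : ℝ) (u : Controller ν k₂ q₁) :
    Matrix (Fin ν ⊕ Pair q₂) (Fin ν ⊕ (Pair k₂ ⊕ Pair q₁)) ℝ :=
  θ • ((S.Γ₁)ᵀ * core (J k₁ k₂) θ (S.𝒜 u) (S.ℬ u) (S.𝒞 u) * (S.Γ₂)ᵀ)

/-- The block `∂_a Υ_θ` of `θ Γ₁ᵀ χ_θ Γ₂ᵀ`. -/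
def da (θ : ℝ) (u : Controller ν k₂ q₁) : Matrix (Fin ν) (Fin ν) ℝ := (S.derMat θ u).toBlocks₁₁

/-- The block `∂_b Υ_θ`. -/
def db (θ : ℝ) (u : Controller ν k₂ q₁) : Matrix (Fin ν) (Pair k₂) ℝ :=
  (S.derMat θ u).toBlocks₁₂.toCols₁

/-- The block `∂_e Υ_θ`. -/
def de (θ : ℝ) (u : Controller ν k₂ q₁) : Matrix (Fin ν) (Pair q₁) ℝ :=
  (S.derMat θ u).toBlocks₁₂.toCols₂

/-- The block `∂_c Υ_θ`. -/
def dc (θ : ℝ) (u : Controller ν k₂ q₁) : Matrix (Pair q₂) (Fin ν) ℝ := (S.derMat θ u).toBlocks₂₁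

end Setup

end CoherentQEF

end

/-! Everything rests on one determinant identity. Put z = θΨ, which is skew-Hermitian. From e^{iz} =
cos z + i z sinc z one gets cos(z) e^{iz} = I + i z φ(2iz) and sinc(z) e^{iz} = φ(2iz), hence D_θ
e^{iθΨ} = I - θ(Φ - iΨ)φ(2iθΨ). Because S² = I - iJ, the factor Φ - iΨ equals F S S F*, and det(I -
XY) = det(I - YX) gives det Δ_θ = det D_θ · exp(iθ Tr Ψ) (`dX_mul_exp`, `det_dX_mul_exp`). The
exponent is real, and it is odd in λ because F(-iλ) is the complex conjugate of F(iλ). It therefore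
integrates to zero, and the rate is -(1/4π) ∫ ln det Δ_θ dλ (`rateTf_eq`).

The logarithm makes sense because D_θ = (I - θΦ tanc(θΨ)) cos(θΨ), where the cosine is positive
definite and det(I - sθΦ tanc(θΨ)) is real and, by the spectral constraint, does not vanish for 0 ≤
s ≤ 1 (`det_one_sub_tancX_pos`).

For fixed λ, Jacobi's formula differentiates ln det Δ_θ. The derivative of φ is an off-diagonal
block of φ of a block triangular matrix (`fderiv_matPhi`) and is self-adjoint for the trace form
(`trace_mul_phiDeriv`). Consequently a variation Y of F changes ln det Δ_θ by -2θ Re Tr(Y*(φ_θ +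
2iθψ_θ)) (`trace_inv_mul_deriv`). Substituting the derivative of F = 𝒞Gℬ produces the integrand of
the core matrix (`frob_coreIntegrand`).

To differentiate under the integral, note that F and its derivative are O(1/|λ|) uniformly near a
stable system, while φ_θ + 2iθψ_θ is O(|F|), so the derivative of the integrand is O(1/λ²). The
constraint is an open condition on F that holds at F = 0; hence all transfer matrices of nearby
systems lie in one compact set on which it holds (`StableBelow.exists_compact`), which makes the
bounds uniform (`hasFDerivAt_rateTf`).

The time-domain cost is brought to this form by Fourier transforms of matrix exponentials together
with two Lyapunov equations, one for the Gramian and one expressing preservation of the commutation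
relations (`IsHurwitz.fourierMat_eq`, `physical_realizability`). Finally, (𝒜, ℬ, 𝒞) is affine in (a,
b, c, e) with linear part Γ₁ [a b e; c 0 0] Γ₂ (`sysMat_eq`), and (a, b, c, e) is polynomial in (R₂,
M₂, L₂), so the gradients follow by transposition (`frob_gradients`). Feasible controllers form an
open set, so all gradients vanish at a constrained local minimum. -/

noncomputable section

namespace CoherentQEF

set_option linter.unusedSectionVars false

/-! ### Entire functions on a complex Banach algebra -/

section BanachAlgebra

variable {𝔸 : Type*} [NormedRing 𝔸] [NormedAlgebra ℂ 𝔸] [CompleteSpace 𝔸]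

theorem summable_smul_pow_of_norm_le {c : ℕ → ℂ} (hc : ∀ k, ‖c k‖ ≤ ‖((k.factorial : ℂ))⁻¹‖) (A : 𝔸) :
    Summable fun k => c k • A ^ k := by
  refine Summable.of_norm_bounded (NormedSpace.norm_expSeries_summable' (𝕂 := ℂ) A) fun k => ?_
  rw [norm_smul, norm_smul]
  exact mul_le_mul_of_nonneg_right (hc k) (norm_nonneg _)

/-- The ratio condition makes the radius of convergence infinite, so the sum is analytic on the
whole algebra. -/
theorem contDiff_tsum_smul_pow {c : ℕ → ℂ} (h0 : ∀ k, c k ≠ 0)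
    (hc : Tendsto (fun k => ‖c k.succ‖ / ‖c k‖) atTop (𝓝 0)) :
    ContDiff ℂ 2 fun A : 𝔸 => ∑' k, c k • A ^ k := by
  have hr := FormalMultilinearSeries.ofScalars_radius_eq_top_of_tendsto 𝔸 c
    (Eventually.of_forall h0) hc
  have h := (FormalMultilinearSeries.ofScalars 𝔸 c).hasFPowerSeriesOnBall (by rw [hr]; simp)
  rw [hr] at h
  have ha : AnalyticOnNhd ℂ (FormalMultilinearSeries.ofScalars 𝔸 c).sum Set.univ := by
    intro x _
    exact h.analyticAt_of_mem (by simp)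
  have := ha.contDiff (n := 2)
  convert this using 1
  ext A
  exact (FormalMultilinearSeries.ofScalars_sum_eq c A).symm

theorem tendsto_inv_natCast_add_atTop (a b : ℕ) (ha : 0 < a) :
    Tendsto (fun k : ℕ => ((a * k + b : ℕ) : ℝ)⁻¹) atTop (𝓝 0) := by
  refine tendsto_inv_atTop_zero.comp (tendsto_natCast_atTop_atTop.comp ?_)
  exact tendsto_atTop_mono (fun k => (Nat.le_mul_of_pos_left k ha).trans (Nat.le_add_right _ _)) tendsto_id

theorem contDiff_phiSeries :
    ContDiff ℂ 2 fun A : 𝔸 => ∑' k : ℕ, (1 / ((k + 1).factorial : ℂ)) • A ^ k := by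
  refine contDiff_tsum_smul_pow (fun k => one_div_ne_zero (Nat.cast_ne_zero.2 (Nat.factorial_ne_zero _))) ?_
  refine (tendsto_inv_natCast_add_atTop 1 2 one_pos).congr fun k => ?_
  have h : ((k + 1).factorial : ℝ) ≠ 0 := by positivity
  simp only [norm_div, norm_one, Complex.norm_natCast, Nat.succ_eq_add_one]
  rw [Nat.factorial_succ (k + 1)]
  push_cast
  field_simp
  ring

/-- The series is taken in powers A ^ k because the ratio test needs nonzero coefficients, whereas
the odd coefficients of sinc vanish. The function sinc is recovered by substituting A². -/
theorem contDiff_sincSeries :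
    ContDiff ℂ 2 fun A : 𝔸 => ∑' k : ℕ, ((-1 : ℂ) ^ k / ((2 * k + 1).factorial : ℂ)) • A ^ k := by
  refine contDiff_tsum_smul_pow (fun k => div_ne_zero (pow_ne_zero _ (by norm_num))
    (Nat.cast_ne_zero.2 (Nat.factorial_ne_zero _))) ?_
  have h := (tendsto_inv_natCast_add_atTop 2 2 two_pos).mul
    (tendsto_inv_natCast_add_atTop 2 3 two_pos)
  rw [mul_zero] at h
  refine h.congr fun k => ?_
  have h : ((2 * k + 1).factorial : ℝ) ≠ 0 := by positivity
  simp only [norm_div, norm_pow, norm_neg, norm_one, one_pow, Complex.norm_natCast,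
    Nat.succ_eq_add_one]
  rw [show 2 * (k + 1) + 1 = 2 * k + 2 + 1 by ring, Nat.factorial_succ (2 * k + 2),
    Nat.factorial_succ (2 * k + 1)]
  push_cast
  field_simp
  ring

theorem hasSum_phiSeries (A : 𝔸) :
    HasSum (fun k : ℕ => (1 / ((k + 1).factorial : ℂ)) • A ^ k)
      (∑' k : ℕ, (1 / ((k + 1).factorial : ℂ)) • A ^ k) := by
  refine (summable_smul_pow_of_norm_le (fun k => ?_) A).hasSum
  rw [norm_div, norm_one, norm_inv, Complex.norm_natCast, Complex.norm_natCast, one_div]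
  gcongr
  exact Nat.le_succ k

/-- Multiplication by A shifts the series to that of the exponential without its constant term; A
need not be invertible. -/
theorem mul_phiSeries (A : 𝔸) :
    A * (∑' k : ℕ, (1 / ((k + 1).factorial : ℂ)) • A ^ k) = NormedSpace.exp A - 1 := by
  have h1 := (hasSum_phiSeries A).mul_left A
  have h2 := NormedSpace.exp_series_hasSum_exp' (𝕂 := ℂ) A
  rw [← hasSum_nat_add_iff' 1] at h2
  refine h1.unique ?_
  have e : (fun k : ℕ => A * (1 / ((k + 1).factorial : ℂ)) • A ^ k) =
      fun k : ℕ => (((k + 1).factorial : ℂ))⁻¹ • A ^ (k + 1) := by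
    funext k
    rw [mul_smul_comm, ← pow_succ', one_div]
  rw [e]
  simpa using h2

/-- Euler's formula, obtained by splitting the exponential series of iA into even and odd terms. -/
theorem cosSeries_sincSeries (A : 𝔸) :
    NormedSpace.exp (Complex.I • A) =
      (∑' k : ℕ, ((-1 : ℂ) ^ k / ((2 * k).factorial : ℂ)) • A ^ (2 * k)) +
      Complex.I • (A * ∑' k : ℕ, ((-1 : ℂ) ^ k / ((2 * k + 1).factorial : ℂ)) • A ^ (2 * k)) := by
  have hs := NormedSpace.expSeries_summable' (𝕂 := ℂ) A
  have hn := NormedSpace.norm_expSeries_summable' (𝕂 := ℂ) A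
  have he : Summable fun k : ℕ => ((-1 : ℂ) ^ k / ((2 * k).factorial : ℂ)) • A ^ (2 * k) := by
    refine Summable.of_norm_bounded (hn.comp_injective
      (i := fun k => 2 * k) (fun a b h => by simpa using h)) fun k => ?_
    simp [norm_smul]
  have ho : Summable fun k : ℕ => ((-1 : ℂ) ^ k / ((2 * k + 1).factorial : ℂ)) • A ^ (2 * k) := by
    refine Summable.of_norm_bounded (hn.comp_injective
      (i := fun k => 2 * k) (fun a b h => by simpa using h)) fun k => ?_
    simp only [norm_smul, norm_div, norm_pow, norm_neg, norm_one, one_pow, Complex.norm_natCast,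
      Function.comp, norm_inv, one_div]
    gcongr
    omega
  have hsum := HasSum.even_add_odd
    (f := fun k : ℕ => ((k.factorial : ℂ))⁻¹ • (Complex.I • A) ^ k)
    (by
      refine he.hasSum.congr_fun fun k => ?_
      rw [smul_pow, smul_smul, pow_mul, Complex.I_sq]
      congr 1; ring)
    (by
      refine ((ho.hasSum.mul_left A).const_smul Complex.I).congr_fun fun k => ?_
      rw [smul_pow, smul_smul, pow_succ Complex.I, pow_mul, Complex.I_sq, mul_smul_comm, smul_smul,
        ← pow_succ']
      congr 1; ring)
  exact (NormedSpace.exp_series_hasSum_exp' (𝕂 := ℂ) (Complex.I • A)).unique hsum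

end BanachAlgebra

/-! ### Trigonometric functions and φ of matrices -/

section MatrixFunctions

open scoped Matrix.Norms.Frobenius

variable {n m : Type*} [Fintype n] [DecidableEq n] [Fintype m] [DecidableEq m]

theorem contDiff_matPhi : ContDiff ℝ 2 (matPhi : Matrix n n ℂ → Matrix n n ℂ) :=
  (contDiff_phiSeries (𝔸 := Matrix n n ℂ)).restrict_scalars ℝ

theorem continuous_matPhi : Continuous (matPhi : Matrix n n ℂ → Matrix n n ℂ) :=
  contDiff_matPhi.continuous

theorem hasSum_matPhi (A : Matrix n n ℂ) :
    HasSum (fun k : ℕ => (1 / ((k + 1).factorial : ℂ)) • A ^ k) (matPhi A) :=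
  hasSum_phiSeries A

theorem mul_matPhi (A : Matrix n n ℂ) : A * matPhi A = NormedSpace.exp A - 1 :=
  mul_phiSeries A

theorem exp_I_smul (A : Matrix n n ℂ) :
    NormedSpace.exp (Complex.I • A) = matCos A + Complex.I • (A * matSinc A) :=
  cosSeries_sincSeries A

theorem matCos_neg (A : Matrix n n ℂ) : matCos (-A) = matCos A := by
  simp only [matCos, (even_two_mul _).neg_pow]

theorem matSinc_neg (A : Matrix n n ℂ) : matSinc (-A) = matSinc A := by
  simp only [matSinc, (even_two_mul _).neg_pow]

theorem exp_neg_I_smul (A : Matrix n n ℂ) :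
    NormedSpace.exp (-(Complex.I • A)) = matCos A - Complex.I • (A * matSinc A) := by
  have h := exp_I_smul (-A)
  rwa [matCos_neg, matSinc_neg, smul_neg, neg_mul, smul_neg, ← sub_eq_add_neg] at h

theorem matCos_eq (A : Matrix n n ℂ) :
    matCos A = (1 / 2 : ℂ) •
      (NormedSpace.exp (Complex.I • A) + NormedSpace.exp (-(Complex.I • A))) := by
  rw [exp_I_smul, exp_neg_I_smul, add_add_sub_cancel, ← two_smul ℂ, smul_smul]
  norm_num

theorem continuous_matSinc : Continuous (matSinc : Matrix n n ℂ → Matrix n n ℂ) := by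
  have h : Continuous fun A : Matrix n n ℂ =>
      ∑' k : ℕ, ((-1 : ℂ) ^ k / ((2 * k + 1).factorial : ℂ)) • A ^ k :=
    (contDiff_sincSeries (𝔸 := Matrix n n ℂ)).continuous
  have h2 := h.comp (continuous_pow (M := Matrix n n ℂ) 2)
  refine h2.congr fun A => ?_
  simp only [matSinc, Function.comp, pow_mul]

theorem continuous_matExp :
    Continuous (NormedSpace.exp : Matrix n n ℂ → Matrix n n ℂ) :=
  NormedSpace.exp_continuous (𝔸 := Matrix n n ℂ)

theorem continuous_matCos : Continuous (matCos : Matrix n n ℂ → Matrix n n ℂ) := by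
  have h : Continuous fun A : Matrix n n ℂ => (1 / 2 : ℂ) •
      (NormedSpace.exp (Complex.I • A) + NormedSpace.exp (-(Complex.I • A))) := by
    have := continuous_matExp (n := n)
    fun_prop
  exact h.congr fun A => (matCos_eq A).symm

/-- Power series in intertwined matrices are intertwined. -/
theorem matPhi_mul_of_mul_eq {A : Matrix n n ℂ} {B : Matrix m m ℂ} {Q : Matrix n m ℂ}
    (h : A * Q = Q * B) : matPhi A * Q = Q * matPhi B := by
  have hp : ∀ k : ℕ, A ^ k * Q = Q * B ^ k := by
    intro k
    induction k with
    | zero => simp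
    | succ k ih => rw [pow_succ, Matrix.mul_assoc, h, ← Matrix.mul_assoc, ih, Matrix.mul_assoc,
        ← pow_succ]
  have h1 := (hasSum_matPhi A).map (AddMonoidHom.mk' (fun Y : Matrix n n ℂ => Y * Q)
    (fun a b => Matrix.add_mul a b Q)) (by
      show Continuous fun Y : Matrix n n ℂ => Y * Q
      fun_prop)
  have h2 := (hasSum_matPhi B).map (AddMonoidHom.mk' (fun Y : Matrix m m ℂ => Q * Y)
    (fun a b => Matrix.mul_add Q a b)) (by
      show Continuous fun Y : Matrix m m ℂ => Q * Y
      fun_prop)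
  refine h1.unique ?_
  refine h2.congr_fun fun k => ?_
  simp only [Function.comp, AddMonoidHom.mk'_apply, Matrix.smul_mul, Matrix.mul_smul, hp]

theorem matPhi_conjTranspose (A : Matrix n n ℂ) : matPhi Aᴴ = (matPhi A)ᴴ := by
  have h1 := (hasSum_matPhi A).matrix_conjTranspose
  refine (hasSum_matPhi Aᴴ).unique ?_
  convert h1 using 1
  ext1 k
  rw [conjTranspose_smul, conjTranspose_pow]
  congr 1
  simp

theorem matPhi_isHermitian {A : Matrix n n ℂ} (h : A.IsHermitian) : (matPhi A).IsHermitian := by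
  rw [Matrix.IsHermitian, ← matPhi_conjTranspose, h.eq]

theorem matSinc_conjTranspose (A : Matrix n n ℂ) : (matSinc A)ᴴ = matSinc Aᴴ := by
  simp only [matSinc, conjTranspose_tsum, conjTranspose_smul, conjTranspose_pow]
  congr! 3
  simp

/-- The spectrum is finite and the shifts 1/(k+1) are distinct, so only finitely many of them can be
singular. This density of invertible matrices lets identities proved by cancelling A pass to all A.
-/
theorem exists_seq_isUnit_add_smul_one (A : Matrix n n ℂ) :
    ∃ u : ℕ → ℂ, Tendsto u atTop (𝓝 0) ∧ ∀ᶠ k in atTop, IsUnit (A + u k • (1 : Matrix n n ℂ)) := by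
  refine ⟨fun k => ((k : ℂ) + 1)⁻¹, ?_, ?_⟩
  · simpa using tendsto_one_div_add_atTop_nhds_zero_nat (𝕜 := ℂ)
  · have hinj : Function.Injective fun k : ℕ => -((k : ℂ) + 1)⁻¹ := by
      intro a b h
      simpa using h
    have hf := (Matrix.finite_spectrum A).preimage hinj.injOn
    have := hf.eventually_cofinite_notMem
    rw [Nat.cofinite_eq_atTop] at this
    filter_upwards [this] with k hk
    simp only [Set.mem_preimage, spectrum.mem_iff, not_not] at hk
    have := hk.neg
    convert this using 1
    rw [Algebra.algebraMap_eq_smul_one]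
    simp [neg_smul]

/-- After multiplication by 2iA both sides become e^{2iA} - 1, which settles invertible A;
continuity does the rest. -/
theorem exp_mul_matSinc (A : Matrix n n ℂ) :
    NormedSpace.exp (Complex.I • A) * matSinc A = matPhi ((2 * Complex.I) • A) := by
  have key : ∀ A : Matrix n n ℂ, IsUnit A →
      NormedSpace.exp (Complex.I • A) * matSinc A = matPhi ((2 * Complex.I) • A) := by
    intro A hA
    have h1 : (2 * Complex.I) • (A * matSinc A) =
        NormedSpace.exp (Complex.I • A) - NormedSpace.exp (-(Complex.I • A)) := by
      rw [exp_I_smul, exp_neg_I_smul, mul_smul, two_smul]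
      abel
    have h2 := mul_matPhi ((2 * Complex.I) • A)
    have h3 : NormedSpace.exp ((2 * Complex.I) • A) =
        NormedSpace.exp (Complex.I • A) * NormedSpace.exp (Complex.I • A) := by
      rw [← Matrix.exp_add_of_commute _ _ (Commute.refl _), mul_smul, two_smul]
    have h4 : NormedSpace.exp (Complex.I • A) * NormedSpace.exp (-(Complex.I • A)) = 1 := by
      rw [← Matrix.exp_add_of_commute _ _ (Commute.refl (Complex.I • A)).neg_right, add_neg_cancel,
        NormedSpace.exp_zero]
    have h5 : Commute A (NormedSpace.exp (Complex.I • A)) :=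
      Commute.exp_right ((Commute.refl A).smul_right _)
    refine hA.mul_left_cancel ?_
    have : (2 * Complex.I) • (A * (NormedSpace.exp (Complex.I • A) * matSinc A)) =
        (2 * Complex.I) • (A * matPhi ((2 * Complex.I) • A)) := by
      rw [← Matrix.smul_mul (2 * Complex.I) A (matPhi _), h2, ← mul_assoc, h5.eq, mul_assoc,
        ← mul_smul_comm, h1, mul_sub, h4, h3]
    exact smul_right_injective _ (by simp : (2 * Complex.I) ≠ 0) this
  obtain ⟨u, hu, hk⟩ := exists_seq_isUnit_add_smul_one A
  have hlim : Tendsto (fun k => A + u k • (1 : Matrix n n ℂ)) atTop (𝓝 A) := by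
    have := tendsto_const_nhds (x := A) |>.add (hu.smul_const (1 : Matrix n n ℂ))
    simpa using this
  have c1 : Continuous fun A : Matrix n n ℂ => NormedSpace.exp (Complex.I • A) * matSinc A := by
    have := continuous_matExp (n := n)
    have := continuous_matSinc (n := n)
    fun_prop
  have c2 : Continuous fun A : Matrix n n ℂ => matPhi ((2 * Complex.I) • A) := by
    have := continuous_matPhi (n := n)
    fun_prop
  refine tendsto_nhds_unique_of_eventuallyEq ((c1.tendsto A).comp hlim)
    ((c2.tendsto A).comp hlim) ?_
  filter_upwards [hk] with k hk
  exact key _ hk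

end MatrixFunctions

theorem hasDerivAt_add_smul {E : Type*} [NormedAddCommGroup E] [NormedSpace ℝ E] (x y : E) (t : ℝ) :
    HasDerivAt (fun s : ℝ => x + s • y) y t := by
  simpa using ((hasDerivAt_id t).smul_const y).const_add x

/-! ### Derivatives of products, adjoints and determinants of matrices -/

section MatrixCalculus

open scoped Matrix.Norms.Frobenius

variable {l m n : Type*} [Fintype l] [Fintype m] [Fintype n]

theorem hasDerivAt_matrix_iff {A : ℝ → Matrix m n ℂ} {A' : Matrix m n ℂ} {t : ℝ} :
    HasDerivAt A A' t ↔ ∀ i j, HasDerivAt (fun s => A s i j) (A' i j) t :=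
  hasDerivAt_pi.trans (forall_congr' fun _ => hasDerivAt_pi)

theorem hasDerivAt_matrix_mul {A : ℝ → Matrix l m ℂ} {B : ℝ → Matrix m n ℂ} {A' : Matrix l m ℂ}
    {B' : Matrix m n ℂ} {t : ℝ} (hA : HasDerivAt A A' t) (hB : HasDerivAt B B' t) :
    HasDerivAt (fun s => A s * B s) (A' * B t + A t * B') t := by
  rw [hasDerivAt_matrix_iff] at *
  intro i j
  simp only [Matrix.mul_apply, Matrix.add_apply, ← Finset.sum_add_distrib]
  exact HasDerivAt.fun_sum fun k _ => (hA i k).mul (hB k j)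

theorem hasDerivAt_conjTranspose {A : ℝ → Matrix l m ℂ} {A' : Matrix l m ℂ} {t : ℝ}
    (hA : HasDerivAt A A' t) : HasDerivAt (fun s => (A s)ᴴ) A'ᴴ t := by
  rw [hasDerivAt_matrix_iff] at *
  intro i j
  exact (hA j i).star

theorem hasDerivAt_const_mul_matrix (C : Matrix l m ℂ) {B : ℝ → Matrix m n ℂ}
    {B' : Matrix m n ℂ} {t : ℝ} (hB : HasDerivAt B B' t) :
    HasDerivAt (fun s => C * B s) (C * B') t := by
  simpa using hasDerivAt_matrix_mul (hasDerivAt_const t C) hB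

theorem hasDerivAt_mul_const_matrix {A : ℝ → Matrix l m ℂ} {A' : Matrix l m ℂ}
    (C : Matrix m n ℂ) {t : ℝ} (hA : HasDerivAt A A' t) :
    HasDerivAt (fun s => A s * C) (A' * C) t := by
  simpa using hasDerivAt_matrix_mul hA (hasDerivAt_const t C)

variable [DecidableEq n]

theorem contDiff_matrix_det {k : WithTop ℕ∞} : ContDiff ℝ k (fun A : Matrix n n ℂ => A.det) := by
  have hentry : ∀ i j, ContDiff ℝ k (fun A : Matrix n n ℂ => A i j) := fun i j =>
    (LinearMap.toContinuousLinearMap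
      ({ toFun := fun A => A i j, map_add' := fun _ _ => rfl, map_smul' := fun _ _ => rfl } :
        Matrix n n ℂ →ₗ[ℝ] ℂ)).contDiff
  simp only [Matrix.det_apply]
  refine ContDiff.sum fun σ _ => ContDiff.const_smul _ ?_
  exact contDiff_prod fun i _ => hentry _ _

/-- Jacobi's formula at an invertible matrix. -/
theorem hasDerivAt_det {A : ℝ → Matrix n n ℂ} {A' : Matrix n n ℂ} {t : ℝ}
    (hA : HasDerivAt A A' t) (hdet : (A t).det ≠ 0) :
    HasDerivAt (fun s => (A s).det) ((A t).det * ((A t)⁻¹ * A').trace) t := by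
  have hd : DifferentiableAt ℝ (fun A : Matrix n n ℂ => A.det) (A t) :=
    (contDiff_matrix_det (k := 1)).differentiable (by norm_num) _
  have h1 := hd.hasFDerivAt.comp_hasDerivAt t hA
  have hline : HasDerivAt (fun s : ℝ => A t + s • A') A' 0 :=
    hasDerivAt_add_smul _ _ _
  have hd0 : HasFDerivAt (fun A : Matrix n n ℂ => A.det)
      (fderiv ℝ (fun A : Matrix n n ℂ => A.det) (A t)) ((fun s : ℝ => A t + s • A') 0) := by
    simpa using hd.hasFDerivAt
  have h2 := hd0.comp_hasDerivAt 0 hline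
  have hu : IsUnit (A t).det := isUnit_iff_ne_zero.2 hdet
  set B := (A t)⁻¹ * A' with hB
  -- It suffices to evaluate the differential of det on the tangent line. There det(1 + sB) = 1 + s
  -- Tr B + s² p(s) with a polynomial p, and only the linear term survives at s = 0.
  have h3 : HasDerivAt (fun s : ℝ => (A t + s • A').det) ((A t).det * B.trace) 0 := by
    set p := (det (1 + (Polynomial.X : Polynomial ℂ) • B.map Polynomial.C)).divX.divX
    have e : (fun s : ℝ => (A t + s • A').det) = fun s : ℝ =>
        (A t).det * (1 + B.trace * (s : ℂ) + p.eval (s : ℂ) * (s : ℂ) ^ 2) := by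
      funext s
      rw [← Matrix.det_one_add_smul, ← Matrix.det_mul]
      congr 1
      rw [mul_add, mul_one, mul_smul_comm, hB, Matrix.mul_nonsing_inv_cancel_left _ _ hu]
      rfl
    rw [e]
    have hs : HasDerivAt (fun s : ℝ => (s : ℂ)) 1 0 := Complex.ofRealCLM.hasDerivAt
    have hp : HasDerivAt (fun s : ℝ => p.eval (s : ℂ)) (p.derivative.eval ((0 : ℝ) : ℂ)) 0 := by
      exact (p.hasDerivAt ((0 : ℝ) : ℂ)).comp_ofReal
    have := (((hs.const_mul B.trace).const_add 1).add (hp.mul (hs.pow 2))).const_mul (A t).det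
    refine this.congr_deriv ?_
    simp
  have h4 := h2.unique h3
  rw [← h4]
  exact h1

/-- By Jacobi's formula, det(e^{sA}) e^{-s Tr A} has zero derivative in s, and it equals 1 at s = 0.
-/
theorem matrix_det_exp (A : Matrix n n ℂ) :
    (NormedSpace.exp A).det = Complex.exp A.trace := by
  have hne : ∀ t : ℝ, (NormedSpace.exp (t • A)).det ≠ 0 := fun t =>
    ((Matrix.isUnit_iff_isUnit_det (NormedSpace.exp (t • A))).1 (Matrix.isUnit_exp (t • A))).ne_zero
  have hd : ∀ t : ℝ, HasDerivAt (fun s : ℝ => (NormedSpace.exp (s • A)).det *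
      Complex.exp (-(s : ℂ) * A.trace)) 0 t := by
    intro t
    have h1 : HasDerivAt (fun s : ℝ => NormedSpace.exp (s • A)) (NormedSpace.exp (t • A) * A) t :=
      hasDerivAt_exp_smul_const (𝕂 := ℝ) A t
    have h2 := hasDerivAt_det h1 (hne t)
    rw [← Matrix.mul_assoc, Matrix.nonsing_inv_mul _ (isUnit_iff_ne_zero.2 (hne t)),
      Matrix.one_mul] at h2
    have h3 : HasDerivAt (fun s : ℝ => Complex.exp (-(s : ℂ) * A.trace))
        (Complex.exp (-(t : ℂ) * A.trace) * (-1 * A.trace)) t := by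
      have hs : HasDerivAt (fun s : ℝ => (s : ℂ)) 1 t := Complex.ofRealCLM.hasDerivAt
      exact (hs.neg.mul_const A.trace).cexp
    have := h2.mul h3
    refine this.congr_deriv ?_
    ring
  have hc := is_const_of_deriv_eq_zero (fun t => (hd t).differentiableAt)
    (fun t => (hd t).deriv) 1 0
  simp only [one_smul, Complex.ofReal_one, zero_smul, NormedSpace.exp_zero, det_one,
    Complex.ofReal_zero, neg_zero, zero_mul, Complex.exp_zero, mul_one, neg_mul, one_mul] at hc
  rw [Complex.exp_neg] at hc
  exact (mul_inv_eq_one₀ (Complex.exp_ne_zero _)).1 hc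

end MatrixCalculus

/-! ### The derivative of φ through block triangular matrices -/

section PhiDerivative

open scoped Matrix.Norms.Frobenius

variable {n : Type*} [Fintype n] [DecidableEq n]

theorem matPhi_fromBlocks_toBlocks (M Z M' : Matrix n n ℂ) :
    (matPhi (fromBlocks M 0 Z M')).toBlocks₁₂ = 0 ∧
      (matPhi (fromBlocks M 0 Z M')).toBlocks₂₂ = matPhi M' := by
  have h : fromBlocks M 0 Z M' * (fromRows 0 1 : Matrix (n ⊕ n) n ℂ) =
      (fromRows 0 1 : Matrix (n ⊕ n) n ℂ) * M' := by
    rw [fromBlocks_mul_fromRows, fromRows_mul]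
    simp
  have h2 := matPhi_mul_of_mul_eq h
  set N := matPhi (fromBlocks M 0 Z M')
  rw [← fromBlocks_toBlocks N, fromBlocks_mul_fromRows, fromRows_mul] at h2
  obtain ⟨h3, h4⟩ := fromRows_inj h2
  constructor
  · simpa using h3
  · simpa using h4

/-- An exact divided difference. The block column (t, -1) intertwines the triangular matrix with M,
hence also their images under φ; the bottom row of that relation is the formula. -/
theorem matPhi_add_smul (M Z : Matrix n n ℂ) (t : ℝ) :
    matPhi (M + t • Z) - matPhi M = t • (matPhi (fromBlocks M 0 Z (M + t • Z))).toBlocks₂₁ := by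
  rcases eq_or_ne t 0 with rfl | ht
  · simp
  have h : fromBlocks M 0 Z (M + t • Z) * (fromRows (t • 1) (-1) : Matrix (n ⊕ n) n ℂ) =
      (fromRows (t • 1) (-1) : Matrix (n ⊕ n) n ℂ) * M := by
    rw [fromBlocks_mul_fromRows, fromRows_mul]
    simp
  have h2 := matPhi_mul_of_mul_eq h
  obtain ⟨-, h22⟩ := matPhi_fromBlocks_toBlocks M Z (M + t • Z)
  set N := matPhi (fromBlocks M 0 Z (M + t • Z))
  rw [← fromBlocks_toBlocks N, fromBlocks_mul_fromRows, fromRows_mul] at h2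
  have h3 := (fromRows_inj h2).2
  rw [h22] at h3
  simp only [Matrix.mul_smul, Matrix.mul_one, Matrix.mul_neg, Matrix.neg_mul, Matrix.one_mul] at h3
  rw [← sub_eq_zero] at h3 ⊢
  rw [← neg_eq_zero, ← h3]
  abel

/-- The derivative of `φ` at `M` in the direction `Z`. -/
def phiDeriv (M Z : Matrix n n ℂ) : Matrix n n ℂ := (matPhi (fromBlocks M 0 Z M)).toBlocks₂₁

theorem continuous_phiDeriv :
    Continuous fun p : Matrix n n ℂ × Matrix n n ℂ => phiDeriv p.1 p.2 := by
  have h := continuous_matPhi (n := n ⊕ n)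
  have h2 : Continuous fun p : Matrix n n ℂ × Matrix n n ℂ =>
      matPhi (fromBlocks p.1 0 p.2 p.1) :=
    h.comp (Continuous.matrix_fromBlocks continuous_fst continuous_const continuous_snd
      continuous_fst)
  exact continuous_pi fun i => continuous_pi fun j => h2.matrix_elem _ _

/-- Differentiability is known from analyticity, so only the limit of the exact divided difference
as t → 0 has to be identified, and it exists by continuity of φ on block matrices. -/
theorem fderiv_matPhi (M Z : Matrix n n ℂ) :
    fderiv ℝ (matPhi : Matrix n n ℂ → Matrix n n ℂ) M Z = phiDeriv M Z := by
  have hd : DifferentiableAt ℝ (matPhi : Matrix n n ℂ → Matrix n n ℂ) M :=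
    contDiff_matPhi.differentiable (by norm_num) _
  have hline : HasDerivAt (fun s : ℝ => M + s • Z) Z 0 :=
    hasDerivAt_add_smul _ _ _
  have hd0 : HasFDerivAt (matPhi : Matrix n n ℂ → Matrix n n ℂ)
      (fderiv ℝ (matPhi : Matrix n n ℂ → Matrix n n ℂ) M) ((fun s : ℝ => M + s • Z) 0) := by
    simpa using hd.hasFDerivAt
  have h1 := hd0.comp_hasDerivAt 0 hline
  refine h1.unique ?_
  rw [hasDerivAt_iff_tendsto_slope_zero]
  have hc : Continuous fun t : ℝ => (matPhi (fromBlocks M 0 Z (M + t • Z))).toBlocks₂₁ := by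
    have h := continuous_matPhi (n := n ⊕ n)
    have h2 : Continuous fun t : ℝ => matPhi (fromBlocks M 0 Z (M + t • Z)) :=
      h.comp (Continuous.matrix_fromBlocks continuous_const continuous_const continuous_const
        (by fun_prop))
    exact continuous_pi fun i => continuous_pi fun j => h2.matrix_elem _ _
  have h2 : Tendsto (fun t : ℝ => (matPhi (fromBlocks M 0 Z (M + t • Z))).toBlocks₂₁) (𝓝[≠] 0)
      (𝓝 (phiDeriv M Z)) := by
    have := (hc.tendsto 0).mono_left (nhdsWithin_le_nhds (s := {0}ᶜ))
    simpa [phiDeriv] using this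
  refine h2.congr' ?_
  filter_upwards [self_mem_nhdsWithin] with t ht
  have := matPhi_add_smul M Z t
  simp only [Function.comp, zero_add, zero_smul, add_zero]
  rw [this, smul_smul, inv_mul_cancel₀ ht, one_smul]

theorem hasDerivAt_matPhi {M : ℝ → Matrix n n ℂ} {M' : Matrix n n ℂ} {t : ℝ}
    (h : HasDerivAt M M' t) :
    HasDerivAt (fun s => matPhi (M s)) (phiDeriv (M t) M') t := by
  have hd : DifferentiableAt ℝ (matPhi : Matrix n n ℂ → Matrix n n ℂ) (M t) :=
    contDiff_matPhi.differentiable (by norm_num) _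
  rw [← fderiv_matPhi]
  exact hd.hasFDerivAt.comp_hasDerivAt t h

/-- Exchanging the two block coordinates intertwines the adjoint of the triangular block matrix with
the matrix itself, so the bottom left block of φ coincides with its own adjoint. -/
theorem phiDeriv_isHermitian {M Y : Matrix n n ℂ} (hM : M.IsHermitian) (hY : Y.IsHermitian) :
    (phiDeriv M Y).IsHermitian := by
  have h : (fromBlocks M 0 Y M)ᴴ * (fromBlocks 0 1 1 0 : Matrix (n ⊕ n) (n ⊕ n) ℂ) =
      fromBlocks 0 1 1 0 * fromBlocks M 0 Y M := by
    rw [fromBlocks_conjTranspose, fromBlocks_multiply, fromBlocks_multiply, hM.eq, hY.eq]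
    simp
  have h2 := matPhi_mul_of_mul_eq h
  rw [matPhi_conjTranspose] at h2
  unfold phiDeriv Matrix.IsHermitian
  set N := matPhi (fromBlocks M 0 Y M)
  rw [← fromBlocks_toBlocks N, fromBlocks_conjTranspose, fromBlocks_multiply,
    fromBlocks_multiply, fromBlocks_inj] at h2
  simpa using h2.1

theorem fromBlocks_pow_toBlocks₂₁ (M Z : Matrix n n ℂ) (k : ℕ) :
    (fromBlocks M 0 Z M) ^ k = fromBlocks (M ^ k) 0
      (∑ i ∈ Finset.range k, M ^ i * Z * M ^ (k - 1 - i)) (M ^ k) := by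
  induction k with
  | zero => simp
  | succ k ih =>
    rw [pow_succ, ih, fromBlocks_multiply, Finset.sum_range_succ]
    have : ∀ i ∈ Finset.range k, M ^ i * Z * M ^ (k + 1 - 1 - i) =
        M ^ i * Z * M ^ (k - 1 - i) * M := by
      intro i hi
      rw [Finset.mem_range] at hi
      rw [mul_assoc _ _ M, ← pow_succ, show k - 1 - i + 1 = k + 1 - 1 - i by omega]
    rw [Finset.sum_congr rfl this, Finset.sum_mul]
    simp [pow_succ]

/-- The derivative of `φ` is self-adjoint with respect to the trace form. -/
theorem trace_mul_phiDeriv (M Y Z : Matrix n n ℂ) :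
    (Y * phiDeriv M Z).trace = (phiDeriv M Y * Z).trace := by
  have h1 := (hasSum_matPhi (fromBlocks M 0 Z M)).map (AddMonoidHom.mk'
    (fun N : Matrix (n ⊕ n) (n ⊕ n) ℂ => (Y * N.toBlocks₂₁).trace)
    (fun a b => by
      rw [← Matrix.trace_add, ← Matrix.mul_add]; rfl)) (by
      show Continuous fun N : Matrix (n ⊕ n) (n ⊕ n) ℂ => (Y * N.toBlocks₂₁).trace
      have : Continuous fun N : Matrix (n ⊕ n) (n ⊕ n) ℂ => N.toBlocks₂₁ :=
        continuous_pi fun i => continuous_pi fun j => continuous_id.matrix_elem _ _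
      fun_prop)
  have h2 := (hasSum_matPhi (fromBlocks M 0 Y M)).map (AddMonoidHom.mk'
    (fun N : Matrix (n ⊕ n) (n ⊕ n) ℂ => (N.toBlocks₂₁ * Z).trace)
    (fun a b => by
      rw [← Matrix.trace_add, ← Matrix.add_mul]; rfl)) (by
      show Continuous fun N : Matrix (n ⊕ n) (n ⊕ n) ℂ => (N.toBlocks₂₁ * Z).trace
      have : Continuous fun N : Matrix (n ⊕ n) (n ⊕ n) ℂ => N.toBlocks₂₁ :=
        continuous_pi fun i => continuous_pi fun j => continuous_id.matrix_elem _ _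
      fun_prop)
  refine h1.unique (h2.congr_fun fun k => ?_)
  simp only [Function.comp, AddMonoidHom.mk'_apply, fromBlocks_pow_toBlocks₂₁, fromBlocks_smul,
    toBlocks_fromBlocks₂₁, Matrix.mul_smul, Matrix.smul_mul, trace_smul]
  congr 1
  -- The k-th term is the sum over i of Tr(Y M^i Z M^(k-1-i)); reversing i and cycling the trace
  -- exchanges the roles of Y and Z.
  rw [Finset.mul_sum, Finset.sum_mul, trace_sum, trace_sum, ← Finset.sum_range_reflect]
  refine Finset.sum_congr rfl fun i hi => ?_
  rw [Finset.mem_range] at hi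
  rw [show k - 1 - (k - 1 - i) = i by omega, Matrix.mul_assoc, ← Matrix.mul_assoc Y,
    Matrix.trace_mul_comm, Matrix.mul_assoc, Matrix.trace_mul_comm]
  simp only [Matrix.mul_assoc]

end PhiDerivative

/-! ### Positivity of the cosine of a skew-Hermitian matrix -/

section Hermitian

open scoped ComplexOrder

variable {n : Type*} [Fintype n] [DecidableEq n]

/-- The exponential of H is the square of e^{H/2}, which is Hermitian and invertible. -/
theorem posDef_exp {H : Matrix n n ℂ} (hH : H.IsHermitian) : (NormedSpace.exp H).PosDef := by
  have h2 : ((1 / 2 : ℂ) • H).IsHermitian := by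
    rw [Matrix.IsHermitian, conjTranspose_smul, hH.eq]
    congr 1
    simp
  have h3 : NormedSpace.exp H =
      (NormedSpace.exp ((1 / 2 : ℂ) • H))ᴴ * 1 * NormedSpace.exp ((1 / 2 : ℂ) • H) := by
    rw [h2.exp.eq, Matrix.mul_one, ← Matrix.exp_add_of_commute _ _ (Commute.refl _), ← add_smul]
    norm_num
  rw [h3]
  refine PosDef.one.conjTranspose_mul_mul_same (Matrix.mulVec_injective_of_isUnit ?_)
  exact Matrix.isUnit_exp _

variable {z : Matrix n n ℂ}

theorem isHermitian_I_smul (hz : zᴴ = -z) : (Complex.I • z).IsHermitian := by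
  rw [Matrix.IsHermitian, conjTranspose_smul, hz]
  simp

/-- Here iz is Hermitian, so the cosine is the mean of two positive definite exponentials. In
particular tanc(θΨ) is always well defined. -/
theorem posDef_matCos (hz : zᴴ = -z) : (matCos z).PosDef := by
  have h := isHermitian_I_smul hz
  have h' : (-(Complex.I • z)).IsHermitian := by
    rw [Matrix.IsHermitian, conjTranspose_neg, h.eq]
  rw [matCos_eq]
  exact ((posDef_exp h).add (posDef_exp h')).smul (by norm_num)

theorem det_matCos_pos (hz : zᴴ = -z) : 0 < (matCos z).det := (posDef_matCos hz).det_pos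

theorem isUnit_det_matCos (hz : zᴴ = -z) : IsUnit (matCos z).det :=
  isUnit_iff_ne_zero.2 (det_matCos_pos hz).ne'

theorem commute_matSinc (A : Matrix n n ℂ) : Commute A (matSinc A) :=
  Commute.tsum_right _ fun _ => ((Commute.refl A).pow_right _).smul_right _

theorem commute_matCos_matSinc (A : Matrix n n ℂ) : Commute (matCos A) (matSinc A) :=
  Commute.tsum_left _ fun _ => ((commute_matSinc A).pow_left _).smul_left _

theorem matTanc_mul_matCos (hz : zᴴ = -z) : matTanc z * matCos z = matSinc z := by
  rw [matTanc, Matrix.mul_assoc, ← (commute_matCos_matSinc z).eq,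
    Matrix.nonsing_inv_mul_cancel_left _ _ (isUnit_det_matCos hz)]

/-- Both cos z and sinc z are Hermitian and they commute, so the quotient is Hermitian as well. -/
theorem matTanc_isHermitian (hz : zᴴ = -z) : (matTanc z).IsHermitian := by
  have h1 : (matCos z)ᴴ = matCos z := (posDef_matCos hz).isHermitian
  have h2 : (matSinc z)ᴴ = matSinc z := by rw [matSinc_conjTranspose, hz, matSinc_neg]
  have h3 : matCos z * matTanc z = matSinc z := by
    rw [matTanc, Matrix.mul_nonsing_inv_cancel_left _ _ (isUnit_det_matCos hz)]
  have h4 := congrArg conjTranspose h3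
  rw [conjTranspose_mul, h1, h2, ← matTanc_mul_matCos hz] at h4
  have h5 : IsUnit (matCos z) := (posDef_matCos hz).isUnit
  exact h5.mul_right_cancel h4

end Hermitian

section Inverse

open scoped Matrix.Norms.Frobenius

variable {n : Type*} [Fintype n] [DecidableEq n]

theorem continuousAt_matrix_inv {A : Matrix n n ℂ} (h : A.det ≠ 0) :
    ContinuousAt (fun A : Matrix n n ℂ => A⁻¹) A := by
  have h1 : (fun A : Matrix n n ℂ => A⁻¹) = fun A => A.det⁻¹ • A.adjugate := by
    funext A
    rw [Matrix.inv_def, Ring.inverse_eq_inv']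
  rw [h1]
  have hd : Continuous fun A : Matrix n n ℂ => A.det := continuous_id.matrix_det
  have ha : Continuous fun A : Matrix n n ℂ => A.adjugate := continuous_id.matrix_adjugate
  exact (hd.continuousAt.inv₀ h).smul ha.continuousAt

end Inverse

/-! ### The determinant identity and positivity for a fixed transfer matrix -/

section Transfer

variable {w r : Type*} [Fintype w] [DecidableEq w] [Fintype r] [DecidableEq r]

variable (J : Matrix w w ℝ) (θ : ℝ) (X : Matrix r w ℂ)

/-- `X J X*`. -/
def psiX : Matrix r r ℂ := X * toC J * Xᴴ

/-- `2 i θ X J X*`. -/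
def twoPsiX : Matrix r r ℂ := (2 * Complex.I * θ) • psiX J X

/-- `Δ_θ` as a function of the transfer matrix. -/
def deltaX : Matrix w w ℂ :=
  1 - (θ : ℂ) • (Sroot J * Xᴴ * matPhi (twoPsiX J θ X) * X * Sroot J)

/-- `θ Φ tanc (θ Ψ)` as a function of the transfer matrix. -/
def tancX : Matrix r r ℂ := (θ : ℂ) • (X * Xᴴ * matTanc ((θ : ℂ) • psiX J X))

/-- `D_θ` as a function of the transfer matrix. -/
def dX : Matrix r r ℂ :=
  matCos ((θ : ℂ) • psiX J X) - (θ : ℂ) • (X * Xᴴ * matSinc ((θ : ℂ) • psiX J X))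

/-- `φ_θ + 2 i θ ψ_θ` as a function of the transfer matrix. -/
def xiX : Matrix r w ℂ :=
  matPhi (twoPsiX J θ X) * X * Sroot J * (deltaX J θ X)⁻¹ * Sroot J +
    (2 * Complex.I * θ) • (phiDeriv (twoPsiX J θ X)
      (X * Sroot J * (deltaX J θ X)⁻¹ * Sroot J * Xᴴ) * X * toC J)

/-- `ln det Δ_θ` as a function of the transfer matrix. -/
def logDetX : ℝ := Real.log (deltaX J θ X).det.re

/-- The spectral constraint with the bound `c` for a given value of the transfer matrix. -/
def SpecBelow (c : ℝ) : Prop := ∀ y : ℝ, c ≤ y → (y : ℂ) ∉ spectrum ℂ (tancX J θ X)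

variable {J} {θ} {X}

theorem toC_conjTranspose {m n : Type*} (A : Matrix m n ℝ) : (toC A)ᴴ = (toC A)ᵀ := by
  ext i j
  simp [toC]

theorem toC_transpose {m n : Type*} (A : Matrix m n ℝ) : toC Aᵀ = (toC A)ᵀ := rfl

theorem toC_neg {m n : Type*} (A : Matrix m n ℝ) : toC (-A) = -toC A := by
  ext i j
  simp [toC]

theorem toC_mul {l m n : Type*} [Fintype m] (A : Matrix l m ℝ) (B : Matrix m n ℝ) :
    toC (A * B) = toC A * toC B := Matrix.map_mul (f := Complex.ofRealHom)

theorem toC_one {n : Type*} [DecidableEq n] : toC (1 : Matrix n n ℝ) = 1 :=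
  Matrix.map_one _ Complex.ofReal_zero Complex.ofReal_one

theorem toC_conjTranspose_of_antisymm (hJ : Jᵀ = -J) : (toC J)ᴴ = -toC J := by
  rw [toC_conjTranspose, ← toC_transpose, hJ, toC_neg]

theorem sroot_eq (hJ : Jᵀ = -J) :
    Sroot J = ((1 / Real.sqrt 2 : ℝ) : ℂ) • ((1 : Matrix w w ℂ) - Complex.I • toC J) := by
  rw [Sroot, transpose_add, transpose_one, transpose_smul, ← toC_transpose, hJ, toC_neg, smul_neg,
    ← sub_eq_add_neg]

theorem sroot_isHermitian (hJ : Jᵀ = -J) : (Sroot J)ᴴ = Sroot J := by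
  rw [sroot_eq hJ, conjTranspose_smul, conjTranspose_sub, conjTranspose_one, conjTranspose_smul,
    toC_conjTranspose_of_antisymm hJ]
  simp

/-- Since (iJ)² = I, the matrix (I - iJ)/2 is idempotent, and S is √2 times it. -/
theorem sroot_mul_self (hJ : Jᵀ = -J) (hJ2 : J * J = -1) :
    Sroot J * Sroot J = 1 - Complex.I • toC J := by
  have h1 : toC J * toC J = -1 := by rw [← toC_mul, hJ2, toC_neg, toC_one]
  rw [sroot_eq hJ, Matrix.smul_mul, Matrix.mul_smul, smul_smul, sub_mul, mul_sub, mul_sub]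
  have h2 : ((1 / Real.sqrt 2 : ℝ) : ℂ) * ((1 / Real.sqrt 2 : ℝ) : ℂ) = 1 / 2 := by
    rw [← Complex.ofReal_mul]
    norm_num [← mul_inv]
  rw [h2]
  simp only [Matrix.smul_mul, Matrix.mul_smul, Matrix.mul_one, Matrix.one_mul, h1, smul_smul,
    Complex.I_mul_I, neg_smul, one_smul, neg_neg]
  module

theorem psiX_conjTranspose (hJ : Jᵀ = -J) : (psiX J X)ᴴ = -psiX J X := by
  rw [psiX, conjTranspose_mul, conjTranspose_mul, conjTranspose_conjTranspose,
    toC_conjTranspose_of_antisymm hJ, Matrix.neg_mul, Matrix.mul_neg, Matrix.mul_assoc]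

theorem smul_psiX_conjTranspose (hJ : Jᵀ = -J) :
    ((θ : ℂ) • psiX J X)ᴴ = -((θ : ℂ) • psiX J X) := by
  rw [conjTranspose_smul, psiX_conjTranspose hJ]
  simp

theorem twoPsiX_isHermitian (hJ : Jᵀ = -J) : (twoPsiX J θ X).IsHermitian := by
  rw [Matrix.IsHermitian, twoPsiX, conjTranspose_smul, psiX_conjTranspose hJ]
  simp

theorem deltaX_isHermitian (hJ : Jᵀ = -J) : (deltaX J θ X)ᴴ = deltaX J θ X := by
  rw [deltaX, conjTranspose_sub, conjTranspose_one, conjTranspose_smul]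
  simp only [conjTranspose_mul, sroot_isHermitian hJ, conjTranspose_conjTranspose,
    (matPhi_isHermitian (twoPsiX_isHermitian hJ)).eq, Matrix.mul_assoc]
  simp

/-- Multiplication by e^{iz}, z = θΨ, expresses both cos z and sinc z through φ(2iz), and Φ - iΨ is
then recognized as X S S X*. This trades the trigonometric form of the cost for a single entire
function φ. -/
theorem dX_mul_exp (hJ : Jᵀ = -J) (hJ2 : J * J = -1) :
    dX J θ X * NormedSpace.exp (Complex.I • (θ : ℂ) • psiX J X) =
      1 - (θ : ℂ) • (X * Sroot J * (Sroot J * Xᴴ * matPhi (twoPsiX J θ X))) := by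
  set z := (θ : ℂ) • psiX J X with hz
  have h2 : twoPsiX J θ X = (2 * Complex.I) • z := by
    rw [hz, twoPsiX, smul_smul]
  clear_value z
  set e := NormedSpace.exp (Complex.I • z) with he
  have h4 : NormedSpace.exp (-(Complex.I • z)) * e = 1 := by
    rw [← Matrix.exp_add_of_commute _ _ (Commute.refl (Complex.I • z)).neg_left, neg_add_cancel,
      NormedSpace.exp_zero]
  have h5 : e * e = NormedSpace.exp ((2 * Complex.I) • z) := by
    rw [← Matrix.exp_add_of_commute _ _ (Commute.refl _), mul_smul, two_smul]
  have hcos : matCos z * e = 1 + (Complex.I • z) * matPhi ((2 * Complex.I) • z) := by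
    have h6 := mul_matPhi ((2 * Complex.I) • z)
    rw [Matrix.smul_mul] at h6
    rw [matCos_eq, Matrix.smul_mul, add_mul, h4, h5, ← eq_sub_iff_add_eq.1 h6, Matrix.smul_mul]
    generalize z * matPhi ((2 * Complex.I) • z) = q
    module
  have hsinc : matSinc z * e = matPhi ((2 * Complex.I) • z) := by
    rw [← exp_mul_matSinc]
    exact ((commute_matSinc z).smul_left _).exp_left.eq.symm
  have hS : X * Sroot J * (Sroot J * Xᴴ * matPhi ((2 * Complex.I) • z)) =
      (X * Xᴴ - Complex.I • psiX J X) * matPhi ((2 * Complex.I) • z) := by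
    rw [← Matrix.mul_assoc, ← Matrix.mul_assoc, Matrix.mul_assoc X, sroot_mul_self hJ hJ2,
      Matrix.mul_sub, Matrix.mul_one, Matrix.mul_smul, Matrix.sub_mul, Matrix.smul_mul, psiX]
  rw [dX, ← hz, Matrix.sub_mul, hcos, Matrix.smul_mul _ _ e, Matrix.mul_assoc _ (matSinc _), hsinc,
    h2, hS, Matrix.sub_mul, Matrix.smul_mul, Matrix.smul_mul, hz, Matrix.smul_mul (θ : ℂ)]
  module

theorem det_dX_mul_exp (hJ : Jᵀ = -J) (hJ2 : J * J = -1) :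
    (dX J θ X).det * Complex.exp (Complex.I * θ * (psiX J X).trace) = (deltaX J θ X).det := by
  have h := congrArg Matrix.det (dX_mul_exp (X := X) (θ := θ) hJ hJ2)
  rw [det_mul, matrix_det_exp, trace_smul, trace_smul, smul_eq_mul, smul_eq_mul, ← mul_assoc] at h
  rw [h, deltaX, ← Matrix.smul_mul, det_one_sub_mul_comm, Matrix.mul_smul]
  simp only [Matrix.mul_assoc]

/-- `i θ Tr Ψ`, which is real. -/
def traceX (J : Matrix w w ℝ) (θ : ℝ) (X : Matrix r w ℂ) : ℝ :=
  (Complex.I * θ * (psiX J X).trace).re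

/-- The trace of the skew-Hermitian Ψ is purely imaginary. -/
theorem ofReal_traceX (hJ : Jᵀ = -J) :
    (traceX J θ X : ℂ) = Complex.I * θ * (psiX J X).trace := by
  have h := congrArg Matrix.trace (psiX_conjTranspose (X := X) hJ)
  rw [trace_conjTranspose, trace_neg] at h
  rw [traceX]
  apply Complex.conj_eq_iff_re.1
  rw [map_mul, map_mul, Complex.conj_I, Complex.conj_ofReal]
  change _ * star _ = _
  rw [h]
  ring

theorem dX_eq (hJ : Jᵀ = -J) :
    dX J θ X = (1 - tancX J θ X) * matCos ((θ : ℂ) • psiX J X) := by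
  rw [tancX, sub_mul, one_mul, Matrix.smul_mul, Matrix.mul_assoc (X * Xᴴ),
    matTanc_mul_matCos (smul_psiX_conjTranspose hJ), dX]

/-- The matrix is a real multiple of a product of two Hermitian factors. The adjoint reverses their
order, which det(1 - XY) = det(1 - YX) undoes. -/
theorem conj_det_one_sub_smul_tancX (hJ : Jᵀ = -J) (s : ℝ) :
    conj (1 - (s : ℂ) • tancX J θ X).det = (1 - (s : ℂ) • tancX J θ X).det := by
  have hT := matTanc_isHermitian (smul_psiX_conjTranspose (θ := θ) (X := X) hJ)
  change star _ = _
  rw [← det_conjTranspose, conjTranspose_sub, conjTranspose_one, conjTranspose_smul, tancX,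
    conjTranspose_smul, conjTranspose_mul, hT.eq, conjTranspose_mul, conjTranspose_conjTranspose]
  simp only [Complex.star_def, Complex.conj_ofReal]
  rw [smul_smul, ← Matrix.mul_smul, det_one_sub_mul_comm, Matrix.smul_mul, smul_smul]

/-- A homotopy argument: det(1 - sT) is real and continuous in s, equals 1 at s = 0, and cannot
vanish for s in [0, 1], so it keeps its sign up to s = 1. -/
theorem det_one_sub_tancX_pos (hJ : Jᵀ = -J) {c : ℝ} (hc : c ≤ 1) (h : SpecBelow J θ X c) :
    (1 - tancX J θ X).det.im = 0 ∧ 0 < (1 - tancX J θ X).det.re := by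
  have hreal : ∀ s : ℝ, (1 - (s : ℂ) • tancX J θ X).det.im = 0 := fun s =>
    Complex.conj_eq_iff_im.1 (conj_det_one_sub_smul_tancX hJ s)
  have hcont : Continuous fun s : ℝ => (1 - (s : ℂ) • tancX J θ X).det.re := by
    refine Complex.continuous_re.comp (Continuous.matrix_det ?_)
    exact continuous_const.sub (Complex.continuous_ofReal.smul continuous_const)
  have hne : ∀ s ∈ Set.Icc (0 : ℝ) 1, (1 - (s : ℂ) • tancX J θ X).det.re ≠ 0 := by
    intro s hs h0
    have hdet : (1 - (s : ℂ) • tancX J θ X).det = 0 := Complex.ext h0 (hreal s)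
    rcases eq_or_lt_of_le hs.1 with rfl | hpos
    · simp at hdet
    -- A zero at s > 0 would make 1/s ≥ 1 ≥ c an eigenvalue, contrary to the constraint.
    · refine h s⁻¹ (hc.trans ((one_le_inv₀ hpos).2 hs.2)) ?_
      rw [spectrum.mem_iff, Matrix.isUnit_iff_isUnit_det, isUnit_iff_ne_zero, not_not,
        Algebra.algebraMap_eq_smul_one]
      have hs' : (s : ℂ) ≠ 0 := Complex.ofReal_ne_zero.2 hpos.ne'
      have : ((s⁻¹ : ℝ) : ℂ) • (1 : Matrix r r ℂ) - tancX J θ X =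
          ((s⁻¹ : ℝ) : ℂ) • (1 - (s : ℂ) • tancX J θ X) := by
        rw [smul_sub, smul_smul, Complex.ofReal_inv, inv_mul_cancel₀ hs', one_smul]
      rw [this, det_smul, hdet, mul_zero]
  constructor
  · simpa using hreal 1
  · by_contra hle
    push Not at hle
    have h1 : (0 : ℝ) ∈ Set.Icc ((1 - ((1 : ℝ) : ℂ) • tancX J θ X).det.re)
        ((1 - ((0 : ℝ) : ℂ) • tancX J θ X).det.re) := by
      constructor
      · simpa using hle
      · simp
    obtain ⟨s, hs, hs0⟩ := intermediate_value_Icc' zero_le_one hcont.continuousOn h1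
    exact hne s hs hs0

theorem det_dX_pos (hJ : Jᵀ = -J) {c : ℝ} (hc : c ≤ 1) (h : SpecBelow J θ X c) :
    (dX J θ X).det.im = 0 ∧ 0 < (dX J θ X).det.re := by
  obtain ⟨h1, h2⟩ := det_one_sub_tancX_pos hJ hc h
  open scoped ComplexOrder in
  have h3 := det_matCos_pos (smul_psiX_conjTranspose (θ := θ) (X := X) hJ)
  have h4 : 0 < (matCos ((θ : ℂ) • psiX J X)).det.re ∧
      0 = (matCos ((θ : ℂ) • psiX J X)).det.im := Complex.lt_def.1 h3
  rw [dX_eq hJ, det_mul, Complex.mul_im, Complex.mul_re, h1, ← h4.2]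
  constructor
  · ring
  · simpa using mul_pos h2 h4.1

theorem det_deltaX_eq (hJ : Jᵀ = -J) (hJ2 : J * J = -1) :
    (deltaX J θ X).det = (dX J θ X).det * (Real.exp (traceX J θ X) : ℝ) := by
  rw [← det_dX_mul_exp hJ hJ2, Complex.ofReal_exp, ofReal_traceX hJ]

theorem det_deltaX_pos (hJ : Jᵀ = -J) (hJ2 : J * J = -1) {c : ℝ} (hc : c ≤ 1)
    (h : SpecBelow J θ X c) : (deltaX J θ X).det.im = 0 ∧ 0 < (deltaX J θ X).det.re := by
  obtain ⟨h1, h2⟩ := det_dX_pos hJ hc h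
  rw [det_deltaX_eq hJ hJ2, Complex.im_mul_ofReal, Complex.re_mul_ofReal, h1]
  exact ⟨zero_mul _, mul_pos h2 (Real.exp_pos _)⟩

theorem log_det_dX (hJ : Jᵀ = -J) (hJ2 : J * J = -1) {c : ℝ} (hc : c ≤ 1)
    (h : SpecBelow J θ X c) :
    Real.log (dX J θ X).det.re = logDetX J θ X - traceX J θ X := by
  obtain ⟨h1, h2⟩ := det_dX_pos hJ hc h
  rw [logDetX, det_deltaX_eq hJ hJ2, Complex.re_mul_ofReal,
    Real.log_mul h2.ne' (Real.exp_pos _).ne', Real.log_exp]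
  ring

end Transfer

/-! ### Openness of the constraint and the derivative of ln det Δ -/

section TransferCalculus

open scoped Matrix.Norms.Frobenius

variable {w r : Type*} [Fintype w] [DecidableEq w] [Fintype r] [DecidableEq r]
variable {J : Matrix w w ℝ} {θ : ℝ} {X : Matrix r w ℂ}

theorem continuous_psiX : Continuous fun X : Matrix r w ℂ => psiX J X := by
  unfold psiX
  fun_prop

theorem continuous_twoPsiX : Continuous fun X : Matrix r w ℂ => twoPsiX J θ X := by
  unfold twoPsiX
  have := continuous_psiX (r := r) (J := J)
  fun_prop

theorem continuous_deltaX : Continuous fun X : Matrix r w ℂ => deltaX J θ X := by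
  unfold deltaX
  have h : Continuous fun X : Matrix r w ℂ => matPhi (twoPsiX J θ X) :=
    continuous_matPhi.comp continuous_twoPsiX
  fun_prop

theorem continuous_tancX (hJ : Jᵀ = -J) : Continuous fun X : Matrix r w ℂ => tancX J θ X := by
  unfold tancX matTanc
  have hz : Continuous fun X : Matrix r w ℂ => (θ : ℂ) • psiX J X := by
    have := continuous_psiX (r := r) (J := J)
    fun_prop
  have h1 : Continuous fun X : Matrix r w ℂ => matSinc ((θ : ℂ) • psiX J X) :=
    continuous_matSinc.comp hz
  have h2 : Continuous fun X : Matrix r w ℂ => matCos ((θ : ℂ) • psiX J X) :=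
    continuous_matCos.comp hz
  have h3 : Continuous fun X : Matrix r w ℂ => (matCos ((θ : ℂ) • psiX J X))⁻¹ := by
    rw [continuous_iff_continuousAt]
    intro X
    exact ContinuousAt.comp' (f := fun X : Matrix r w ℂ => matCos ((θ : ℂ) • psiX J X))
      (continuousAt_matrix_inv (isUnit_det_matCos (smul_psiX_conjTranspose hJ)).ne_zero)
      h2.continuousAt
  fun_prop

theorem isOpen_specBelow (hJ : Jᵀ = -J) (c : ℝ) :
    IsOpen {X : Matrix r w ℂ | SpecBelow J θ X c} := by
  have hcl : IsClosed ((fun y : ℝ => (y : ℂ)) '' Set.Ici c) :=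
    Complex.isometry_ofReal.isClosedEmbedding.isClosedMap _ isClosed_Ici
  have hiff : ∀ M : Matrix r r ℂ, (∀ y : ℝ, c ≤ y → (y : ℂ) ∉ spectrum ℂ M) ↔
      spectrum ℂ M ⊆ ((fun y : ℝ => (y : ℂ)) '' Set.Ici c)ᶜ := by
    intro M
    constructor
    · rintro h z hz ⟨y, hy, rfl⟩
      exact h y hy hz
    · intro h y hy hz
      exact h hz ⟨y, hy, rfl⟩
  have hopen : IsOpen {M : Matrix r r ℂ | ∀ y : ℝ, c ≤ y → (y : ℂ) ∉ spectrum ℂ M} := by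
    rw [isOpen_iff_mem_nhds]
    intro M hM
    -- The spectrum is upper hemicontinuous, so avoiding the closed ray [c, ∞) is stable under small
    -- perturbations.
    have h1 := upperHemicontinuous_spectrum ℂ (Matrix r r ℂ) M _
      (hcl.isOpen_compl.mem_nhdsSet.2 ((hiff M).1 hM))
    refine mem_of_superset h1 fun M' hM' => (hiff M').2 (subset_of_mem_nhdsSet hM')
  exact hopen.preimage (continuous_tancX hJ)

/-- Covers high frequencies, where the transfer matrix tends to zero; this is why the bound c is
kept positive. -/
theorem specBelow_zero {c : ℝ} (hc : 0 < c) : SpecBelow J θ (0 : Matrix r w ℂ) c := by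
  intro y hy
  have h0 : tancX J θ (0 : Matrix r w ℂ) = 0 := by simp [tancX]
  rw [h0, spectrum.mem_iff, not_not, sub_zero]
  have hy' : (y : ℂ) ≠ 0 := Complex.ofReal_ne_zero.2 (hc.trans_le hy).ne'
  exact (isUnit_iff_ne_zero.2 hy').map (algebraMap ℂ (Matrix r r ℂ))

theorem hasDerivAt_twoPsiX {X : ℝ → Matrix r w ℂ} {Y : Matrix r w ℂ} {t : ℝ}
    (hX : HasDerivAt X Y t) :
    HasDerivAt (fun s => twoPsiX J θ (X s))
      ((2 * Complex.I * θ) • (Y * toC J * (X t)ᴴ + X t * toC J * Yᴴ)) t :=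
  (hasDerivAt_matrix_mul (hasDerivAt_mul_const_matrix (toC J) hX)
    (hasDerivAt_conjTranspose hX)).const_smul (2 * Complex.I * (θ : ℂ))

theorem hasDerivAt_deltaX {X : ℝ → Matrix r w ℂ} {Y : Matrix r w ℂ} {t : ℝ}
    (hX : HasDerivAt X Y t) :
    HasDerivAt (fun s => deltaX J θ (X s))
      (-((θ : ℂ) • (Sroot J * Yᴴ * matPhi (twoPsiX J θ (X t)) * X t * Sroot J +
        Sroot J * (X t)ᴴ * phiDeriv (twoPsiX J θ (X t))
          ((2 * Complex.I * θ) • (Y * toC J * (X t)ᴴ + X t * toC J * Yᴴ)) * X t * Sroot J +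
        Sroot J * (X t)ᴴ * matPhi (twoPsiX J θ (X t)) * Y * Sroot J))) t := by
  have h1 := hasDerivAt_const_mul_matrix (Sroot J) (hasDerivAt_conjTranspose hX)
  have h2 := hasDerivAt_matrix_mul h1 (hasDerivAt_matPhi (hasDerivAt_twoPsiX (J := J) (θ := θ) hX))
  have h3 := hasDerivAt_mul_const_matrix (Sroot J) (hasDerivAt_matrix_mul h2 hX)
  have h4 := (h3.const_smul (θ : ℂ)).const_sub 1
  refine h4.congr_deriv ?_
  simp only [Matrix.add_mul]

/-- Of the three product-rule terms, the outer two are complex conjugates u and conj u, because Δ, S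
and φ(2iθΨ) are Hermitian. In the middle one, self-adjointness of the derivative of φ moves it onto
W = X S Δ⁻¹ S X*, which leaves 2iθ(v - conj v). The real parts combine to -2θ Re(u + 2iθ v), and u +
2iθ v is the pairing of Y with φ_θ + 2iθψ_θ. -/
theorem trace_inv_mul_deriv (hJ : Jᵀ = -J) (X Y : Matrix r w ℂ) :
    ((deltaX J θ X)⁻¹ *
      (-((θ : ℂ) • (Sroot J * Yᴴ * matPhi (twoPsiX J θ X) * X * Sroot J +
        Sroot J * Xᴴ * phiDeriv (twoPsiX J θ X)
          ((2 * Complex.I * θ) • (Y * toC J * Xᴴ + X * toC J * Yᴴ)) * X * Sroot J +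
        Sroot J * Xᴴ * matPhi (twoPsiX J θ X) * Y * Sroot J)))).trace.re =
      -2 * θ * (Yᴴ * xiX J θ X).trace.re := by
  set Φ := matPhi (twoPsiX J θ X)
  set m := twoPsiX J θ X with hm
  set Δ := (deltaX J θ X)⁻¹ with hΔ
  set S := Sroot J
  set W := X * S * Δ * S * Xᴴ with hW
  have hΔH : Δᴴ = Δ := by rw [hΔ, conjTranspose_nonsing_inv, deltaX_isHermitian hJ]
  have hSH : Sᴴ = S := sroot_isHermitian hJ
  have hmH : m.IsHermitian := twoPsiX_isHermitian hJ
  have hΦH : Φᴴ = Φ := matPhi_isHermitian hmH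
  have hWH : W.IsHermitian := by
    rw [Matrix.IsHermitian, hW]
    simp only [conjTranspose_mul, hΔH, hSH, conjTranspose_conjTranspose, Matrix.mul_assoc]
  have hVH : (phiDeriv m W)ᴴ = phiDeriv m W := phiDeriv_isHermitian hmH hWH
  have e1 : (Δ * (S * Yᴴ * Φ * X * S)).trace = (Yᴴ * (Φ * X * S * Δ * S)).trace := by
    have : Δ * (S * Yᴴ * Φ * X * S) = (Δ * S) * (Yᴴ * Φ * X * S) := by
      simp only [Matrix.mul_assoc]
    rw [this, Matrix.trace_mul_comm]
    simp only [Matrix.mul_assoc]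
  have e3 : (Δ * (S * Xᴴ * Φ * Y * S)).trace = conj (Yᴴ * (Φ * X * S * Δ * S)).trace := by
    rw [← e1]
    change _ = star _
    rw [← Matrix.trace_conjTranspose]
    simp only [conjTranspose_mul, hΔH, hSH, hΦH, conjTranspose_conjTranspose]
    rw [Matrix.trace_mul_comm]
    simp only [Matrix.mul_assoc]
  have e2 : (Δ * (S * Xᴴ * phiDeriv m ((2 * Complex.I * θ) •
      (Y * toC J * Xᴴ + X * toC J * Yᴴ)) * X * S)).trace =
      (2 * Complex.I * θ) * ((Yᴴ * (phiDeriv m W * X * toC J)).trace -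
        conj (Yᴴ * (phiDeriv m W * X * toC J)).trace) := by
    have a1 : (Δ * (S * Xᴴ * phiDeriv m ((2 * Complex.I * θ) •
        (Y * toC J * Xᴴ + X * toC J * Yᴴ)) * X * S)).trace =
        (W * phiDeriv m ((2 * Complex.I * θ) • (Y * toC J * Xᴴ + X * toC J * Yᴴ))).trace := by
      generalize phiDeriv m _ = Q
      have : Δ * (S * Xᴴ * Q * X * S) = (Δ * S * Xᴴ * Q) * (X * S) := by
        simp only [Matrix.mul_assoc]
      rw [this, Matrix.trace_mul_comm, hW]
      simp only [Matrix.mul_assoc]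
    have a2 : (phiDeriv m W * (X * toC J * Yᴴ)).trace =
        (Yᴴ * (phiDeriv m W * X * toC J)).trace := by
      rw [Matrix.trace_mul_comm Yᴴ]
      simp only [Matrix.mul_assoc]
    have a3 : (phiDeriv m W * (Y * toC J * Xᴴ)).trace =
        -conj (Yᴴ * (phiDeriv m W * X * toC J)).trace := by
      rw [← a2]
      change _ = -star _
      rw [← Matrix.trace_conjTranspose]
      simp only [conjTranspose_mul, hVH, conjTranspose_conjTranspose,
        toC_conjTranspose_of_antisymm hJ]
      rw [Matrix.trace_mul_comm]
      simp only [Matrix.mul_assoc, Matrix.neg_mul, Matrix.mul_neg, trace_neg, neg_neg]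
    rw [a1, trace_mul_phiDeriv, Matrix.mul_smul, trace_smul, smul_eq_mul, Matrix.mul_add,
      trace_add, a2, a3]
    ring
  have hxi : (Yᴴ * xiX J θ X).trace = (Yᴴ * (Φ * X * S * Δ * S)).trace +
      (2 * Complex.I * θ) * (Yᴴ * (phiDeriv m W * X * toC J)).trace := by
    rw [xiX, Matrix.mul_add, trace_add, Matrix.mul_smul, trace_smul, smul_eq_mul]
  rw [Matrix.mul_neg, Matrix.mul_smul, Matrix.mul_add, Matrix.mul_add, trace_neg, trace_smul,
    trace_add, trace_add, e1, e2, e3, hxi]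
  generalize (Yᴴ * (Φ * X * S * Δ * S)).trace = u
  generalize (Yᴴ * (phiDeriv m W * X * toC J)).trace = v
  simp
  ring

theorem hasDerivAt_logDetX (hJ : Jᵀ = -J) {X : ℝ → Matrix r w ℂ} {Y : Matrix r w ℂ} {t : ℝ}
    (hX : HasDerivAt X Y t) (him : (deltaX J θ (X t)).det.im = 0)
    (hre : 0 < (deltaX J θ (X t)).det.re) :
    HasDerivAt (fun s => logDetX J θ (X s)) (-2 * θ * ((Yᴴ * xiX J θ (X t)).trace).re) t := by
  have hne : (deltaX J θ (X t)).det ≠ 0 := fun h => by simp [h] at hre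
  have h1 := hasDerivAt_det (hasDerivAt_deltaX (J := J) (θ := θ) hX) hne
  have h2 : HasDerivAt (fun s => (deltaX J θ (X s)).det.re) _ t :=
    Complex.reCLM.hasFDerivAt.comp_hasDerivAt t h1
  refine (h2.log hre.ne').congr_deriv ?_
  rw [Complex.reCLM_apply, Complex.mul_re, him, zero_mul, sub_zero, mul_div_cancel_left₀ _ hre.ne',
    trace_inv_mul_deriv hJ]

end TransferCalculus

/-! ### Local bounds for ln det Δ and for its gradient -/

section TransferBounds

open scoped Matrix.Norms.Frobenius

theorem differentiableAt_matrix_iff {E 𝕜 : Type*} [NormedAddCommGroup E] [NormedSpace ℝ E]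
    [RCLike 𝕜] {m n : Type*} [Fintype m] [Fintype n] {A : E → Matrix m n 𝕜} {x : E} :
    DifferentiableAt ℝ A x ↔ ∀ i j, DifferentiableAt ℝ (fun s => A s i j) x :=
  differentiableAt_pi.trans (forall_congr' fun _ => differentiableAt_pi)

theorem differentiableAt_matrix_mul {E 𝕜 : Type*} [NormedAddCommGroup E] [NormedSpace ℝ E]
    [RCLike 𝕜] {l m n : Type*} [Fintype l] [Fintype m] [Fintype n] {A : E → Matrix l m 𝕜}
    {B : E → Matrix m n 𝕜} {x : E} (hA : DifferentiableAt ℝ A x) (hB : DifferentiableAt ℝ B x) :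
    DifferentiableAt ℝ (fun s => A s * B s) x := by
  rw [differentiableAt_matrix_iff] at *
  intro i j
  simp only [Matrix.mul_apply]
  exact DifferentiableAt.fun_sum fun k _ => (hA i k).mul (hB k j)

theorem differentiableAt_matrix_conjTranspose {E : Type*} [NormedAddCommGroup E] [NormedSpace ℝ E]
    {m n : Type*} [Fintype m] [Fintype n] {A : E → Matrix m n ℂ} {x : E}
    (hA : DifferentiableAt ℝ A x) : DifferentiableAt ℝ (fun s => (A s)ᴴ) x := by
  rw [differentiableAt_matrix_iff] at *
  intro i j
  exact (hA j i).star

variable {w r : Type*} [Fintype w] [DecidableEq w] [Fintype r] [DecidableEq r]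

theorem exists_norm_trace_mul_le (m n : Type*) [Fintype m] [Fintype n] :
    ∃ C : ℝ, 0 ≤ C ∧ ∀ (A : Matrix m n ℂ) (B : Matrix m n ℂ), ‖(Aᴴ * B).trace‖ ≤ C * ‖A‖ * ‖B‖ := by
  classical
  obtain ⟨C, hC, h⟩ := ContinuousLinearMap.bound
    (LinearMap.toContinuousLinearMap (Matrix.traceLinearMap n ℂ ℂ))
  refine ⟨C, hC.le, fun A B => ?_⟩
  calc ‖(Aᴴ * B).trace‖ ≤ C * ‖Aᴴ * B‖ := h _
    _ ≤ C * (‖Aᴴ‖ * ‖B‖) := by gcongr; exact frobenius_norm_mul _ _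
    _ = C * ‖A‖ * ‖B‖ := by rw [frobenius_norm_conjTranspose, mul_assoc]

variable {J : Matrix w w ℝ} {θ : ℝ} {X : Matrix r w ℂ}

theorem differentiable_deltaX : Differentiable ℝ fun X : Matrix r w ℂ => deltaX J θ X := by
  intro X
  have hid : DifferentiableAt ℝ (fun X : Matrix r w ℂ => X) X := differentiableAt_id
  have hH := differentiableAt_matrix_conjTranspose hid
  have h1 : DifferentiableAt ℝ (fun X : Matrix r w ℂ => twoPsiX J θ X) X :=
    (differentiableAt_matrix_mul (differentiableAt_matrix_mul hid
      (differentiableAt_const (toC J))) hH).const_smul (2 * Complex.I * (θ : ℂ))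
  have h2 : DifferentiableAt ℝ (fun X : Matrix r w ℂ => matPhi (twoPsiX J θ X)) X :=
    DifferentiableAt.comp X (contDiff_matPhi.differentiable (by norm_num) _) h1
  have hS : DifferentiableAt ℝ (fun _ : Matrix r w ℂ => Sroot J) X := differentiableAt_const _
  have h3 := differentiableAt_matrix_mul (differentiableAt_matrix_mul (differentiableAt_matrix_mul
    (differentiableAt_matrix_mul hS hH) h2) hid) hS
  exact (differentiableAt_const (1 : Matrix w w ℂ)).sub (h3.const_smul (θ : ℂ))

theorem differentiableAt_logDetX (h : (deltaX J θ X).det.re ≠ 0) :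
    DifferentiableAt ℝ (fun X : Matrix r w ℂ => logDetX J θ X) X := by
  have h1 : DifferentiableAt ℝ (fun X : Matrix r w ℂ => (deltaX J θ X).det) X :=
    DifferentiableAt.comp (g := fun A : Matrix w w ℂ => A.det) X
      ((contDiff_matrix_det (k := 1)).differentiable (by norm_num) _) (differentiable_deltaX X)
  have h2 : DifferentiableAt ℝ (fun X : Matrix r w ℂ => (deltaX J θ X).det.re) X :=
    Complex.reCLM.differentiableAt.comp X h1
  exact h2.log h

/-- A continuous bound for the ratio of the norms of `xiX` and of the transfer matrix. -/
def xiBound (J : Matrix w w ℝ) (θ : ℝ) (X : Matrix r w ℂ) : ℝ :=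
  ‖matPhi (twoPsiX J θ X)‖ * ‖Sroot J * (deltaX J θ X)⁻¹ * Sroot J‖ +
    ‖2 * Complex.I * (θ : ℂ)‖ * (‖phiDeriv (twoPsiX J θ X)
      (X * Sroot J * (deltaX J θ X)⁻¹ * Sroot J * Xᴴ)‖ * ‖toC J‖)

theorem norm_xiX_le : ‖xiX J θ X‖ ≤ xiBound J θ X * ‖X‖ := by
  have h1 : ‖matPhi (twoPsiX J θ X) * X * Sroot J * (deltaX J θ X)⁻¹ * Sroot J‖ ≤
      ‖matPhi (twoPsiX J θ X)‖ * ‖X‖ * ‖Sroot J * (deltaX J θ X)⁻¹ * Sroot J‖ := by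
    have : matPhi (twoPsiX J θ X) * X * Sroot J * (deltaX J θ X)⁻¹ * Sroot J =
        (matPhi (twoPsiX J θ X) * X) * (Sroot J * (deltaX J θ X)⁻¹ * Sroot J) := by
      simp only [Matrix.mul_assoc]
    rw [this]
    refine (frobenius_norm_mul _ _).trans ?_
    gcongr
    exact frobenius_norm_mul _ _
  have h2 : ‖phiDeriv (twoPsiX J θ X) (X * Sroot J * (deltaX J θ X)⁻¹ * Sroot J * Xᴴ) * X * toC J‖ ≤
      ‖phiDeriv (twoPsiX J θ X) (X * Sroot J * (deltaX J θ X)⁻¹ * Sroot J * Xᴴ)‖ * ‖X‖ * ‖toC J‖ := by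
    refine (frobenius_norm_mul _ _).trans ?_
    gcongr
    exact frobenius_norm_mul _ _
  refine (norm_add_le _ _).trans ?_
  rw [norm_smul]
  refine (add_le_add h1 (mul_le_mul_of_nonneg_left h2 (norm_nonneg _))).trans (le_of_eq ?_)
  rw [xiBound]
  ring

theorem continuousAt_inv_deltaX (h : (deltaX J θ X).det ≠ 0) :
    ContinuousAt (fun X : Matrix r w ℂ => (deltaX J θ X)⁻¹) X :=
  ContinuousAt.comp' (f := fun X : Matrix r w ℂ => deltaX J θ X)
    (continuousAt_matrix_inv h) continuous_deltaX.continuousAt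

theorem continuousAt_matrix_mul {E : Type*} [TopologicalSpace E]
    {l m n : Type*} [Fintype m] {A : E → Matrix l m ℂ} {B : E → Matrix m n ℂ} {x : E}
    (hA : ContinuousAt A x) (hB : ContinuousAt B x) : ContinuousAt (fun s => A s * B s) x := by
  have h : Continuous fun p : Matrix l m ℂ × Matrix m n ℂ => p.1 * p.2 := by fun_prop
  exact h.continuousAt.comp (hA.prodMk hB)

theorem continuousAt_sandwich (h : (deltaX J θ X).det ≠ 0) :
    ContinuousAt (fun X : Matrix r w ℂ => Sroot J * (deltaX J θ X)⁻¹ * Sroot J) X :=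
  continuousAt_matrix_mul (continuousAt_matrix_mul continuousAt_const (continuousAt_inv_deltaX h))
    continuousAt_const

theorem continuousAt_phiDeriv_twoPsiX (h : (deltaX J θ X).det ≠ 0) :
    ContinuousAt (fun X : Matrix r w ℂ => phiDeriv (twoPsiX J θ X)
      (X * Sroot J * (deltaX J θ X)⁻¹ * Sroot J * Xᴴ)) X := by
  have h1 : ContinuousAt (fun X : Matrix r w ℂ => X * Sroot J * (deltaX J θ X)⁻¹ * Sroot J * Xᴴ) X := by
    refine continuousAt_matrix_mul (continuousAt_matrix_mul (continuousAt_matrix_mul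
      (continuousAt_matrix_mul continuousAt_id continuousAt_const) (continuousAt_inv_deltaX h))
      continuousAt_const) ?_
    exact (continuous_id.matrix_conjTranspose).continuousAt
  have h2 : ContinuousAt (fun X : Matrix r w ℂ => twoPsiX J θ X) X :=
    continuous_twoPsiX.continuousAt
  exact ContinuousAt.comp' (f := fun X : Matrix r w ℂ => (twoPsiX J θ X,
    X * Sroot J * (deltaX J θ X)⁻¹ * Sroot J * Xᴴ)) continuous_phiDeriv.continuousAt (h2.prodMk h1)

theorem continuousAt_xiBound (h : (deltaX J θ X).det ≠ 0) :
    ContinuousAt (fun X : Matrix r w ℂ => xiBound J θ X) X := by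
  have h1 : ContinuousAt (fun X : Matrix r w ℂ => matPhi (twoPsiX J θ X)) X :=
    (continuous_matPhi.comp continuous_twoPsiX).continuousAt
  exact (h1.norm.mul (continuousAt_sandwich h).norm).add
    (continuousAt_const.mul ((continuousAt_phiDeriv_twoPsiX h).norm.mul continuousAt_const))

theorem continuousAt_xiX (h : (deltaX J θ X).det ≠ 0) :
    ContinuousAt (fun X : Matrix r w ℂ => xiX J θ X) X := by
  have h1 : ContinuousAt (fun X : Matrix r w ℂ => matPhi (twoPsiX J θ X)) X :=
    (continuous_matPhi.comp continuous_twoPsiX).continuousAt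
  have hS : ContinuousAt (fun _ : Matrix r w ℂ => Sroot J) X := continuousAt_const
  have hJ : ContinuousAt (fun _ : Matrix r w ℂ => toC J) X := continuousAt_const
  have h2 := continuousAt_matrix_mul (continuousAt_matrix_mul (continuousAt_matrix_mul
    (continuousAt_matrix_mul h1 continuousAt_id) hS) (continuousAt_inv_deltaX h)) hS
  have h3 := continuousAt_matrix_mul (continuousAt_matrix_mul (continuousAt_phiDeriv_twoPsiX h)
    continuousAt_id) hJ
  exact h2.add (h3.const_smul (2 * Complex.I * (θ : ℂ)))

theorem det_deltaX_ne_zero (hJ : Jᵀ = -J) (hJ2 : J * J = -1) {c : ℝ} (hc : c ≤ 1)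
    (h : SpecBelow J θ X c) : (deltaX J θ X).det ≠ 0 := fun h0 => by
  have := (det_deltaX_pos hJ hJ2 hc h).2
  simp [h0] at this

/-- The gradient carries a factor X, and the remaining factors are continuous on the compact set.
This factor supplies the second power of 1/|λ| needed for integrability. -/
theorem exists_norm_xiX_le (hJ : Jᵀ = -J) (hJ2 : J * J = -1) {c : ℝ} (hc : c ≤ 1)
    {K : Set (Matrix r w ℂ)} (hK : IsCompact K) (hKs : ∀ X ∈ K, SpecBelow J θ X c) :
    ∃ C : ℝ, 0 ≤ C ∧ ∀ X ∈ K, ‖xiX J θ X‖ ≤ C * ‖X‖ := by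
  have hcont : ContinuousOn (fun X : Matrix r w ℂ => xiBound J θ X) K := fun X hX =>
    (continuousAt_xiBound (det_deltaX_ne_zero hJ hJ2 hc (hKs X hX))).continuousWithinAt
  obtain ⟨C, hC⟩ := hK.exists_bound_of_continuousOn hcont
  refine ⟨max C 0, le_max_right _ _, fun X hX => norm_xiX_le.trans ?_⟩
  gcongr
  exact (le_abs_self _).trans ((hC X hX).trans (le_max_left _ _))

theorem logDetX_zero : logDetX J θ (0 : Matrix r w ℂ) = 0 := by
  simp [logDetX, deltaX]

/-- The mean value inequality along s ↦ sX, starting from the value 0 at s = 0: the derivative pairs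
X with a gradient of size O(|X|). -/
theorem exists_abs_logDetX_le (hJ : Jᵀ = -J) (hJ2 : J * J = -1) {c : ℝ} (hc : c ≤ 1) {ε : ℝ}
    (hs : ∀ X ∈ Metric.closedBall (0 : Matrix r w ℂ) ε, SpecBelow J θ X c) :
    ∃ C : ℝ, 0 ≤ C ∧ ∀ X ∈ Metric.closedBall (0 : Matrix r w ℂ) ε, |logDetX J θ X| ≤ C * ‖X‖ ^ 2 := by
  have : ProperSpace (Matrix r w ℂ) := FiniteDimensional.proper_rclike ℂ _
  obtain ⟨C, hC0, hC⟩ := exists_norm_xiX_le hJ hJ2 hc (isCompact_closedBall (0 : Matrix r w ℂ) ε) hs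
  obtain ⟨D, hD0, hD⟩ := exists_norm_trace_mul_le r w
  refine ⟨2 * |θ| * (D * C), by positivity, fun X hX => ?_⟩
  have hmem : ∀ s ∈ Set.Icc (0 : ℝ) 1, s • X ∈ Metric.closedBall (0 : Matrix r w ℂ) ε := by
    intro s hs
    rw [mem_closedBall_zero_iff] at hX ⊢
    rw [norm_smul, Real.norm_of_nonneg hs.1]
    exact (mul_le_of_le_one_left (norm_nonneg _) hs.2).trans hX
  have hderiv : ∀ s ∈ Set.Icc (0 : ℝ) 1, HasDerivWithinAt (fun s : ℝ => logDetX J θ (s • X))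
      (-2 * θ * ((Xᴴ * xiX J θ (s • X)).trace).re) (Set.Icc 0 1) s := by
    intro s hs'
    obtain ⟨h1, h2⟩ := det_deltaX_pos hJ hJ2 hc (hs _ (hmem s hs'))
    have h3 : HasDerivAt (fun s : ℝ => s • X) X s :=
      ((hasDerivAt_id s).smul_const X).congr_deriv (one_smul _ _)
    exact (hasDerivAt_logDetX hJ h3 h1 h2).hasDerivWithinAt
  have hbound : ∀ s ∈ Set.Icc (0 : ℝ) 1, ‖-2 * θ * ((Xᴴ * xiX J θ (s • X)).trace).re‖ ≤
      2 * |θ| * (D * C) * ‖X‖ ^ 2 := by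
    intro s hs'
    have h1 : ‖xiX J θ (s • X)‖ ≤ C * ‖X‖ := by
      refine (hC _ (hmem s hs')).trans ?_
      rw [norm_smul, Real.norm_of_nonneg hs'.1]
      gcongr
      exact mul_le_of_le_one_left (norm_nonneg _) hs'.2
    have h2 : |((Xᴴ * xiX J θ (s • X)).trace).re| ≤ D * ‖X‖ * (C * ‖X‖) :=
      (Complex.abs_re_le_norm _).trans ((hD _ _).trans (by gcongr))
    rw [norm_mul, norm_mul, Real.norm_eq_abs, Real.norm_eq_abs, Real.norm_eq_abs, abs_neg, abs_two]
    calc 2 * |θ| * |((Xᴴ * xiX J θ (s • X)).trace).re| ≤ 2 * |θ| * (D * ‖X‖ * (C * ‖X‖)) := by gcongr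
      _ = _ := by ring
  have := (convex_Icc (0 : ℝ) 1).norm_image_sub_le_of_norm_hasDerivWithin_le hderiv hbound
    (Set.left_mem_Icc.2 zero_le_one) (Set.right_mem_Icc.2 zero_le_one)
  simpa [logDetX_zero] using this

end TransferBounds

/-! ### Hurwitz matrices and their resolvents on the imaginary axis -/

section Resolvent

open scoped Matrix.Norms.Frobenius

variable {x : Type*} [Fintype x] [DecidableEq x]

theorem norm_toC {m n : Type*} [Fintype m] [Fintype n] (A : Matrix m n ℝ) : ‖toC A‖ = ‖A‖ :=
  frobenius_norm_map_eq A _ fun a => Complex.norm_real a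

theorem toC_add {m n : Type*} (A B : Matrix m n ℝ) : toC (A + B) = toC A + toC B := by
  ext i j
  simp [toC]

theorem toC_smul {m n : Type*} (s : ℝ) (A : Matrix m n ℝ) : toC (s • A) = s • toC A := by
  ext i j
  simp [toC]

theorem continuous_toC {m n : Type*} : Continuous (toC : Matrix m n ℝ → Matrix m n ℂ) :=
  continuous_id.matrix_map Complex.continuous_ofReal

theorem isOpen_isHurwitz : IsOpen {A : Matrix x x ℝ | IsHurwitz A} := by
  have hopen : IsOpen {M : Matrix x x ℂ | ∀ z ∈ spectrum ℂ M, z.re < 0} := by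
    rw [isOpen_iff_mem_nhds]
    intro M hM
    have hre : IsOpen {z : ℂ | z.re < 0} := isOpen_lt Complex.continuous_re continuous_const
    have h1 := upperHemicontinuous_spectrum ℂ (Matrix x x ℂ) M _ (hre.mem_nhdsSet.2 hM)
    exact mem_of_superset h1 fun M' hM' => subset_of_mem_nhdsSet hM'
  exact hopen.preimage continuous_toC

theorem IsHurwitz.det_ne_zero {A : Matrix x x ℝ} (hA : IsHurwitz A) (lam : ℝ) :
    ((Complex.I * lam) • (1 : Matrix x x ℂ) - toC A).det ≠ 0 := by
  have h : (Complex.I * lam) ∉ spectrum ℂ (toC A) := fun h => by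
    have := hA _ h
    simp at this
  rw [spectrum.mem_iff, not_not, Matrix.isUnit_iff_isUnit_det, Algebra.algebraMap_eq_smul_one] at h
  exact h.ne_zero

theorem IsHurwitz.Gtf_mul {A : Matrix x x ℝ} (hA : IsHurwitz A) (lam : ℝ) :
    Gtf A lam * ((Complex.I * lam) • (1 : Matrix x x ℂ) - toC A) = 1 :=
  Matrix.nonsing_inv_mul _ (isUnit_iff_ne_zero.2 (hA.det_ne_zero lam))

theorem continuousAt_Gtf {A : Matrix x x ℝ} (hA : IsHurwitz A) (lam : ℝ) :
    ContinuousAt (fun q : Matrix x x ℝ × ℝ => Gtf q.1 q.2) (A, lam) := by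
  have h : Continuous fun q : Matrix x x ℝ × ℝ =>
      (Complex.I * q.2) • (1 : Matrix x x ℂ) - toC q.1 := by
    have := continuous_toC.comp (continuous_fst (X := Matrix x x ℝ) (Y := ℝ))
    have h2 : Continuous fun q : Matrix x x ℝ × ℝ => toC q.1 := this
    fun_prop
  exact ContinuousAt.comp' (f := fun q : Matrix x x ℝ × ℝ =>
    (Complex.I * q.2) • (1 : Matrix x x ℂ) - toC q.1)
    (continuousAt_matrix_inv (hA.det_ne_zero lam)) h.continuousAt

theorem continuous_Gtf {A : Matrix x x ℝ} (hA : IsHurwitz A) : Continuous (Gtf A) := by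
  rw [continuous_iff_continuousAt]
  intro lam
  exact ContinuousAt.comp' (f := fun l : ℝ => (A, l)) (continuousAt_Gtf hA lam)
    (continuousAt_const.prodMk continuousAt_id)

/-- From iλG = I + GA one has (|λ| - ‖A‖)‖G‖ ≤ ‖I‖, and the threshold is exactly the condition |λ| -
‖A‖ ≥ (1 + |λ|)/2. The Frobenius norm of I is not 1, so it stays in the constant. -/
theorem norm_Gtf_le_of_large {A : Matrix x x ℝ} (hA : IsHurwitz A) {lam : ℝ}
    (h : 2 * ‖A‖ + 1 ≤ |lam|) :
    ‖Gtf A lam‖ ≤ 2 * ‖(1 : Matrix x x ℂ)‖ * (1 + |lam|)⁻¹ := by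
  have h1 := hA.Gtf_mul lam
  rw [Matrix.mul_sub, Matrix.mul_smul, Matrix.mul_one, sub_eq_iff_eq_add] at h1
  have h2 : |lam| * ‖Gtf A lam‖ ≤ ‖(1 : Matrix x x ℂ)‖ + ‖Gtf A lam‖ * ‖A‖ := by
    have := congrArg norm h1
    rw [norm_smul, norm_mul, Complex.norm_I, one_mul, Complex.norm_real, Real.norm_eq_abs] at this
    rw [this, ← norm_toC A]
    exact (norm_add_le _ _).trans (by gcongr; exact frobenius_norm_mul _ _)
  have hpos : 0 < 1 + |lam| := by positivity
  rw [← div_eq_mul_inv, le_div_iff₀ hpos]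
  nlinarith [norm_nonneg (Gtf A lam), norm_nonneg A]

/-- Uniform decay of the resolvents on the imaginary axis near a Hurwitz matrix. -/
theorem IsHurwitz.exists_norm_Gtf_le {A₀ : Matrix x x ℝ} (hA : IsHurwitz A₀) :
    ∃ δ > 0, ∃ C : ℝ, 0 ≤ C ∧ ∀ A ∈ Metric.closedBall A₀ δ, IsHurwitz A ∧
      ∀ lam : ℝ, ‖Gtf A lam‖ ≤ C * (1 + |lam|)⁻¹ := by
  have : ProperSpace (Matrix x x ℝ) := FiniteDimensional.proper_rclike ℝ _
  obtain ⟨δ, hδ, hsub⟩ := Metric.nhds_basis_closedBall.mem_iff.1 (isOpen_isHurwitz.mem_nhds hA)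
  -- Beyond R the large-frequency estimate applies to every A in the ball; up to R, compactness of
  -- ball × interval gives the bound.
  set R := 2 * (‖A₀‖ + δ) + 1 with hR
  have hcomp : IsCompact (Metric.closedBall A₀ δ ×ˢ Set.Icc (-R) R) :=
    (isCompact_closedBall A₀ δ).prod isCompact_Icc
  have hcont : ContinuousOn (fun q : Matrix x x ℝ × ℝ => Gtf q.1 q.2)
      (Metric.closedBall A₀ δ ×ˢ Set.Icc (-R) R) := fun q hq =>
    (continuousAt_Gtf (hsub hq.1) q.2).continuousWithinAt
  obtain ⟨C, hC⟩ := hcomp.exists_bound_of_continuousOn hcont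
  have hδ0 : 0 ≤ δ := le_of_lt hδ
  have hR0 : 0 ≤ R := by positivity
  refine ⟨δ, hδ, max (2 * ‖(1 : Matrix x x ℂ)‖) (C * (1 + R)), le_max_of_le_left (by positivity),
    fun A hAm => ⟨hsub hAm, fun lam => ?_⟩⟩
  have hpos : 0 < 1 + |lam| := by positivity
  rcases le_total |lam| R with h | h
  · have h1 := hC (A, lam) ⟨hAm, abs_le.1 h⟩
    have hC0 : 0 ≤ C := (norm_nonneg _).trans h1
    refine h1.trans ?_
    rw [← div_eq_mul_inv, le_div_iff₀ hpos]
    refine le_trans ?_ (le_max_right _ _)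
    gcongr
  · have hn : ‖A‖ ≤ ‖A₀‖ + δ := by
      have h1 : ‖A - A₀‖ ≤ δ := by rwa [← dist_eq_norm]
      calc ‖A‖ = ‖A₀ + (A - A₀)‖ := by rw [add_sub_cancel]
        _ ≤ ‖A₀‖ + ‖A - A₀‖ := norm_add_le _ _
        _ ≤ _ := by gcongr
    refine (norm_Gtf_le_of_large (hsub hAm) (le_trans ?_ h)).trans ?_
    · rw [hR]; gcongr
    · gcongr
      exact le_max_left _ _

theorem hasDerivAt_matrix_inv {A : ℝ → Matrix x x ℂ} {A' : Matrix x x ℂ} {t : ℝ}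
    (hA : HasDerivAt A A' t) (hdet : (A t).det ≠ 0) :
    HasDerivAt (fun s => (A s)⁻¹) (-((A t)⁻¹ * A' * (A t)⁻¹)) t := by
  have hu : IsUnit (A t) := (Matrix.isUnit_iff_isUnit_det _).2 (isUnit_iff_ne_zero.2 hdet)
  obtain ⟨u, hu⟩ := hu
  have h1 : HasFDerivAt (Ring.inverse : Matrix x x ℂ → Matrix x x ℂ) _ (A t) :=
    hu ▸ hasFDerivAt_ringInverse (𝕜 := ℝ) u
  have h2 := h1.comp_hasDerivAt t hA
  have e : (fun s => (A s)⁻¹) = Ring.inverse ∘ A := by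
    funext s
    exact Matrix.nonsing_inv_eq_ringInverse _
  rw [e]
  refine h2.congr_deriv ?_
  have hi : ((u⁻¹ : (Matrix x x ℂ)ˣ) : Matrix x x ℂ) = (A t)⁻¹ := by
    rw [← hu, Matrix.coe_units_inv]
  simp [hi]

theorem differentiableAt_matrix_inv {A : Matrix x x ℂ} (hdet : A.det ≠ 0) :
    DifferentiableAt ℝ (fun A : Matrix x x ℂ => A⁻¹) A := by
  have hu : IsUnit A := (Matrix.isUnit_iff_isUnit_det _).2 (isUnit_iff_ne_zero.2 hdet)
  obtain ⟨u, rfl⟩ := hu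
  have e : (fun A : Matrix x x ℂ => A⁻¹) = Ring.inverse := by
    funext s
    exact Matrix.nonsing_inv_eq_ringInverse _
  rw [e]
  exact (hasFDerivAt_ringInverse (𝕜 := ℝ) u).differentiableAt

end Resolvent

/-! ### The transfer matrix as a function of the system matrices -/

section TransferFunction

open scoped Matrix.Norms.Frobenius

variable {x w r : Type*} [Fintype x] [DecidableEq x] [Fintype w] [DecidableEq w]
  [Fintype r] [DecidableEq r]

/-- The transfer matrix of the system with the block matrix of coefficients `[𝒜, ℬ; 𝒞, *]`. -/
def transfer (p : Matrix (x ⊕ r) (x ⊕ w) ℝ) (lam : ℝ) : Matrix r w ℂ :=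
  Ftf p.toBlocks₁₁ p.toBlocks₁₂ p.toBlocks₂₁ lam

/-- The derivative of the transfer matrix with respect to the coefficients. -/
def transferDeriv (p : Matrix (x ⊕ r) (x ⊕ w) ℝ) (lam : ℝ) (q : Matrix (x ⊕ r) (x ⊕ w) ℝ) :
    Matrix r w ℂ :=
  (toC q.toBlocks₂₁ * Gtf p.toBlocks₁₁ lam +
    toC p.toBlocks₂₁ * (Gtf p.toBlocks₁₁ lam * toC q.toBlocks₁₁ * Gtf p.toBlocks₁₁ lam)) *
      toC p.toBlocks₁₂ +
    toC p.toBlocks₂₁ * Gtf p.toBlocks₁₁ lam * toC q.toBlocks₁₂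

theorem hasDerivAt_toC_line {m n : Type*} [Fintype m] [Fintype n] (A B : Matrix m n ℝ)
    (t : ℝ) : HasDerivAt (fun s : ℝ => toC (A + s • B)) (toC B) t := by
  have h := hasDerivAt_add_smul (toC A) (toC B) t
  have e : (fun s : ℝ => toC (A + s • B)) = fun s : ℝ => toC A + s • toC B := by
    funext s
    rw [toC_add, toC_smul]
  rw [e]
  exact h

variable {p : Matrix (x ⊕ r) (x ⊕ w) ℝ}

theorem hasDerivAt_transfer {q : Matrix (x ⊕ r) (x ⊕ w) ℝ} {t : ℝ}
    (hp : IsHurwitz (p + t • q).toBlocks₁₁) (lam : ℝ) :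
    HasDerivAt (fun s : ℝ => transfer (p + s • q) lam) (transferDeriv (p + t • q) lam q) t := by
  have h1 : HasDerivAt (fun s : ℝ => (Complex.I * lam) • (1 : Matrix x x ℂ) -
      toC (p.toBlocks₁₁ + s • q.toBlocks₁₁)) (-toC q.toBlocks₁₁) t :=
    (hasDerivAt_toC_line p.toBlocks₁₁ q.toBlocks₁₁ t).const_sub _
  have h2 := hasDerivAt_matrix_inv h1 (hp.det_ne_zero lam)
  rw [Matrix.mul_neg, Matrix.neg_mul, neg_neg] at h2
  exact hasDerivAt_matrix_mul (hasDerivAt_matrix_mul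
    (hasDerivAt_toC_line p.toBlocks₂₁ q.toBlocks₂₁ t) h2)
    (hasDerivAt_toC_line p.toBlocks₁₂ q.toBlocks₁₂ t)

/-- Only existence of the Fréchet derivative is recorded; its value is read off from the directional
derivatives in `hasDerivAt_transfer`. -/
theorem differentiableAt_transfer (hp : IsHurwitz p.toBlocks₁₁) (lam : ℝ) :
    DifferentiableAt ℝ (fun p : Matrix (x ⊕ r) (x ⊕ w) ℝ => transfer p lam) p := by
  have hentry : ∀ i j, DifferentiableAt ℝ
      (fun p : Matrix (x ⊕ r) (x ⊕ w) ℝ => ((p i j : ℝ) : ℂ)) p := fun i j => by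
    have h1 : DifferentiableAt ℝ (fun p : Matrix (x ⊕ r) (x ⊕ w) ℝ => p i j) p :=
      (LinearMap.toContinuousLinearMap
        ({ toFun := fun A => A i j, map_add' := fun _ _ => rfl, map_smul' := fun _ _ => rfl } :
          Matrix (x ⊕ r) (x ⊕ w) ℝ →ₗ[ℝ] ℝ)).differentiableAt
    exact Complex.ofRealCLM.differentiableAt.comp p h1
  have h11 : DifferentiableAt ℝ (fun p : Matrix (x ⊕ r) (x ⊕ w) ℝ => toC p.toBlocks₁₁) p :=
    differentiableAt_matrix_iff.2 fun _ _ => hentry _ _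
  have h12 : DifferentiableAt ℝ (fun p : Matrix (x ⊕ r) (x ⊕ w) ℝ => toC p.toBlocks₁₂) p :=
    differentiableAt_matrix_iff.2 fun _ _ => hentry _ _
  have h21 : DifferentiableAt ℝ (fun p : Matrix (x ⊕ r) (x ⊕ w) ℝ => toC p.toBlocks₂₁) p :=
    differentiableAt_matrix_iff.2 fun _ _ => hentry _ _
  have hG : DifferentiableAt ℝ (fun p : Matrix (x ⊕ r) (x ⊕ w) ℝ => Gtf p.toBlocks₁₁ lam) p :=
    DifferentiableAt.comp (f := fun p : Matrix (x ⊕ r) (x ⊕ w) ℝ =>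
      (Complex.I * lam) • (1 : Matrix x x ℂ) - toC p.toBlocks₁₁) p
      (differentiableAt_matrix_inv (hp.det_ne_zero lam)) ((differentiableAt_const _).sub h11)
  exact differentiableAt_matrix_mul (differentiableAt_matrix_mul h21 hG) h12

theorem continuous_transfer (hp : IsHurwitz p.toBlocks₁₁) : Continuous (transfer p) := by
  have := continuous_Gtf hp
  unfold transfer Ftf
  fun_prop

theorem continuous_transferDeriv (hp : IsHurwitz p.toBlocks₁₁) (q : Matrix (x ⊕ r) (x ⊕ w) ℝ) :
    Continuous fun lam => transferDeriv p lam q := by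
  have := continuous_Gtf hp
  unfold transferDeriv
  fun_prop

theorem sum_comp_le_sum {ι κ : Type*} [Fintype ι] [Fintype κ] {e : ι → κ} (he : e.Injective)
    {f : κ → ℝ} (hf : ∀ k, 0 ≤ f k) : ∑ i, f (e i) ≤ ∑ k, f k := by
  refine (Finset.sum_map Finset.univ ⟨e, he⟩ f).symm.trans_le ?_
  exact Finset.sum_le_univ_sum_of_nonneg hf

theorem norm_submatrix_le {m n m' n' : Type*} [Fintype m] [Fintype n] [Fintype m'] [Fintype n']
    (A : Matrix m n ℝ) {f : m' → m} {g : n' → n} (hf : f.Injective) (hg : g.Injective) :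
    ‖A.submatrix f g‖ ≤ ‖A‖ := by
  rw [frobenius_norm_def, frobenius_norm_def]
  refine Real.rpow_le_rpow (by positivity) ?_ (by norm_num)
  calc ∑ i, ∑ j, ‖A.submatrix f g i j‖ ^ (2 : ℝ) ≤ ∑ i, ∑ j, ‖A (f i) j‖ ^ (2 : ℝ) :=
        Finset.sum_le_sum fun i _ => sum_comp_le_sum (f := fun j => ‖A (f i) j‖ ^ (2 : ℝ)) hg
          fun _ => by positivity
    _ ≤ _ := sum_comp_le_sum (f := fun i => ∑ j, ‖A i j‖ ^ (2 : ℝ)) hf fun _ => by positivity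

theorem norm_toC_toBlocks₁₁_le (p : Matrix (x ⊕ r) (x ⊕ w) ℝ) : ‖toC p.toBlocks₁₁‖ ≤ ‖p‖ :=
  (norm_toC _).trans_le (norm_submatrix_le p Sum.inl_injective Sum.inl_injective)

theorem norm_toC_toBlocks₁₂_le (p : Matrix (x ⊕ r) (x ⊕ w) ℝ) : ‖toC p.toBlocks₁₂‖ ≤ ‖p‖ :=
  (norm_toC _).trans_le (norm_submatrix_le p Sum.inl_injective Sum.inr_injective)

theorem norm_toC_toBlocks₂₁_le (p : Matrix (x ⊕ r) (x ⊕ w) ℝ) : ‖toC p.toBlocks₂₁‖ ≤ ‖p‖ :=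
  (norm_toC _).trans_le (norm_submatrix_le p Sum.inr_injective Sum.inl_injective)

theorem norm_transfer_le {C d N : ℝ} {lam : ℝ} (hG : ‖Gtf p.toBlocks₁₁ lam‖ ≤ C * d)
    (hN : ‖p‖ ≤ N) : ‖transfer p lam‖ ≤ N * (C * d) * N := by
  have h0 : 0 ≤ C * d := (norm_nonneg _).trans hG
  have hN0 : 0 ≤ N := (norm_nonneg _).trans hN
  refine (frobenius_norm_mul _ _).trans ?_
  have h1 := (norm_toC_toBlocks₁₂_le p).trans hN
  have h2 := (norm_toC_toBlocks₂₁_le p).trans hN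
  gcongr
  refine (frobenius_norm_mul _ _).trans ?_
  gcongr

theorem norm_transferDeriv_le {C d N : ℝ} {lam : ℝ} (hG : ‖Gtf p.toBlocks₁₁ lam‖ ≤ C * d)
    (hC : 0 ≤ C) (hd0 : 0 ≤ d) (hd : d ≤ 1) (hN : ‖p‖ ≤ N) (q : Matrix (x ⊕ r) (x ⊕ w) ℝ) :
    ‖transferDeriv p lam q‖ ≤ (2 * C * N + C ^ 2 * N ^ 2) * d * ‖q‖ := by
  have h0 : 0 ≤ C * d := (norm_nonneg _).trans hG
  have hN0 : 0 ≤ N := (norm_nonneg _).trans hN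
  have h12 := (norm_toC_toBlocks₁₂_le p).trans hN
  have h21 := (norm_toC_toBlocks₂₁_le p).trans hN
  have g12 := norm_toC_toBlocks₁₂_le q
  have g21 := norm_toC_toBlocks₂₁_le q
  have g11 := norm_toC_toBlocks₁₁_le q
  set G := Gtf p.toBlocks₁₁ lam
  have e1 : ‖toC q.toBlocks₂₁ * G‖ ≤ ‖q‖ * (C * d) := by
    refine (frobenius_norm_mul _ _).trans ?_
    gcongr
  have e2 : ‖toC p.toBlocks₂₁ * (G * toC q.toBlocks₁₁ * G)‖ ≤ N * (C * d * ‖q‖ * (C * d)) := by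
    refine (frobenius_norm_mul _ _).trans ?_
    gcongr
    refine (frobenius_norm_mul _ _).trans ?_
    gcongr
    refine (frobenius_norm_mul _ _).trans ?_
    gcongr
  have e3 : ‖toC p.toBlocks₂₁ * G * toC q.toBlocks₁₂‖ ≤ N * (C * d) * ‖q‖ := by
    refine (frobenius_norm_mul _ _).trans ?_
    gcongr
    refine (frobenius_norm_mul _ _).trans ?_
    gcongr
  have e4 : ‖(toC q.toBlocks₂₁ * G + toC p.toBlocks₂₁ * (G * toC q.toBlocks₁₁ * G)) *
      toC p.toBlocks₁₂‖ ≤ (‖q‖ * (C * d) + N * (C * d * ‖q‖ * (C * d))) * N := by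
    refine (frobenius_norm_mul _ _).trans ?_
    gcongr
    exact (norm_add_le _ _).trans (add_le_add e1 e2)
  refine (norm_add_le _ _).trans ((add_le_add e4 e3).trans ?_)
  -- The variation of 𝒜 brings two resolvents, hence d²; since d ≤ 1 it is absorbed into the first
  -- power.
  have hdd : d * d ≤ d := mul_le_of_le_one_left hd0 hd
  have : (‖q‖ * (C * d) + N * (C * d * ‖q‖ * (C * d))) * N + N * (C * d) * ‖q‖ =
      2 * C * N * d * ‖q‖ + C ^ 2 * N ^ 2 * (d * d) * ‖q‖ := by ring
  rw [this, add_mul, add_mul]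
  gcongr

theorem inv_one_add_abs_le_one (lam : ℝ) : (1 + |lam|)⁻¹ ≤ 1 :=
  inv_le_one_of_one_le₀ (by linarith [abs_nonneg lam])

/-- Uniform decay of the transfer matrix and of its derivative near a stable system. -/
theorem exists_transfer_bounds {p₀ : Matrix (x ⊕ r) (x ⊕ w) ℝ} (hp : IsHurwitz p₀.toBlocks₁₁) :
    ∃ δ > 0, ∃ C : ℝ, 0 ≤ C ∧ ∀ p ∈ Metric.closedBall p₀ δ, IsHurwitz p.toBlocks₁₁ ∧
      (∀ lam : ℝ, ‖transfer p lam‖ ≤ C * (1 + |lam|)⁻¹) ∧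
      ∀ (lam : ℝ) (q : Matrix (x ⊕ r) (x ⊕ w) ℝ),
        ‖transferDeriv p lam q‖ ≤ C * (1 + |lam|)⁻¹ * ‖q‖ := by
  obtain ⟨δ, hδ, C, hC, h⟩ := hp.exists_norm_Gtf_le
  set N := ‖p₀‖ + δ with hN
  have hN0 : 0 ≤ N := by positivity
  refine ⟨δ, hδ, max (N * C * N) (2 * C * N + C ^ 2 * N ^ 2), le_max_of_le_left (by positivity),
    fun p hpm => ?_⟩
  have hsub : p.toBlocks₁₁ ∈ Metric.closedBall p₀.toBlocks₁₁ δ := by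
    rw [mem_closedBall_iff_norm] at hpm ⊢
    exact (norm_submatrix_le (p - p₀) Sum.inl_injective Sum.inl_injective).trans hpm
  obtain ⟨hH, hG⟩ := h _ hsub
  have hpN : ‖p‖ ≤ N := by
    rw [mem_closedBall_iff_norm] at hpm
    calc ‖p‖ = ‖p₀ + (p - p₀)‖ := by rw [add_sub_cancel]
      _ ≤ ‖p₀‖ + ‖p - p₀‖ := norm_add_le _ _
      _ ≤ _ := by rw [hN]; gcongr
  refine ⟨hH, fun lam => ?_, fun lam q => ?_⟩
  · refine (norm_transfer_le (hG lam) hpN).trans ?_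
    have : N * (C * (1 + |lam|)⁻¹) * N = N * C * N * (1 + |lam|)⁻¹ := by ring
    rw [this]
    gcongr
    exact le_max_left _ _
  · refine (norm_transferDeriv_le (hG lam) hC (by positivity) (inv_one_add_abs_le_one lam)
      hpN q).trans ?_
    gcongr
    exact le_max_right _ _

end TransferFunction

/-! ### Integrals over the frequency axis depending on a parameter -/

theorem inv_one_add_abs_sq_le (lam : ℝ) : (1 + |lam|)⁻¹ * (1 + |lam|)⁻¹ ≤ (1 + lam ^ 2)⁻¹ := by
  rw [← mul_inv]
  have h : 0 < 1 + lam ^ 2 := by positivity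
  refine inv_anti₀ h ?_
  nlinarith [abs_nonneg lam, sq_abs lam]

/-- Differentiation under the integral sign for a family of functions with directional derivatives
decaying quadratically at infinity. -/
theorem exists_hasFDerivAt_integral {E : Type*} [NormedAddCommGroup E] [NormedSpace ℝ E]
    [FiniteDimensional ℝ E] {f : E → ℝ → ℝ} {g : E → ℝ → E → ℝ} {p₀ : E} {δ C : ℝ} (hδ : 0 < δ)
    (hC : 0 ≤ C)
    (hdiff : ∀ p ∈ Metric.closedBall p₀ δ, ∀ lam, DifferentiableAt ℝ (fun p => f p lam) p)
    (hderiv : ∀ p ∈ Metric.closedBall p₀ δ, ∀ lam q,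
      HasDerivAt (fun s : ℝ => f (p + s • q) lam) (g p lam q) 0)
    (hbound : ∀ p ∈ Metric.closedBall p₀ δ, ∀ lam q, |g p lam q| ≤ C * (1 + lam ^ 2)⁻¹ * ‖q‖)
    (hcont : ∀ p ∈ Metric.closedBall p₀ δ, Continuous (f p))
    (hint : Integrable (f p₀)) (hg : ∀ q, Continuous fun lam => g p₀ lam q) :
    ∃ L : E →L[ℝ] ℝ, HasFDerivAt (fun p => ∫ lam, f p lam) L p₀ ∧
      ∀ q, L q = ∫ lam, g p₀ lam q := by
  have hmem : Metric.closedBall p₀ δ ∈ 𝓝 p₀ := Metric.closedBall_mem_nhds p₀ hδ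
  have hval : ∀ p ∈ Metric.closedBall p₀ δ, ∀ lam q,
      fderiv ℝ (fun p => f p lam) p q = g p lam q := by
    intro p hp lam q
    have h1 := hasDerivAt_add_smul p q 0
    have h2 : HasFDerivAt (fun p => f p lam) (fderiv ℝ (fun p => f p lam) p)
        ((fun s : ℝ => p + s • q) 0) := by
      simpa using (hdiff p hp lam).hasFDerivAt
    have h3 : HasDerivAt (fun s : ℝ => f (p + s • q) lam)
        (fderiv ℝ (fun p => f p lam) p q) 0 :=
      HasFDerivAt.comp_hasDerivAt (l := fun p => f p lam) (f := fun s : ℝ => p + s • q) 0 h2 h1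
    exact h3.unique (hderiv p hp lam q)
  have hp₀ : p₀ ∈ Metric.closedBall p₀ δ := Metric.mem_closedBall_self hδ.le
  -- In finite dimension, continuity of an operator-valued map can be tested on each vector, so the
  -- continuity of the directional derivatives is enough for measurability.
  have hFc : Continuous fun lam => fderiv ℝ (fun p => f p lam) p₀ := by
    rw [continuous_clm_apply]
    intro q
    exact (hg q).congr fun lam => (hval p₀ hp₀ lam q).symm
  have hFb : ∀ p ∈ Metric.closedBall p₀ δ, ∀ lam,
      ‖fderiv ℝ (fun p => f p lam) p‖ ≤ C * (1 + lam ^ 2)⁻¹ := by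
    intro p hp lam
    refine ContinuousLinearMap.opNorm_le_bound _ (by positivity) fun q => ?_
    rw [hval p hp lam q]
    exact hbound p hp lam q
  have hbi : Integrable fun lam : ℝ => C * (1 + lam ^ 2)⁻¹ :=
    integrable_inv_one_add_sq.const_mul C
  refine ⟨∫ lam, fderiv ℝ (fun p => f p lam) p₀, ?_, fun q => ?_⟩
  · refine hasFDerivAt_integral_of_dominated_of_fderiv_le (𝕜 := ℝ) (bound := fun lam => C * (1 + lam ^ 2)⁻¹)
      (F' := fun p lam => fderiv ℝ (fun p => f p lam) p) hmem ?_ hint hFc.aestronglyMeasurable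
      ?_ hbi ?_
    · filter_upwards [hmem] with p hp
      exact (hcont p hp).aestronglyMeasurable
    · exact ae_of_all _ fun lam p hp => hFb p hp lam
    · exact ae_of_all _ fun lam p hp => (hdiff p hp lam).hasFDerivAt
  · have hFi : Integrable fun lam => fderiv ℝ (fun p => f p lam) p₀ :=
      hbi.mono' hFc.aestronglyMeasurable (ae_of_all _ fun lam => hFb p₀ hp₀ lam)
    rw [ContinuousLinearMap.integral_apply hFi]
    exact integral_congr_ae (ae_of_all _ fun lam => hval p₀ hp₀ lam q)

theorem integrable_of_norm_le_of_large {E : Type*} [NormedAddCommGroup E] {f : ℝ → E}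
    (hf : Continuous f) {C R : ℝ} (h : ∀ lam, R ≤ |lam| → ‖f lam‖ ≤ C * (1 + lam ^ 2)⁻¹) :
    Integrable f := by
  obtain ⟨B, hB⟩ := (isCompact_Icc (a := -R) (b := R)).exists_bound_of_continuousOn hf.continuousOn
  -- The factor 1 + R² makes the majorant at least B throughout [-R, R].
  have hi : Integrable fun lam : ℝ => max C (B * (1 + R ^ 2)) * (1 + lam ^ 2)⁻¹ :=
    integrable_inv_one_add_sq.const_mul _
  refine hi.mono' hf.aestronglyMeasurable (ae_of_all _ fun lam => ?_)
  rcases le_total R |lam| with h1 | h1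
  · refine (h lam h1).trans ?_
    gcongr
    exact le_max_left _ _
  · have h2 := hB lam (abs_le.1 h1)
    have hB0 : 0 ≤ B := (norm_nonneg _).trans h2
    refine h2.trans ?_
    have hpos : 0 < 1 + lam ^ 2 := by positivity
    rw [← div_eq_mul_inv, le_div_iff₀ hpos]
    refine le_trans ?_ (le_max_right _ _)
    have h3 : lam ^ 2 ≤ R ^ 2 := by
      rw [← sq_abs lam]
      exact pow_le_pow_left₀ (abs_nonneg _) h1 2
    gcongr

/-! ### Uniformity near a stable system; reduction of the rate to ln det Δ -/

section StateSpaceAnalysis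

open scoped Matrix.Norms.Frobenius

variable {x w r : Type*} [Fintype x] [DecidableEq x] [Fintype w] [DecidableEq w]
  [Fintype r] [DecidableEq r]

/-- A stable system satisfying the spectral constraint with the bound `c`. -/
def StableBelow (J : Matrix w w ℝ) (θ c : ℝ) (p : Matrix (x ⊕ r) (x ⊕ w) ℝ) : Prop :=
  IsHurwitz p.toBlocks₁₁ ∧ ∀ lam, SpecBelow J θ (transfer p lam) c

variable {J : Matrix w w ℝ} {θ c : ℝ} {p₀ : Matrix (x ⊕ r) (x ⊕ w) ℝ}

theorem exists_inv_one_add_abs_le {C ε : ℝ} (hε : 0 < ε) :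
    ∃ R : ℝ, ∀ lam : ℝ, R ≤ |lam| → C * (1 + |lam|)⁻¹ ≤ ε := by
  refine ⟨C / ε, fun lam h => ?_⟩
  have hpos : 0 < 1 + |lam| := by positivity
  rw [← div_eq_mul_inv, div_le_iff₀ hpos]
  rw [div_le_iff₀ hε] at h
  nlinarith

/-- The mean value inequality on the segment from p₀ to p; the point is that the Lipschitz constant
does not depend on λ. -/
theorem norm_transfer_sub_le {δ C : ℝ} (hC : 0 ≤ C)
    (h : ∀ p ∈ Metric.closedBall p₀ δ, IsHurwitz p.toBlocks₁₁ ∧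
      ∀ (lam : ℝ) (q : Matrix (x ⊕ r) (x ⊕ w) ℝ),
        ‖transferDeriv p lam q‖ ≤ C * (1 + |lam|)⁻¹ * ‖q‖)
    {p : Matrix (x ⊕ r) (x ⊕ w) ℝ} (hp : p ∈ Metric.closedBall p₀ δ) (lam : ℝ) :
    ‖transfer p lam - transfer p₀ lam‖ ≤ C * ‖p - p₀‖ := by
  have hmem : ∀ s ∈ Set.Icc (0 : ℝ) 1, p₀ + s • (p - p₀) ∈ Metric.closedBall p₀ δ := by
    intro s hs
    rw [mem_closedBall_iff_norm] at hp ⊢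
    rw [add_sub_cancel_left, norm_smul, Real.norm_of_nonneg hs.1]
    exact (mul_le_of_le_one_left (norm_nonneg _) hs.2).trans hp
  have hd : ∀ s ∈ Set.Icc (0 : ℝ) 1, HasDerivWithinAt
      (fun s : ℝ => transfer (p₀ + s • (p - p₀)) lam)
      (transferDeriv (p₀ + s • (p - p₀)) lam (p - p₀)) (Set.Icc 0 1) s := fun s hs =>
    (hasDerivAt_transfer (h _ (hmem s hs)).1 lam).hasDerivWithinAt
  have hb : ∀ s ∈ Set.Icc (0 : ℝ) 1, ‖transferDeriv (p₀ + s • (p - p₀)) lam (p - p₀)‖ ≤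
      C * ‖p - p₀‖ := by
    intro s hs
    refine ((h _ (hmem s hs)).2 lam _).trans ?_
    gcongr
    exact mul_le_of_le_one_right hC (inv_one_add_abs_le_one lam)
  have := (convex_Icc (0 : ℝ) 1).norm_image_sub_le_of_norm_hasDerivWithin_le hd hb
    (Set.left_mem_Icc.2 zero_le_one) (Set.right_mem_Icc.2 zero_le_one)
  simpa using this

/-- Near a stable system satisfying the spectral constraint, the transfer matrices take values in a
common compact set on which the constraint holds. -/
theorem StableBelow.exists_compact (hJ : Jᵀ = -J) (hc : 0 < c) (hp : StableBelow J θ c p₀) :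
    ∃ K : Set (Matrix r w ℂ), IsCompact K ∧ (∀ X ∈ K, SpecBelow J θ X c) ∧
      ∃ δ > 0, ∃ C : ℝ, 0 ≤ C ∧ ∀ p ∈ Metric.closedBall p₀ δ, IsHurwitz p.toBlocks₁₁ ∧
        (∀ lam : ℝ, transfer p lam ∈ K) ∧ (∀ lam : ℝ, ‖transfer p lam‖ ≤ C * (1 + |lam|)⁻¹) ∧
        ∀ (lam : ℝ) (q : Matrix (x ⊕ r) (x ⊕ w) ℝ),
          ‖transferDeriv p lam q‖ ≤ C * (1 + |lam|)⁻¹ * ‖q‖ := by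
  have : ProperSpace (Matrix r w ℂ) := FiniteDimensional.proper_rclike ℂ _
  obtain ⟨δ₁, hδ₁, C, hC, h⟩ := exists_transfer_bounds hp.1
  have hopen := isOpen_specBelow (r := r) (θ := θ) hJ c
  obtain ⟨ε, hε, hεs⟩ := Metric.nhds_basis_closedBall.mem_iff.1
    (hopen.mem_nhds (specBelow_zero (J := J) (θ := θ) (r := r) hc))
  obtain ⟨R, hR⟩ := exists_inv_one_add_abs_le (C := C) hε
  -- Low frequencies give a compact image, and high frequencies fall into a ball around 0 on which
  -- the constraint holds.
  set K₀ : Set (Matrix r w ℂ) := transfer p₀ '' Set.Icc (-R) R ∪ Metric.closedBall 0 ε with hK₀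
  have hK₀c : IsCompact K₀ :=
    (isCompact_Icc.image (continuous_transfer hp.1)).union (isCompact_closedBall _ _)
  have hK₀s : K₀ ⊆ {X | SpecBelow J θ X c} := by
    rintro X (⟨lam, -, rfl⟩ | hX)
    · exact hp.2 lam
    · exact hεs hX
  have hp₀ : p₀ ∈ Metric.closedBall p₀ δ₁ := Metric.mem_closedBall_self (le_of_lt hδ₁)
  have hmem : ∀ lam, transfer p₀ lam ∈ K₀ := by
    intro lam
    rcases le_total R |lam| with h1 | h1
    · right
      rw [mem_closedBall_zero_iff]
      exact ((h p₀ hp₀).2.1 lam).trans (hR lam h1)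
    · left
      exact ⟨lam, abs_le.1 h1, rfl⟩
  obtain ⟨η, hη, hηs⟩ := hK₀c.exists_cthickening_subset_open hopen hK₀s
  -- The radius is chosen so that the λ-uniform Lipschitz bound moves transfer matrices by at most
  -- η; C + 1 avoids division by zero.
  refine ⟨Metric.cthickening η K₀, hK₀c.cthickening, fun X hX => hηs hX,
    min δ₁ (η / (C + 1)), lt_min hδ₁ (by positivity), C, hC, fun p hpm => ?_⟩
  rw [Metric.mem_closedBall, le_min_iff] at hpm
  obtain ⟨h1, h2, h3⟩ := h p hpm.1
  refine ⟨h1, fun lam => ?_, h2, h3⟩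
  refine Metric.mem_cthickening_of_dist_le _ (transfer p₀ lam) η K₀ (hmem lam) ?_
  rw [dist_eq_norm]
  refine (norm_transfer_sub_le hC (fun p hp => ⟨(h p hp).1, (h p hp).2.2⟩) hpm.1 lam).trans ?_
  rw [← dist_eq_norm]
  have := hpm.2
  rw [le_div_iff₀ (by positivity)] at this
  nlinarith [dist_nonneg (x := p) (y := p₀)]

theorem StableBelow.eventually (hJ : Jᵀ = -J) (hc : 0 < c) (hp : StableBelow J θ c p₀) :
    ∀ᶠ p in 𝓝 p₀, StableBelow J θ c p := by
  obtain ⟨K, -, hKs, δ, hδ, C, -, h⟩ := hp.exists_compact hJ hc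
  have hm : Metric.closedBall p₀ δ ∈ 𝓝 p₀ := Metric.closedBall_mem_nhds p₀ hδ
  filter_upwards [hm] with p hpm
  exact ⟨(h p hpm).1, fun lam => hKs _ ((h p hpm).2.1 lam)⟩

theorem continuous_logDetX_transfer (hJ : Jᵀ = -J) (hJ2 : J * J = -1) (hc : c ≤ 1)
    (hp : StableBelow J θ c p₀) : Continuous fun lam => logDetX J θ (transfer p₀ lam) := by
  rw [continuous_iff_continuousAt]
  intro lam
  have h1 : ContinuousAt (fun X : Matrix r w ℂ => logDetX J θ X) (transfer p₀ lam) :=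
    (differentiableAt_logDetX (det_deltaX_pos hJ hJ2 hc (hp.2 lam)).2.ne').continuousAt
  exact ContinuousAt.comp' (f := transfer p₀) h1 (continuous_transfer hp.1).continuousAt

theorem continuous_xiX_transfer (hJ : Jᵀ = -J) (hJ2 : J * J = -1) (hc : c ≤ 1)
    (hp : StableBelow J θ c p₀) : Continuous fun lam => xiX J θ (transfer p₀ lam) := by
  rw [continuous_iff_continuousAt]
  intro lam
  have h1 : ContinuousAt (fun X : Matrix r w ℂ => xiX J θ X) (transfer p₀ lam) :=
    continuousAt_xiX (det_deltaX_ne_zero hJ hJ2 hc (hp.2 lam))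
  exact ContinuousAt.comp' (f := transfer p₀) h1 (continuous_transfer hp.1).continuousAt

theorem sq_mul_le {C a : ℝ} (ha : 0 ≤ a) {lam : ℝ} (h : a ≤ C * (1 + |lam|)⁻¹) :
    a ^ 2 ≤ C ^ 2 * (1 + lam ^ 2)⁻¹ := by
  calc a ^ 2 ≤ (C * (1 + |lam|)⁻¹) ^ 2 := pow_le_pow_left₀ ha h 2
    _ = C ^ 2 * ((1 + |lam|)⁻¹ * (1 + |lam|)⁻¹) := by ring
    _ ≤ _ := by gcongr; exact inv_one_add_abs_sq_le lam

/-- For large |λ| the transfer matrix is near 0, where ln det Δ is quadratically small, so the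
integrand is O(1/λ²). -/
theorem integrable_logDetX_transfer (hJ : Jᵀ = -J) (hJ2 : J * J = -1) (hc0 : 0 < c) (hc : c ≤ 1)
    (hp : StableBelow J θ c p₀) : Integrable fun lam => logDetX J θ (transfer p₀ lam) := by
  have hopen := isOpen_specBelow (r := r) (θ := θ) hJ c
  obtain ⟨ε, hε, hεs⟩ := Metric.nhds_basis_closedBall.mem_iff.1
    (hopen.mem_nhds (specBelow_zero (J := J) (θ := θ) (r := r) hc0))
  obtain ⟨δ, hδ, C, hC, h⟩ := exists_transfer_bounds hp.1
  have hb := (h p₀ (Metric.mem_closedBall_self (le_of_lt hδ))).2.1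
  obtain ⟨R, hR⟩ := exists_inv_one_add_abs_le (C := C) hε
  obtain ⟨D, hD0, hD⟩ := exists_abs_logDetX_le hJ hJ2 hc (fun X hX => hεs hX)
  refine integrable_of_norm_le_of_large (C := D * C ^ 2) (R := R)
    (continuous_logDetX_transfer hJ hJ2 hc hp) fun lam hlam => ?_
  have hm : transfer p₀ lam ∈ Metric.closedBall (0 : Matrix r w ℂ) ε := by
    rw [mem_closedBall_zero_iff]
    exact (hb lam).trans (hR lam hlam)
  refine (hD _ hm).trans ?_
  rw [mul_assoc]
  gcongr
  exact sq_mul_le (norm_nonneg _) (hb lam)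

theorem continuous_traceX : Continuous fun X : Matrix r w ℂ => traceX J θ X := by
  unfold traceX
  have := continuous_psiX (r := r) (J := J)
  exact Complex.continuous_re.comp (by fun_prop)

theorem integrable_traceX_transfer (hp : IsHurwitz p₀.toBlocks₁₁) :
    Integrable fun lam => traceX J θ (transfer p₀ lam) := by
  obtain ⟨δ, hδ, C, hC, h⟩ := exists_transfer_bounds hp
  have hb := (h p₀ (Metric.mem_closedBall_self (le_of_lt hδ))).2.1
  obtain ⟨D, hD0, hD⟩ := exists_norm_trace_mul_le r w
  refine integrable_of_norm_le_of_large (C := |θ| * (D * ‖toC J‖ * C ^ 2)) (R := 0)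
    (continuous_traceX.comp (continuous_transfer hp)) fun lam _ => ?_
  set X := transfer p₀ lam
  have h1 : ‖(psiX J X).trace‖ ≤ D * ‖X‖ * (‖X‖ * ‖toC J‖) := by
    rw [psiX, Matrix.trace_mul_comm]
    refine (hD _ _).trans ?_
    gcongr
    exact frobenius_norm_mul _ _
  calc ‖traceX J θ X‖ ≤ ‖Complex.I * θ * (psiX J X).trace‖ := Complex.abs_re_le_norm _
    _ = |θ| * ‖(psiX J X).trace‖ := by simp
    _ ≤ |θ| * (D * ‖X‖ * (‖X‖ * ‖toC J‖)) := by gcongr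
    _ = |θ| * (D * ‖toC J‖ * ‖X‖ ^ 2) := by ring
    _ ≤ |θ| * (D * ‖toC J‖ * (C ^ 2 * (1 + lam ^ 2)⁻¹)) := by
        gcongr
        exact sq_mul_le (norm_nonneg _) (hb lam)
    _ = _ := by ring

/-- Conjugating the resolvent equation of a real matrix replaces λ by -λ. -/
theorem Gtf_neg {A : Matrix x x ℝ} (hA : IsHurwitz A) (lam : ℝ) :
    Gtf A (-lam) = (Gtf A lam).map conj := by
  have h := congrArg (fun M : Matrix x x ℂ => M.map conj) (hA.Gtf_mul lam)
  simp only [Matrix.map_mul] at h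
  refine Matrix.inv_eq_left_inv ?_
  convert h using 1
  · congr 1
    ext i j
    simp [toC, Matrix.one_apply, apply_ite]
  · ext i j
    simp [Matrix.one_apply, apply_ite]

theorem toC_map_conj {m n : Type*} (A : Matrix m n ℝ) : (toC A).map conj = toC A := by
  ext i j
  simp [toC]

theorem transfer_neg {p : Matrix (x ⊕ r) (x ⊕ w) ℝ} (hp : IsHurwitz p.toBlocks₁₁) (lam : ℝ) :
    transfer p (-lam) = (transfer p lam).map conj := by
  rw [transfer, transfer, Ftf, Ftf, Matrix.map_mul, Matrix.map_mul, Gtf_neg hp, toC_map_conj,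
    toC_map_conj]

theorem traceX_map_conj (X : Matrix r w ℂ) : traceX J θ (X.map conj) = -traceX J θ X := by
  have h : psiX J (X.map conj) = (psiX J X).map conj := by
    rw [psiX, psiX, Matrix.map_mul, Matrix.map_mul]
    congr 2
    · ext i j
      simp [toC]
  have h2 : (psiX J (X.map conj)).trace = conj (psiX J X).trace := by
    rw [h]
    simp [Matrix.trace]
  rw [traceX, traceX, h2]
  simp

/-- The integrand is odd: reversing λ conjugates Ψ, and the factor i turns this into a change of
sign. This removes the discrepancy between det D and det Δ. -/
theorem integral_traceX_transfer (hp : IsHurwitz p₀.toBlocks₁₁) :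
    ∫ lam, traceX J θ (transfer p₀ lam) = 0 := by
  have h := integral_neg_eq_self (fun lam => traceX J θ (transfer p₀ lam)) volume
  simp only [transfer_neg hp, traceX_map_conj, integral_neg] at h
  linarith

theorem logDetD_eq (hJ : Jᵀ = -J) (hJ2 : J * J = -1) (hc : c ≤ 1) (hp : StableBelow J θ c p₀)
    (lam : ℝ) :
    logDetD θ (PhiTf p₀.toBlocks₁₁ p₀.toBlocks₁₂ p₀.toBlocks₂₁)
      (PsiTf J p₀.toBlocks₁₁ p₀.toBlocks₁₂ p₀.toBlocks₂₁) lam =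
    logDetX J θ (transfer p₀ lam) - traceX J θ (transfer p₀ lam) :=
  log_det_dX hJ hJ2 hc (hp.2 lam)

theorem integrable_logDetD (hJ : Jᵀ = -J) (hJ2 : J * J = -1) (hc0 : 0 < c) (hc : c ≤ 1)
    (hp : StableBelow J θ c p₀) :
    Integrable (logDetD θ (PhiTf p₀.toBlocks₁₁ p₀.toBlocks₁₂ p₀.toBlocks₂₁)
      (PsiTf J p₀.toBlocks₁₁ p₀.toBlocks₁₂ p₀.toBlocks₂₁)) := by
  refine ((integrable_logDetX_transfer hJ hJ2 hc0 hc hp).sub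
    (integrable_traceX_transfer (J := J) (θ := θ) hp.1)).congr (ae_of_all _ fun lam => ?_)
  exact (logDetD_eq hJ hJ2 hc hp lam).symm

theorem rateTf_eq (hJ : Jᵀ = -J) (hJ2 : J * J = -1) (hc0 : 0 < c) (hc : c ≤ 1)
    (hp : StableBelow J θ c p₀) :
    rateTf J θ p₀.toBlocks₁₁ p₀.toBlocks₁₂ p₀.toBlocks₂₁ =
      -(1 / (4 * Real.pi)) * ∫ lam, logDetX J θ (transfer p₀ lam) := by
  rw [rateTf, rate]
  congr 1
  rw [integral_congr_ae (ae_of_all _ fun lam => logDetD_eq hJ hJ2 hc hp lam),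
    integral_sub (integrable_logDetX_transfer hJ hJ2 hc0 hc hp)
      (integrable_traceX_transfer hp.1), integral_traceX_transfer hp.1, sub_zero]

end StateSpaceAnalysis

theorem frob_apply {m n : Type*} [Fintype m] [Fintype n] (g X : Matrix m n ℝ) :
    frob g X = (gᵀ * X).trace := rfl

theorem frob_eq_sum {m n : Type*} [Fintype m] [Fintype n] (g X : Matrix m n ℝ) :
    frob g X = ∑ i, ∑ j, g i j * X i j := by
  rw [frob_apply, Finset.sum_comm]
  simp [Matrix.trace, Matrix.mul_apply]

theorem frob_single {m n : Type*} [Fintype m] [Fintype n] [DecidableEq m] [DecidableEq n]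
    (g : Matrix m n ℝ) (i : m) (j : n) : frob g (Matrix.single i j 1) = g i j := by
  rw [frob_eq_sum, Finset.sum_eq_single i, Finset.sum_eq_single j]
  · simp
  · intro b _ hb
    simp [hb.symm]
  · simp
  · intro b _ hb
    simp [hb.symm]
  · simp

theorem frob_map_re {m n : Type*} [Fintype m] [Fintype n] (M : Matrix m n ℂ)
    (q : Matrix m n ℝ) : frob (M.map Complex.re) q = ((toC q)ᵀ * M).trace.re := by
  rw [frob_eq_sum, Finset.sum_comm]
  simp [Matrix.trace, Matrix.mul_apply, toC, mul_comm]

/-! ### The core matrix as the gradient of the rate -/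

section CoreMatrix

open scoped Matrix.Norms.Frobenius

variable {x w r : Type*} [Fintype x] [DecidableEq x] [Fintype w] [DecidableEq w]
  [Fintype r] [DecidableEq r]

variable {J : Matrix w w ℝ} {θ c : ℝ} {p : Matrix (x ⊕ r) (x ⊕ w) ℝ}

theorem trace_transpose_mul_zeroBR (q : Matrix (x ⊕ r) (x ⊕ w) ℝ) (M : Matrix (x ⊕ r) (x ⊕ w) ℂ) :
    ((toC q)ᵀ * zeroBR M).trace = ((toC q.toBlocks₁₁)ᵀ * M.toBlocks₁₁).trace +
      ((toC q.toBlocks₂₁)ᵀ * M.toBlocks₂₁).trace + ((toC q.toBlocks₁₂)ᵀ * M.toBlocks₁₂).trace := by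
  have h : toC q = fromBlocks (toC q.toBlocks₁₁) (toC q.toBlocks₁₂) (toC q.toBlocks₂₁)
      (toC q.toBlocks₂₂) := (fromBlocks_toBlocks (toC q)).symm
  rw [h, fromBlocks_transpose, zeroBR, fromBlocks_multiply, Matrix.mul_zero,
    Matrix.mul_zero, add_zero, add_zero]
  simp [Matrix.trace, Finset.sum_add_distrib]

/-- The core matrix represents the derivative of the transfer matrix. -/
theorem frob_coreIntegrand (lam : ℝ) (q : Matrix (x ⊕ r) (x ⊕ w) ℝ) :
    frob (coreIntegrand J θ p.toBlocks₁₁ p.toBlocks₁₂ p.toBlocks₂₁ lam) q =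
      ((transferDeriv p lam q)ᴴ * xiX J θ (transfer p lam)).trace.re := by
  rw [coreIntegrand, frob_map_re, trace_transpose_mul_zeroBR]
  have hxi : phiTh J θ p.toBlocks₁₁ p.toBlocks₁₂ p.toBlocks₂₁ lam + (2 * Complex.I * θ) •
      psiTh J θ p.toBlocks₁₁ p.toBlocks₁₂ p.toBlocks₂₁ lam = xiX J θ (transfer p lam) := rfl
  rw [hxi]
  congr 1
  set ξ := xiX J θ (transfer p lam)
  rw [fromRows_mul, fromRows_mul_fromCols, toBlocks_fromBlocks₁₁, toBlocks_fromBlocks₁₂,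
    toBlocks_fromBlocks₂₁, Matrix.mul_one, Matrix.one_mul, transferDeriv]
  simp only [conjTranspose_add, conjTranspose_mul, toC_conjTranspose,
    Matrix.add_mul, trace_add]
  set G := (Gtf p.toBlocks₁₁ lam)ᴴ
  -- The three terms are the variations of 𝒞, 𝒜 and ℬ, in this order; the block replaced by zero
  -- corresponds to no coefficient of the system.
  refine congrArg₂ (· + ·) ((add_comm _ _).trans (congrArg₂ (· + ·) ?_ ?_)) ?_
  · rw [← Matrix.mul_assoc, trace_mul_comm]
    simp only [Matrix.mul_assoc]
  · rw [← Matrix.mul_assoc, trace_mul_comm]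
    simp only [Matrix.mul_assoc]
  · simp only [Matrix.mul_assoc]

/-- Each factor is O(1/|λ|): the derivative of the transfer matrix directly, and the gradient
because it is bounded by a multiple of the transfer matrix. Both hold uniformly near p₀, which gives
the dominating function. -/
theorem exists_bound_coreIntegrand (hJ : Jᵀ = -J) (hJ2 : J * J = -1) (hc0 : 0 < c) (hc : c ≤ 1)
    {p₀ : Matrix (x ⊕ r) (x ⊕ w) ℝ} (hp : StableBelow J θ c p₀) :
    ∃ δ > 0, ∃ C : ℝ, 0 ≤ C ∧ ∀ p ∈ Metric.closedBall p₀ δ, StableBelow J θ c p ∧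
      ∀ (lam : ℝ) (q : Matrix (x ⊕ r) (x ⊕ w) ℝ),
        |((transferDeriv p lam q)ᴴ * xiX J θ (transfer p lam)).trace.re| ≤
          C * (1 + lam ^ 2)⁻¹ * ‖q‖ := by
  obtain ⟨K, hK, hKs, δ, hδ, C, hC, h⟩ := hp.exists_compact hJ hc0
  obtain ⟨C₁, hC₁, h1⟩ := exists_norm_xiX_le hJ hJ2 hc hK hKs
  obtain ⟨C₂, hC₂, h2⟩ := exists_norm_trace_mul_le r w
  refine ⟨δ, hδ, C₂ * C * C₁ * C, by positivity, fun p hpm => ?_⟩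
  obtain ⟨e1, e2, e3, e4⟩ := h p hpm
  refine ⟨⟨e1, fun lam => hKs _ (e2 lam)⟩, fun lam q => ?_⟩
  calc |((transferDeriv p lam q)ᴴ * xiX J θ (transfer p lam)).trace.re|
      ≤ C₂ * ‖transferDeriv p lam q‖ * ‖xiX J θ (transfer p lam)‖ :=
        (Complex.abs_re_le_norm _).trans (h2 _ _)
    _ ≤ C₂ * (C * (1 + |lam|)⁻¹ * ‖q‖) * (C₁ * (C * (1 + |lam|)⁻¹)) := by
        gcongr
        · exact e4 lam q
        · refine (h1 _ (e2 lam)).trans ?_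
          gcongr
          exact e3 lam
    _ = C₂ * C * C₁ * C * ((1 + |lam|)⁻¹ * (1 + |lam|)⁻¹) * ‖q‖ := by ring
    _ ≤ _ := by
        gcongr
        exact inv_one_add_abs_sq_le lam

theorem continuous_frob_coreIntegrand (hJ : Jᵀ = -J) (hJ2 : J * J = -1) (hc : c ≤ 1)
    (hp : StableBelow J θ c p) (q : Matrix (x ⊕ r) (x ⊕ w) ℝ) :
    Continuous fun lam => ((transferDeriv p lam q)ᴴ * xiX J θ (transfer p lam)).trace.re := by
  have h1 := continuous_xiX_transfer hJ hJ2 hc hp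
  have h2 := continuous_transferDeriv hp.1 q
  exact Complex.continuous_re.comp ((h2.matrix_conjTranspose.matrix_mul h1).matrix_trace)

theorem integrable_frob_coreIntegrand (hJ : Jᵀ = -J) (hJ2 : J * J = -1) (hc0 : 0 < c)
    (hc : c ≤ 1) (hp : StableBelow J θ c p) (q : Matrix (x ⊕ r) (x ⊕ w) ℝ) :
    Integrable fun lam =>
      frob (coreIntegrand J θ p.toBlocks₁₁ p.toBlocks₁₂ p.toBlocks₂₁ lam) q := by
  simp only [frob_coreIntegrand]
  obtain ⟨δ, hδ, C, hC, h⟩ := exists_bound_coreIntegrand hJ hJ2 hc0 hc hp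
  refine integrable_of_norm_le_of_large (C := C * ‖q‖) (R := 0)
    (continuous_frob_coreIntegrand hJ hJ2 hc hp q) fun lam _ => ?_
  refine ((h p (Metric.mem_closedBall_self (le_of_lt hδ))).2 lam q).trans_eq ?_
  ring

theorem integrable_coreIntegrand (hJ : Jᵀ = -J) (hJ2 : J * J = -1) (hc0 : 0 < c)
    (hc : c ≤ 1) (hp : StableBelow J θ c p) (i : x ⊕ r) (j : x ⊕ w) :
    Integrable fun lam =>
      coreIntegrand J θ p.toBlocks₁₁ p.toBlocks₁₂ p.toBlocks₂₁ lam i j := by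
  have h := integrable_frob_coreIntegrand hJ hJ2 hc0 hc hp (Matrix.single i j 1)
  simpa only [frob_single] using h

theorem frob_core (hJ : Jᵀ = -J) (hJ2 : J * J = -1) (hc0 : 0 < c)
    (hc : c ≤ 1) (hp : StableBelow J θ c p) (q : Matrix (x ⊕ r) (x ⊕ w) ℝ) :
    frob (core J θ p.toBlocks₁₁ p.toBlocks₁₂ p.toBlocks₂₁) q = (1 / (2 * Real.pi)) *
      ∫ lam, frob (coreIntegrand J θ p.toBlocks₁₁ p.toBlocks₁₂ p.toBlocks₂₁ lam) q := by
  have hi := integrable_coreIntegrand hJ hJ2 hc0 hc hp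
  have e : ∫ lam, frob (coreIntegrand J θ p.toBlocks₁₁ p.toBlocks₁₂ p.toBlocks₂₁ lam) q =
      ∑ i, ∑ j, ∫ lam,
        coreIntegrand J θ p.toBlocks₁₁ p.toBlocks₁₂ p.toBlocks₂₁ lam i j * q i j := by
    simp only [frob_eq_sum]
    refine (integral_finsetSum _ fun i _ => integrable_finsetSum _ fun j _ =>
      (hi i j).mul_const _).trans ?_
    exact Finset.sum_congr rfl fun i _ => integral_finsetSum _ fun j _ => (hi i j).mul_const _
  rw [e, frob_eq_sum, Finset.mul_sum]
  refine Finset.sum_congr rfl fun i _ => ?_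
  rw [Finset.mul_sum]
  refine Finset.sum_congr rfl fun j _ => ?_
  rw [integral_mul_const, core, Matrix.of_apply, mul_assoc]

/-- The Frechet derivative of the QEF rate with respect to the matrices of the system. -/
theorem hasFDerivAt_rateTf (hJ : Jᵀ = -J) (hJ2 : J * J = -1) (hc0 : 0 < c) (hc : c ≤ 1)
    {p₀ : Matrix (x ⊕ r) (x ⊕ w) ℝ} (hp : StableBelow J θ c p₀) :
    HasFDerivAt (fun p : Matrix (x ⊕ r) (x ⊕ w) ℝ =>
        rateTf J θ p.toBlocks₁₁ p.toBlocks₁₂ p.toBlocks₂₁)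
      (frob (θ • core J θ p₀.toBlocks₁₁ p₀.toBlocks₁₂ p₀.toBlocks₂₁)) p₀ := by
  obtain ⟨δ, hδ, C, hC, h⟩ := exists_bound_coreIntegrand hJ hJ2 hc0 hc hp
  have hdet : ∀ p ∈ Metric.closedBall p₀ δ, ∀ lam, (deltaX J θ (transfer p lam)).det.im = 0 ∧
      0 < (deltaX J θ (transfer p lam)).det.re := fun p hp lam =>
    det_deltaX_pos hJ hJ2 hc ((h p hp).1.2 lam)
  have hdiff : ∀ p ∈ Metric.closedBall p₀ δ, ∀ lam, DifferentiableAt ℝ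
      (fun p : Matrix (x ⊕ r) (x ⊕ w) ℝ => logDetX J θ (transfer p lam)) p := fun p hpm lam => by
    exact DifferentiableAt.comp (f := fun p : Matrix (x ⊕ r) (x ⊕ w) ℝ => transfer p lam) p
      (differentiableAt_logDetX (hdet p hpm lam).2.ne')
      (differentiableAt_transfer (h p hpm).1.1 lam)
  have hderiv : ∀ p ∈ Metric.closedBall p₀ δ, ∀ lam q, HasDerivAt
      (fun s : ℝ => logDetX J θ (transfer (p + s • q) lam))
      (-2 * θ * ((transferDeriv p lam q)ᴴ * xiX J θ (transfer p lam)).trace.re) 0 :=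
      fun p hpm lam q => by
    have hp0 : p + (0 : ℝ) • q = p := by rw [zero_smul, add_zero]
    have h1 := hasDerivAt_transfer (p := p) (q := q) (t := 0)
      (by rw [hp0]; exact (h p hpm).1.1) lam
    have h2 := hasDerivAt_logDetX (θ := θ) hJ h1 (by rw [hp0]; exact (hdet p hpm lam).1)
      (by rw [hp0]; exact (hdet p hpm lam).2)
    rw [hp0] at h2
    exact h2
  have hbound : ∀ p ∈ Metric.closedBall p₀ δ, ∀ (lam : ℝ) (q : Matrix (x ⊕ r) (x ⊕ w) ℝ),
      |-2 * θ * ((transferDeriv p lam q)ᴴ * xiX J θ (transfer p lam)).trace.re| ≤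
        2 * |θ| * C * (1 + lam ^ 2)⁻¹ * ‖q‖ := fun p hpm lam q => by
    have := (h p hpm).2 lam q
    rw [abs_mul, abs_mul]
    calc |(-2 : ℝ)| * |θ| * _ ≤ |(-2 : ℝ)| * |θ| * (C * (1 + lam ^ 2)⁻¹ * ‖q‖) := by gcongr
      _ = _ := by norm_num; ring
  obtain ⟨L, hL, hLq⟩ := exists_hasFDerivAt_integral hδ (by positivity) hdiff hderiv hbound
    (fun p hpm => continuous_logDetX_transfer hJ hJ2 hc (h p hpm).1)
    (integrable_logDetX_transfer hJ hJ2 hc0 hc hp)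
    (fun q => continuous_const.mul (continuous_frob_coreIntegrand hJ hJ2 hc hp q))
  have e1 : HasFDerivAt (fun p : Matrix (x ⊕ r) (x ⊕ w) ℝ =>
      -(1 / (4 * Real.pi)) * ∫ lam, logDetX J θ (transfer p lam))
      ((-(1 / (4 * Real.pi))) • L) p₀ := hL.const_mul _
  have e2 : (-(1 / (4 * Real.pi))) • L =
      frob (θ • core J θ p₀.toBlocks₁₁ p₀.toBlocks₁₂ p₀.toBlocks₂₁) := by
    ext q
    have e3 : frob (θ • core J θ p₀.toBlocks₁₁ p₀.toBlocks₁₂ p₀.toBlocks₂₁) q =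
        θ * frob (core J θ p₀.toBlocks₁₁ p₀.toBlocks₁₂ p₀.toBlocks₂₁) q := by
      simp [frob_apply]
    refine Eq.trans ?_ e3.symm
    rw [frob_core hJ hJ2 hc0 hc hp]
    simp only [frob_coreIntegrand]
    have e4 : ((-(1 / (4 * Real.pi))) • L) q = (-(1 / (4 * Real.pi))) * L q := rfl
    -- The constants match because -(1/4π)·(-2θ) = θ/(2π).
    rw [e4, hLq, integral_const_mul]
    field_simp
    norm_num
  rw [e2] at e1
  -- The rate equals the integral of ln det Δ at systems satisfying the constraint, and these fill a
  -- neighbourhood of p₀.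
  refine HasFDerivAt.congr_of_eventuallyEq e1 ?_
  filter_upwards [hp.eventually hJ hc0] with p hpp
  exact rateTf_eq hJ hJ2 hc0 hc hpp

theorem ofReal_smul_mem_spectrum {n : Type*} [Fintype n] [DecidableEq n] {M : Matrix n n ℂ}
    (hθ : θ ≠ 0) {y : ℝ} : ((θ * y : ℝ) : ℂ) ∈ spectrum ℂ ((θ : ℂ) • M) ↔ (y : ℂ) ∈ spectrum ℂ M := by
  have hθ' : (θ : ℂ) ≠ 0 := Complex.ofReal_ne_zero.2 hθ
  have h := spectrum.smul_mem_smul_iff (a := M) (s := (y : ℂ)) (r := Units.mk0 (θ : ℂ) hθ')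
  rw [← h, Complex.ofReal_mul]
  rfl

theorem stableBelow_of_specConstraint (hθ : 0 < θ) (h1 : IsHurwitz p.toBlocks₁₁)
    (h2 : SpecConstraint θ (PhiTf p.toBlocks₁₁ p.toBlocks₁₂ p.toBlocks₂₁)
      (PsiTf J p.toBlocks₁₁ p.toBlocks₁₂ p.toBlocks₂₁)) :
    ∃ c, 0 < c ∧ c < 1 ∧ StableBelow J θ c p := by
  obtain ⟨c, hc, h⟩ := h2
  have hm : max c 0 < 1 := max_lt hc zero_lt_one
  -- The midpoint between max c 0 and 1: strictly above c because `SpecBelow` excludes its own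
  -- endpoint, positive for the behaviour at infinity, and still below 1.
  refine ⟨(1 + max c 0) / 2, by positivity, by linarith, h1, fun lam y hy hmem => ?_⟩
  have h3 : (y : ℂ) = ((θ * (y / θ) : ℝ) : ℂ) := by rw [mul_div_cancel₀ _ hθ.ne']
  rw [h3, tancX, ofReal_smul_mem_spectrum hθ.ne'] at hmem
  have h4 := h lam _ hmem
  rw [mul_div_cancel₀ _ hθ.ne'] at h4
  linarith [le_max_left c 0]

theorem StableBelow.specConstraint (hθ : 0 < θ) (hc : c < 1) (hp : StableBelow J θ c p) :
    SpecConstraint θ (PhiTf p.toBlocks₁₁ p.toBlocks₁₂ p.toBlocks₂₁)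
      (PsiTf J p.toBlocks₁₁ p.toBlocks₁₂ p.toBlocks₂₁) := by
  refine ⟨c, hc, fun lam y hy => ?_⟩
  by_contra hlt
  refine hp.2 lam (θ * y) (not_le.1 hlt).le ?_
  rw [tancX, ofReal_smul_mem_spectrum hθ.ne']
  exact hy

end CoreMatrix

/-! ### Exponentially decaying functions -/

section ExpDecay

variable {𝕜 : Type*} [RCLike 𝕜]

/-- Exponential decay at infinity. -/
def ExpDecay (f : ℝ → 𝕜) : Prop :=
  ∃ C ε : ℝ, 0 ≤ C ∧ 0 < ε ∧ ∀ t, 0 ≤ t → ‖f t‖ ≤ C * Real.exp (-ε * t)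

namespace ExpDecay

variable {f g : ℝ → 𝕜}

theorem zero : ExpDecay (fun _ => (0 : 𝕜)) := ⟨0, 1, le_rfl, one_pos, fun t _ => by simp⟩

theorem add (hf : ExpDecay f) (hg : ExpDecay g) : ExpDecay fun t => f t + g t := by
  obtain ⟨C, ε, hC, hε, h⟩ := hf
  obtain ⟨D, δ, hD, hδ, k⟩ := hg
  refine ⟨C + D, min ε δ, by positivity, lt_min hε hδ, fun t ht => ?_⟩
  have h1 : Real.exp (-ε * t) ≤ Real.exp (-min ε δ * t) := by
    gcongr
    exact min_le_left _ _
  have h2 : Real.exp (-δ * t) ≤ Real.exp (-min ε δ * t) := by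
    gcongr
    exact min_le_right _ _
  calc ‖f t + g t‖ ≤ ‖f t‖ + ‖g t‖ := norm_add_le _ _
    _ ≤ C * Real.exp (-ε * t) + D * Real.exp (-δ * t) := add_le_add (h t ht) (k t ht)
    _ ≤ C * Real.exp (-min ε δ * t) + D * Real.exp (-min ε δ * t) := by gcongr
    _ = _ := by ring

theorem sum {ι : Type*} {s : Finset ι} {f : ι → ℝ → 𝕜} (h : ∀ i ∈ s, ExpDecay (f i)) :
    ExpDecay fun t => ∑ i ∈ s, f i t := by
  classical
  induction s using Finset.induction_on with
  | empty => simpa using zero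
  | insert a s ha ih =>
    simp only [Finset.sum_insert ha]
    exact (h a (Finset.mem_insert_self a s)).add
      (ih fun i hi => h i (Finset.mem_insert_of_mem hi))

theorem mul_bounded (hf : ExpDecay f) {B : ℝ} (hg : ∀ t, 0 ≤ t → ‖g t‖ ≤ B) :
    ExpDecay fun t => f t * g t := by
  obtain ⟨C, ε, hC, hε, h⟩ := hf
  have hB : 0 ≤ B := (norm_nonneg _).trans (hg 0 le_rfl)
  refine ⟨C * B, ε, by positivity, hε, fun t ht => ?_⟩
  calc ‖f t * g t‖ = ‖f t‖ * ‖g t‖ := norm_mul _ _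
    _ ≤ (C * Real.exp (-ε * t)) * B := by gcongr; exacts [h t ht, hg t ht]
    _ = _ := by ring

theorem mul_const (hf : ExpDecay f) (c : 𝕜) : ExpDecay fun t => f t * c :=
  hf.mul_bounded (g := fun _ => c) (B := ‖c‖) fun _ _ => le_rfl

theorem const_mul (hf : ExpDecay f) (c : 𝕜) : ExpDecay fun t => c * f t := by
  simpa only [mul_comm c] using hf.mul_const c

theorem mul (hf : ExpDecay f) (hg : ExpDecay g) : ExpDecay fun t => f t * g t := by
  obtain ⟨D, δ, hD, hδ, k⟩ := hg
  refine hf.mul_bounded (B := D) fun t ht => (k t ht).trans ?_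
  refine mul_le_of_le_one_right hD (Real.exp_le_one_iff.2 ?_)
  nlinarith

theorem integrableOn (hf : ExpDecay f) (hc : Continuous f) : IntegrableOn f (Set.Ioi 0) := by
  obtain ⟨C, ε, hC, hε, h⟩ := hf
  refine ((exp_neg_integrableOn_Ioi 0 hε).const_mul C).mono' hc.aestronglyMeasurable ?_
  filter_upwards [ae_restrict_mem measurableSet_Ioi] with t ht
  exact h t (le_of_lt ht)

theorem tendsto (hf : ExpDecay f) : Tendsto f atTop (𝓝 0) := by
  obtain ⟨C, ε, hC, hε, h⟩ := hf
  have h1 : Tendsto (fun t : ℝ => C * Real.exp (-ε * t)) atTop (𝓝 0) := by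
    have h2 : Tendsto (fun t : ℝ => -ε * t) atTop atBot :=
      tendsto_id.const_mul_atTop_of_neg (neg_neg_of_pos hε)
    simpa using (Real.tendsto_exp_atBot.comp h2).const_mul C
  refine squeeze_zero_norm' ?_ h1
  filter_upwards [eventually_ge_atTop 0] with t ht
  exact h t ht

end ExpDecay

theorem expDecay_matrix_mul {l m n : Type*} [Fintype m] {A : ℝ → Matrix l m 𝕜}
    {B : ℝ → Matrix m n 𝕜} (hA : ∀ i j, ExpDecay fun t => A t i j)
    (hB : ∀ i j, ExpDecay fun t => B t i j) (i : l) (j : n) :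
    ExpDecay fun t => (A t * B t) i j := by
  simp only [Matrix.mul_apply]
  exact ExpDecay.sum fun k _ => (hA i k).mul (hB k j)

theorem expDecay_matrix_mul_const {l m n : Type*} [Fintype m] {A : ℝ → Matrix l m 𝕜}
    (hA : ∀ i j, ExpDecay fun t => A t i j) (B : Matrix m n 𝕜) (i : l) (j : n) :
    ExpDecay fun t => (A t * B) i j := by
  simp only [Matrix.mul_apply]
  exact ExpDecay.sum fun k _ => (hA i k).mul_const _

theorem expDecay_const_mul_matrix {l m n : Type*} [Fintype m] (A : Matrix l m 𝕜)
    {B : ℝ → Matrix m n 𝕜} (hB : ∀ i j, ExpDecay fun t => B t i j) (i : l) (j : n) :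
    ExpDecay fun t => (A * B t) i j := by
  simp only [Matrix.mul_apply]
  exact ExpDecay.sum fun k _ => (hB k j).const_mul _

end ExpDecay

/-! ### Exponential decay of e^{tA} for Hurwitz A -/

section MatrixExponential

open scoped Matrix.Norms.Frobenius

variable {n : Type*} [Fintype n] [DecidableEq n]

theorem hasDerivAt_exp_smul (M : Matrix n n ℂ) (t : ℝ) :
    HasDerivAt (fun s : ℝ => NormedSpace.exp (s • M)) (M * NormedSpace.exp (t • M)) t := by
  have : CompleteSpace (Matrix n n ℂ) := FiniteDimensional.complete ℂ _
  exact hasDerivAt_exp_smul_const' M t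

theorem continuous_exp_smul (M : Matrix n n ℂ) :
    Continuous fun s : ℝ => NormedSpace.exp (s • M) :=
  continuous_matExp.comp (continuous_id.smul continuous_const)

theorem toC_exp (A : Matrix n n ℝ) : toC (NormedSpace.exp A) = NormedSpace.exp (toC A) := by
  have : CompleteSpace (Matrix n n ℝ) := FiniteDimensional.complete ℝ _
  exact NormedSpace.map_exp (Complex.ofRealHom.mapMatrix (m := n)) continuous_toC A

theorem toC_exp_smul (A : Matrix n n ℝ) (t : ℝ) :
    toC (NormedSpace.exp (t • A)) = NormedSpace.exp (t • toC A) := by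
  rw [toC_exp, toC_smul]

theorem exp_scalar_add (z : ℂ) (N : Matrix n n ℂ) :
    NormedSpace.exp (z • (1 : Matrix n n ℂ) + N) = Complex.exp z • NormedSpace.exp N := by
  have h1 : NormedSpace.exp (z • (1 : Matrix n n ℂ)) = Complex.exp z • (1 : Matrix n n ℂ) := by
    have := NormedSpace.algebraMap_exp_comm (𝕂 := ℂ) (𝔸 := Matrix n n ℂ) z
    rw [Algebra.algebraMap_eq_smul_one, Algebra.algebraMap_eq_smul_one] at this
    rw [Complex.exp_eq_exp_ℂ]
    exact this.symm
  rw [Matrix.exp_add_of_commute _ _ ((Commute.one_left N).smul_left z), h1, Matrix.smul_mul,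
    Matrix.one_mul]

theorem exp_mulVec_of_pow_mulVec_eq_zero {N : Matrix n n ℂ} {v : n → ℂ} {m : ℕ}
    (h : N ^ m *ᵥ v = 0) (t : ℝ) :
    NormedSpace.exp (t • N) *ᵥ v =
      ∑ k ∈ Finset.range m, ((t ^ k / (k.factorial : ℝ) : ℝ) : ℂ) • (N ^ k *ᵥ v) := by
  have : CompleteSpace (Matrix n n ℂ) := FiniteDimensional.complete ℂ _
  have h1 := NormedSpace.exp_series_hasSum_exp' (𝕂 := ℂ) (t • N)
  have hc : Continuous fun A : Matrix n n ℂ => A *ᵥ v :=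
    Continuous.matrix_mulVec continuous_id continuous_const
  have h2 := h1.map (AddMonoidHom.mk' (fun A : Matrix n n ℂ => A *ᵥ v)
    fun A B => add_mulVec A B v) hc
  have h3 : ∀ k, ((k.factorial : ℂ)⁻¹ • (t • N) ^ k) *ᵥ v =
      ((t ^ k / (k.factorial : ℝ) : ℝ) : ℂ) • (N ^ k *ᵥ v) := by
    intro k
    rw [smul_pow, ← Complex.coe_smul, smul_smul, smul_mulVec]
    congr 1
    push_cast
    ring
  have h4 : HasSum (fun k => ((t ^ k / (k.factorial : ℝ) : ℝ) : ℂ) • (N ^ k *ᵥ v))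
      (NormedSpace.exp (t • N) *ᵥ v) := by
    simp only [← h3]
    exact h2
  refine h4.unique (hasSum_sum_of_ne_finset_zero fun k hk => ?_)
  obtain ⟨j, rfl⟩ := Nat.exists_eq_add_of_le (not_lt.1 (fun hlt => hk (Finset.mem_range.2 hlt)))
  rw [add_comm, pow_add N, ← mulVec_mulVec, h, mulVec_zero, smul_zero]

/-- Half of the decay rate is spent on the polynomial factor, through (at)^k / k! ≤ e^{at}. -/
theorem pow_div_factorial_mul_exp_le {a t : ℝ} (ha : 0 < a) (ht : 0 ≤ t) (k : ℕ) :
    t ^ k / k.factorial * Real.exp (-(2 * a) * t) ≤ a⁻¹ ^ k * Real.exp (-a * t) := by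
  have h1 := Real.pow_div_factorial_le_exp (a * t) (by positivity) k
  have h2 : t ^ k / k.factorial = a⁻¹ ^ k * ((a * t) ^ k / k.factorial) := by
    rw [mul_pow, ← mul_div_assoc, ← mul_assoc, ← mul_pow, inv_mul_cancel₀ ha.ne', one_pow, one_mul]
  have h3 : Real.exp (-a * t) = Real.exp (a * t) * Real.exp (-(2 * a) * t) := by
    rw [← Real.exp_add]
    congr 1
    ring
  rw [h2, h3, ← mul_assoc]
  gcongr

theorem expDecay_pow_mul_exp {z : ℂ} (hz : z.re < 0) (k : ℕ) :
    ExpDecay fun t : ℝ => Complex.exp (t * z) * ((t ^ k / (k.factorial : ℝ) : ℝ) : ℂ) := by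
  have ha : 0 < -z.re / 2 := by linarith
  refine ⟨(-z.re / 2)⁻¹ ^ k, -z.re / 2, by positivity, ha, fun t ht => ?_⟩
  refine le_trans (le_of_eq ?_) (pow_div_factorial_mul_exp_le ha ht k)
  rw [norm_mul, Complex.norm_exp, Complex.norm_real, Real.norm_of_nonneg (by positivity), mul_comm]
  congr 2
  simp
  ring

theorem expDecay_exp_mulVec_of_genEigenvector {M : Matrix n n ℂ} {z : ℂ} (hz : z.re < 0)
    {v : n → ℂ} {m : ℕ} (h : (M - z • 1) ^ m *ᵥ v = 0) (i : n) :
    ExpDecay fun t : ℝ => (NormedSpace.exp (t • M) *ᵥ v) i := by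
  have e : ∀ t : ℝ, (NormedSpace.exp (t • M) *ᵥ v) i = ∑ k ∈ Finset.range m,
      Complex.exp (t * z) * ((t ^ k / (k.factorial : ℝ) : ℝ) : ℂ) *
        ((M - z • 1) ^ k *ᵥ v) i := by
    intro t
    have h1 : t • M = (t * z) • (1 : Matrix n n ℂ) + t • (M - z • 1) := by
      rw [smul_sub, ← Complex.coe_smul t (z • (1 : Matrix n n ℂ)), smul_smul, add_sub_cancel]
    rw [h1, exp_scalar_add, smul_mulVec, exp_mulVec_of_pow_mulVec_eq_zero h]
    simp [Finset.mul_sum, mul_assoc]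
  simp only [e]
  exact ExpDecay.sum fun k _ => (expDecay_pow_mul_exp hz k).mul_const _

/-- The vectors with decaying orbits form a subspace. It contains each generalized eigenspace, on
which e^{tM} is e^{tz} times a polynomial in t, and these span the whole space. -/
theorem expDecay_exp_mulVec {M : Matrix n n ℂ} (hM : ∀ z ∈ spectrum ℂ M, z.re < 0)
    (v : n → ℂ) (i : n) : ExpDecay fun t : ℝ => (NormedSpace.exp (t • M) *ᵥ v) i := by
  let V : Submodule ℂ (n → ℂ) :=
    { carrier := {v | ∀ i, ExpDecay fun t : ℝ => (NormedSpace.exp (t • M) *ᵥ v) i}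
      zero_mem' := fun i => by simpa using ExpDecay.zero
      add_mem' := fun {v w} hv hw i => by
        simpa only [mulVec_add, Pi.add_apply] using (hv i).add (hw i)
      smul_mem' := fun c v hv i => by
        simpa only [mulVec_smul, Pi.smul_apply, smul_eq_mul] using (hv i).const_mul c }
  have hV : (⊤ : Submodule ℂ (n → ℂ)) ≤ V := by
    rw [← Module.End.iSup_maxGenEigenspace_eq_top (Matrix.toLin' M)]
    refine iSup_le fun z u hu i => ?_
    obtain ⟨k, hk⟩ := (Module.End.mem_maxGenEigenspace _ _ _).1 hu
    have e : Matrix.toLin' M - z • (1 : Module.End ℂ (n → ℂ)) = Matrix.toLin' (M - z • 1) := by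
      rw [map_sub, map_smul, Matrix.toLin'_one]
      rfl
    rw [e, ← Matrix.toLin'_pow, Matrix.toLin'_apply] at hk
    by_cases hz : z ∈ spectrum ℂ M
    · exact expDecay_exp_mulVec_of_genEigenvector (hM z hz) hk i
    · have hu1 : IsUnit (M - z • (1 : Matrix n n ℂ)) := by
        have := (spectrum.notMem_iff.1 hz).neg
        rwa [neg_sub, Algebra.algebraMap_eq_smul_one] at this
      obtain ⟨U, hU⟩ := hu1.pow k
      have hu0 : u = 0 := by
        rw [← one_mulVec u, ← U.inv_mul, ← mulVec_mulVec, hU, hk, mulVec_zero]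
      simpa [hu0] using ExpDecay.zero
  exact hV (Submodule.mem_top (x := v)) i

theorem IsHurwitz.expDecay {A : Matrix n n ℝ} (hA : IsHurwitz A) (i j : n) :
    ExpDecay fun t : ℝ => NormedSpace.exp (t • toC A) i j := by
  have := expDecay_exp_mulVec hA (Pi.single j 1) i
  simpa [Matrix.mulVec_single] using this

end MatrixExponential

/-! ### Entrywise integrals of matrix functions -/

section EntryIntegral

variable {𝕜 : Type*} [RCLike 𝕜] {l m n : Type*} [Fintype m] {μ : Measure ℝ}

/-- The entrywise integral of a matrix-valued function. -/
def entryIntegral (μ : Measure ℝ) (f : ℝ → Matrix l n 𝕜) : Matrix l n 𝕜 :=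
  Matrix.of fun i j => ∫ t, f t i j ∂μ

theorem integrable_const_mul_matrix (A : Matrix l m 𝕜) {f : ℝ → Matrix m n 𝕜}
    (hf : ∀ i j, Integrable (fun t => f t i j) μ) (i : l) (j : n) :
    Integrable (fun t => (A * f t) i j) μ := by
  simp only [Matrix.mul_apply]
  exact integrable_finsetSum _ fun k _ => (hf k j).const_mul _

theorem integrable_mul_const_matrix {f : ℝ → Matrix l m 𝕜} (A : Matrix m n 𝕜)
    (hf : ∀ i j, Integrable (fun t => f t i j) μ) (i : l) (j : n) :
    Integrable (fun t => (f t * A) i j) μ := by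
  simp only [Matrix.mul_apply]
  exact integrable_finsetSum _ fun k _ => (hf i k).mul_const _

theorem entryIntegral_const_mul (A : Matrix l m 𝕜) {f : ℝ → Matrix m n 𝕜}
    (hf : ∀ i j, Integrable (fun t => f t i j) μ) :
    entryIntegral μ (fun t => A * f t) = A * entryIntegral μ f := by
  ext i j
  simp only [entryIntegral, Matrix.of_apply, Matrix.mul_apply]
  rw [integral_finsetSum _ fun k _ => (hf k j).const_mul _]
  exact Finset.sum_congr rfl fun k _ => integral_const_mul _ _

theorem entryIntegral_mul_const {f : ℝ → Matrix l m 𝕜} (A : Matrix m n 𝕜)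
    (hf : ∀ i j, Integrable (fun t => f t i j) μ) :
    entryIntegral μ (fun t => f t * A) = entryIntegral μ f * A := by
  ext i j
  simp only [entryIntegral, Matrix.of_apply, Matrix.mul_apply]
  rw [integral_finsetSum _ fun k _ => (hf i k).mul_const _]
  exact Finset.sum_congr rfl fun k _ => integral_mul_const _ _

theorem entryIntegral_add {f g : ℝ → Matrix l n 𝕜}
    (hf : ∀ i j, Integrable (fun t => f t i j) μ) (hg : ∀ i j, Integrable (fun t => g t i j) μ) :
    entryIntegral μ (fun t => f t + g t) = entryIntegral μ f + entryIntegral μ g := by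
  ext i j
  exact integral_add (hf i j) (hg i j)

theorem entryIntegral_conjTranspose (f : ℝ → Matrix l n ℂ) :
    entryIntegral μ (fun t => (f t)ᴴ) = (entryIntegral μ f)ᴴ := by
  ext i j
  exact integral_conj

/-- The fundamental theorem of calculus on the half-line. -/
theorem entryIntegral_Ioi_of_hasDerivAt {l n : Type*} [Fintype l] [Fintype n]
    {f f' : ℝ → Matrix l n ℂ}
    (hd : ∀ i j t, HasDerivAt (fun s => f s i j) (f' t i j) t)
    (hi : ∀ i j, IntegrableOn (fun t => f' t i j) (Set.Ioi 0))
    (h0 : ∀ i j, Tendsto (fun t => f t i j) atTop (𝓝 0)) :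
    entryIntegral (volume.restrict (Set.Ioi 0)) f' = -f 0 := by
  ext i j
  refine (integral_Ioi_of_hasDerivAt_of_tendsto' (fun t _ => hd i j t) (hi i j) (h0 i j)).trans ?_
  simp

end EntryIntegral

/-! ### Spectral densities from the covariance and commutator kernels -/

section StateSpaceFourier

open scoped Matrix.Norms.Frobenius

variable {x w r : Type*} [Fintype x] [DecidableEq x] [Fintype w] [DecidableEq w]
  [Fintype r] [DecidableEq r] {A : Matrix x x ℝ}

theorem exp_smul_mul_comm (M : Matrix x x ℂ) (t : ℝ) :
    M * NormedSpace.exp (t • M) = NormedSpace.exp (t • M) * M :=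
  (((Commute.refl M).smul_right t).exp_right).eq

theorem exp_smul_transpose (M : Matrix x x ℂ) (t : ℝ) :
    NormedSpace.exp (t • Mᵀ) = (NormedSpace.exp (t • M))ᵀ := by
  rw [← Matrix.exp_transpose, transpose_smul]

theorem IsHurwitz.expDecay_transpose (hA : IsHurwitz A) (i j : x) :
    ExpDecay fun t : ℝ => NormedSpace.exp (t • (toC A)ᵀ) i j := by
  simp only [exp_smul_transpose, transpose_apply]
  exact hA.expDecay j i

/-- `exp (-i λ t) exp (t A)`. -/
def modExp (A : Matrix x x ℝ) (lam t : ℝ) : Matrix x x ℂ :=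
  Complex.exp (-Complex.I * lam * t) • NormedSpace.exp (t • toC A)

theorem norm_cexp_modulation (lam t : ℝ) : ‖Complex.exp (-Complex.I * lam * t)‖ = 1 := by
  rw [Complex.norm_exp]
  simp

theorem IsHurwitz.expDecay_modExp (hA : IsHurwitz A) (lam : ℝ) (i j : x) :
    ExpDecay fun t : ℝ => modExp A lam t i j := by
  obtain ⟨C, ε, hC, hε, h⟩ := hA.expDecay i j
  refine ⟨C, ε, hC, hε, fun t ht => ?_⟩
  refine le_trans (le_of_eq ?_) (h t ht)
  simp only [modExp, Matrix.smul_apply, smul_eq_mul, norm_mul, norm_cexp_modulation, one_mul]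

theorem continuous_modExp (lam : ℝ) : Continuous (modExp A lam) := by
  have := continuous_exp_smul (toC A)
  unfold modExp
  have h : Continuous fun t : ℝ => Complex.exp (-Complex.I * lam * t) := by fun_prop
  exact h.smul this

theorem IsHurwitz.integrableOn_modExp (hA : IsHurwitz A) (lam : ℝ) (i j : x) :
    IntegrableOn (fun t => modExp A lam t i j) (Set.Ioi 0) :=
  (hA.expDecay_modExp lam i j).integrableOn ((continuous_modExp lam).matrix_elem i j)

theorem hasDerivAt_modExp (lam t : ℝ) :
    HasDerivAt (modExp A lam)
      (-(((Complex.I * lam) • (1 : Matrix x x ℂ) - toC A) * modExp A lam t)) t := by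
  have h1 : HasDerivAt (fun s : ℝ => Complex.exp (-Complex.I * lam * s))
      (Complex.exp (-Complex.I * lam * t) * (-Complex.I * lam * 1)) t :=
    (((hasDerivAt_id (t : ℂ)).const_mul (-Complex.I * lam)).comp_ofReal).cexp
  refine (h1.smul (hasDerivAt_exp_smul (toC A) t)).congr_deriv ?_
  rw [modExp, Matrix.sub_mul, Matrix.smul_mul, Matrix.one_mul, Matrix.mul_smul, smul_smul, neg_sub,
    sub_eq_add_neg, ← neg_smul]
  congr 2
  ring

/-- The one-sided Fourier transform of the matrix exponential is the resolvent. -/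
theorem IsHurwitz.entryIntegral_modExp (hA : IsHurwitz A) (lam : ℝ) :
    entryIntegral (volume.restrict (Set.Ioi 0)) (modExp A lam) = Gtf A lam := by
  -- An explicit antiderivative: the resolvent cancels the factor iλ - A produced by
  -- differentiation.
  have hd : ∀ i j t, HasDerivAt (fun s => (-Gtf A lam * modExp A lam s) i j)
      (modExp A lam t i j) t := by
    intro i j t
    have h1 := hasDerivAt_const_mul_matrix (-Gtf A lam) (hasDerivAt_modExp (A := A) lam t)
    rw [Matrix.neg_mul, Matrix.mul_neg, neg_neg, ← Matrix.mul_assoc, hA.Gtf_mul, Matrix.one_mul] at h1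
    exact hasDerivAt_matrix_iff.1 h1 i j
  rw [entryIntegral_Ioi_of_hasDerivAt hd (hA.integrableOn_modExp lam) fun i j =>
    (expDecay_const_mul_matrix _ (hA.expDecay_modExp lam) i j).tendsto]
  simp [modExp]

theorem toC_kernelV_of_nonneg (Q : Matrix x x ℝ) {t : ℝ} (ht : 0 ≤ t) :
    toC (kernelV Q A t) = NormedSpace.exp (t • toC A) * toC Q := by
  rw [kernelV, if_pos ht, toC_mul, toC_exp_smul]

theorem toC_kernelV_of_nonpos (Q : Matrix x x ℝ) {t : ℝ} (ht : t ≤ 0) :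
    toC (kernelV Q A t) = toC Q * NormedSpace.exp (-t • (toC A)ᵀ) := by
  rcases ht.lt_or_eq with h | rfl
  · rw [kernelV, if_neg (not_le.2 h), toC_mul, toC_exp_smul, toC_transpose]
  · rw [toC_kernelV_of_nonneg Q le_rfl]
    simp

theorem modExp_conjTranspose (lam t : ℝ) : (modExp A lam t)ᴴ =
    Complex.exp (Complex.I * lam * t) • NormedSpace.exp (t • (toC A)ᵀ) := by
  rw [modExp, conjTranspose_smul, ← Matrix.exp_conjTranspose, conjTranspose_smul,
    toC_conjTranspose]
  simp [← Complex.exp_conj]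

/-- The Fourier transform of the two-point kernel. -/
theorem IsHurwitz.fourier_kernelV (hA : IsHurwitz A) (Q : Matrix x x ℝ) (lam : ℝ) :
    (∀ i j, Integrable fun t : ℝ =>
      (Complex.exp (-Complex.I * lam * t) • toC (kernelV Q A t)) i j) ∧
    entryIntegral volume (fun t : ℝ => Complex.exp (-Complex.I * lam * t) • toC (kernelV Q A t)) =
      Gtf A lam * toC Q + toC Q * (Gtf A lam)ᴴ := by
  set f : ℝ → Matrix x x ℂ := fun t => Complex.exp (-Complex.I * lam * t) • toC (kernelV Q A t)
    with hf
  have hpos : ∀ t ∈ Set.Ioi (0 : ℝ), f t = modExp A lam t * toC Q := by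
    intro t ht
    simp only [hf]
    rw [toC_kernelV_of_nonneg Q (le_of_lt ht), modExp, Matrix.smul_mul]
  -- Reflection turns the negative half-line into an adjoint of the positive one, so its
  -- contribution is Q G*.
  have hneg : ∀ t ∈ Set.Ioi (0 : ℝ), f (-t) = toC Q * (modExp A lam t)ᴴ := by
    intro t ht
    simp only [hf]
    rw [toC_kernelV_of_nonpos Q (neg_nonpos.2 (le_of_lt ht)), modExp_conjTranspose,
      Matrix.mul_smul, neg_neg]
    congr 2
    push_cast
    ring
  have hi1 : ∀ i j, IntegrableOn (fun t => (modExp A lam t * toC Q) i j) (Set.Ioi 0) :=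
    integrable_mul_const_matrix _ (hA.integrableOn_modExp lam)
  have hic : ∀ i j, IntegrableOn (fun t => (modExp A lam t)ᴴ i j) (Set.Ioi 0) := fun i j =>
    (Complex.conjCLE.toContinuousLinearMap).integrable_comp (hA.integrableOn_modExp lam j i)
  have hi2 : ∀ i j, IntegrableOn (fun t => (toC Q * (modExp A lam t)ᴴ) i j) (Set.Ioi 0) :=
    integrable_const_mul_matrix _ hic
  have hp : ∀ i j, IntegrableOn (fun t => f t i j) (Set.Ioi 0) := fun i j =>
    (hi1 i j).congr_fun (fun t ht => by simp only [hpos t ht]) measurableSet_Ioi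
  have hn' : ∀ i j, IntegrableOn (fun t => f (-t) i j) (Set.Ioi 0) := fun i j =>
    (hi2 i j).congr_fun (fun t ht => by simp only [hneg t ht]) measurableSet_Ioi
  have hn : ∀ i j, IntegrableOn (fun t => f t i j) (Set.Iic 0) := fun i j => by
    rw [integrableOn_Iic_iff_integrableOn_Iio]
    refine ((Measure.measurePreserving_neg (volume : Measure ℝ)).integrableOn_comp_preimage
      (MeasurableEquiv.neg ℝ).measurableEmbedding).1 ?_
    rw [Set.neg_preimage, Set.neg_Iio, neg_zero]
    exact hn' i j
  refine ⟨fun i j => ?_, ?_⟩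
  · rw [← integrableOn_univ, ← Set.Iic_union_Ioi (a := (0 : ℝ))]
    exact (hn i j).union (hp i j)
  · ext i j
    have e1 : ∫ t in Set.Ioi 0, f t i j = (Gtf A lam * toC Q) i j := by
      rw [← hA.entryIntegral_modExp, ← entryIntegral_mul_const _ (hA.integrableOn_modExp lam)]
      exact setIntegral_congr_fun measurableSet_Ioi fun t ht => by simp only [hpos t ht]
    have e2 : ∫ t in Set.Iic 0, f t i j = (toC Q * (Gtf A lam)ᴴ) i j := by
      have h1 := integral_comp_neg_Ioi 0 fun t => f t i j
      rw [neg_zero] at h1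
      rw [← h1, ← hA.entryIntegral_modExp, ← entryIntegral_conjTranspose,
        ← entryIntegral_const_mul _ hic]
      exact setIntegral_congr_fun measurableSet_Ioi fun t ht => by simp only [hneg t ht]
    rw [Matrix.add_apply, ← e1, ← e2, add_comm]
    exact (intervalIntegral.integral_Iic_add_Ioi (hn i j) (hp i j)).symm

theorem IsHurwitz.fourierMat_kernelV (hA : IsHurwitz A) (Q : Matrix x x ℝ) (C : Matrix r x ℝ)
    (lam : ℝ) : fourierMat (fun t => C * kernelV Q A t * Cᵀ) lam =
      toC C * (Gtf A lam * toC Q + toC Q * (Gtf A lam)ᴴ) * (toC C)ᵀ := by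
  obtain ⟨hi, h⟩ := hA.fourier_kernelV Q lam
  rw [← h, ← entryIntegral_const_mul _ hi, ← entryIntegral_mul_const _
    (integrable_const_mul_matrix _ hi)]
  ext i j
  refine integral_congr_ae (ae_of_all _ fun t => ?_)
  have e : toC (C * kernelV Q A t * Cᵀ) = toC C * toC (kernelV Q A t) * (toC C)ᵀ := by
    rw [toC_mul, toC_mul, toC_transpose]
  have e2 : ((C * kernelV Q A t * Cᵀ) i j : ℂ) = toC (C * kernelV Q A t * Cᵀ) i j := rfl
  simp only []
  rw [e2, e, Matrix.mul_smul, Matrix.smul_mul, Matrix.smul_apply, smul_eq_mul]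

/-- With K = iλ - A, the Lyapunov equation reads KQ + QK* = BRBᵀ, since the terms in iλ cancel;
multiplying by G = K⁻¹ on the left and G* on the right gives the claim. -/
theorem IsHurwitz.Gtf_mul_add_mul (hA : IsHurwitz A) {Q : Matrix x x ℝ} {B : Matrix x w ℝ}
    {R : Matrix w w ℝ}
    (h : toC A * toC Q + toC Q * (toC A)ᵀ + toC B * toC R * (toC B)ᵀ = 0) (lam : ℝ) :
    Gtf A lam * toC Q + toC Q * (Gtf A lam)ᴴ =
      Gtf A lam * (toC B * toC R * (toC B)ᵀ) * (Gtf A lam)ᴴ := by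
  have h1 := hA.Gtf_mul lam
  have h2 := congrArg conjTranspose h1
  rw [conjTranspose_mul, conjTranspose_one] at h2
  set K := (Complex.I * lam) • (1 : Matrix x x ℂ) - toC A with hK
  have hKs : Kᴴ = -(Complex.I * lam) • (1 : Matrix x x ℂ) - (toC A)ᵀ := by
    rw [hK, conjTranspose_sub, conjTranspose_smul, conjTranspose_one, toC_conjTranspose]
    simp
  have e : toC B * toC R * (toC B)ᵀ = toC Q * Kᴴ + K * toC Q := by
    rw [eq_neg_of_add_eq_zero_right h, hKs, hK, Matrix.mul_sub, Matrix.sub_mul, Matrix.mul_smul,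
      Matrix.smul_mul, Matrix.mul_one, Matrix.one_mul, neg_smul]
    abel
  rw [e, Matrix.mul_add, Matrix.add_mul, ← Matrix.mul_assoc, ← Matrix.mul_assoc, h1,
    Matrix.one_mul, Matrix.mul_assoc (Gtf A lam * toC Q), h2, Matrix.mul_one]

/-- Stated for general Q and R to serve twice: the Gramian with R = I yields Φ = FF*, and the CCR
matrix with R = J yields Ψ = FJF*. -/
theorem IsHurwitz.fourierMat_eq (hA : IsHurwitz A) {Q : Matrix x x ℝ} {B : Matrix x w ℝ}
    {R : Matrix w w ℝ}
    (h : toC A * toC Q + toC Q * (toC A)ᵀ + toC B * toC R * (toC B)ᵀ = 0) (C : Matrix r x ℝ)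
    (lam : ℝ) : fourierMat (fun t => C * kernelV Q A t * Cᵀ) lam =
      Ftf A B C lam * toC R * (Ftf A B C lam)ᴴ := by
  rw [hA.fourierMat_kernelV, hA.Gtf_mul_add_mul h, Ftf]
  simp only [conjTranspose_mul, toC_conjTranspose, Matrix.mul_assoc]

theorem IsHurwitz.fourierMat_kernelLam (hA : IsHurwitz A) {Θ : Matrix x x ℝ} {B : Matrix x w ℝ}
    {J : Matrix w w ℝ} (h : A * Θ + Θ * Aᵀ + B * J * Bᵀ = 0) (C : Matrix r x ℝ) :
    fourierMat (kernelLam Θ A C) = PsiTf J A B C := by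
  funext lam
  refine hA.fourierMat_eq ?_ C lam
  simp only [← toC_transpose, ← toC_mul, ← toC_add, h]
  ext i j
  simp [toC]

/-- The Lyapunov equation for the controllability Gramian. -/
theorem IsHurwitz.lyapunov (hA : IsHurwitz A) (B : Matrix x w ℝ) :
    toC A * toC (gramian A B) + toC (gramian A B) * (toC A)ᵀ +
      toC B * toC (1 : Matrix w w ℝ) * (toC B)ᵀ = 0 := by
  set Q := toC B * (toC B)ᵀ with hQ
  set X : ℝ → Matrix x x ℂ := fun t =>
    NormedSpace.exp (t • toC A) * Q * NormedSpace.exp (t • (toC A)ᵀ) with hX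
  have hXd : ∀ i j, ExpDecay fun t => X t i j := fun i j =>
    expDecay_matrix_mul (expDecay_matrix_mul_const hA.expDecay Q) hA.expDecay_transpose i j
  have hXc : Continuous X :=
    ((continuous_exp_smul _).matrix_mul continuous_const).matrix_mul (continuous_exp_smul _)
  have hXi : ∀ i j, IntegrableOn (fun t => X t i j) (Set.Ioi 0) := fun i j =>
    (hXd i j).integrableOn (hXc.matrix_elem i j)
  have hg : toC (gramian A B) = entryIntegral (volume.restrict (Set.Ioi 0)) X := by
    ext i j
    rw [toC, Matrix.map_apply, gramian, Matrix.of_apply, ← integral_complex_ofReal]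
    refine integral_congr_ae (ae_of_all _ fun t => ?_)
    have e : toC (NormedSpace.exp (t • A) * B * Bᵀ * NormedSpace.exp (t • Aᵀ)) = X t := by
      simp only [hX, hQ, toC_mul, toC_exp_smul, toC_transpose, Matrix.mul_assoc]
    exact congrFun (congrFun e i) j
  have hd : ∀ i j t, HasDerivAt (fun s => X s i j)
      ((toC A * X t + X t * (toC A)ᵀ) i j) t := by
    intro i j t
    have h1 := hasDerivAt_matrix_mul (hasDerivAt_mul_const_matrix Q (hasDerivAt_exp_smul (toC A) t))
      (hasDerivAt_exp_smul (toC A)ᵀ t)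
    have h2 : toC A * NormedSpace.exp (t • toC A) * Q * NormedSpace.exp (t • (toC A)ᵀ) +
        NormedSpace.exp (t • toC A) * Q * ((toC A)ᵀ * NormedSpace.exp (t • (toC A)ᵀ)) =
        toC A * X t + X t * (toC A)ᵀ := by
      rw [exp_smul_mul_comm (toC A)ᵀ]
      simp only [hX, Matrix.mul_assoc]
    rw [h2] at h1
    exact hasDerivAt_matrix_iff.1 h1 i j
  have hi1 := fun i j => integrable_const_mul_matrix (toC A) hXi i j
  have hi2 := fun i j => integrable_mul_const_matrix (toC A)ᵀ hXi i j
  -- The integrand X(t) of the Gramian solves X' = AX + XAᵀ with X(0) = BBᵀ and decays at infinity;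
  -- integrating the equation over the half-line gives the Lyapunov equation.
  have h := entryIntegral_Ioi_of_hasDerivAt hd (fun i j => (hi1 i j).add (hi2 i j))
    fun i j => (hXd i j).tendsto
  rw [entryIntegral_add hi1 hi2, entryIntegral_const_mul _ hXi, entryIntegral_mul_const _ hXi,
    ← hg] at h
  rw [h, toC_one, Matrix.mul_one]
  simp [hX, hQ]

theorem IsHurwitz.fourierMat_kernelP (hA : IsHurwitz A) (B : Matrix x w ℝ) (C : Matrix r x ℝ) :
    fourierMat (kernelP A B C) = PhiTf A B C := by
  funext lam
  have h := hA.fourierMat_eq (hA.lyapunov B) C lam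
  rw [toC_one, Matrix.mul_one] at h
  rw [PhiTf, ← h]
  congr 1
  funext t
  rw [kernelP, kernelV]
  split_ifs <;> simp only [Matrix.mul_assoc]

end StateSpaceFourier

/-! ### Calculus of the Frobenius pairing -/

section FrobeniusPairing

variable {l m n : Type*} [Fintype l] [Fintype m] [Fintype n]

theorem frob_add_left (g h X : Matrix m n ℝ) : frob (g + h) X = frob g X + frob h X := by
  simp [frob_apply, Matrix.add_mul]

theorem frob_smul_left (s : ℝ) (g X : Matrix m n ℝ) : frob (s • g) X = s * frob g X := by
  simp [frob_apply]

theorem frob_const_mul (g : Matrix l n ℝ) (A : Matrix l m ℝ) (X : Matrix m n ℝ) :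
    frob g (A * X) = frob (Aᵀ * g) X := by
  rw [frob_apply, frob_apply, transpose_mul, transpose_transpose, Matrix.mul_assoc]

theorem frob_mul_const (g : Matrix l n ℝ) (X : Matrix l m ℝ) (A : Matrix m n ℝ) :
    frob g (X * A) = frob (g * Aᵀ) X := by
  rw [frob_apply, frob_apply, transpose_mul, transpose_transpose, ← Matrix.mul_assoc,
    trace_mul_comm, Matrix.mul_assoc]

theorem frob_transpose (g : Matrix m n ℝ) (X : Matrix n m ℝ) : frob g Xᵀ = frob gᵀ X := by
  rw [frob_eq_sum, frob_eq_sum, Finset.sum_comm]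
  rfl

theorem frob_fromBlocks {l' m' : Type*} [Fintype l'] [Fintype m']
    (g : Matrix (l ⊕ m) (l' ⊕ m') ℝ) (A : Matrix l l' ℝ) (B : Matrix l m' ℝ) (C : Matrix m l' ℝ)
    (D : Matrix m m' ℝ) : frob g (fromBlocks A B C D) = frob g.toBlocks₁₁ A + frob g.toBlocks₁₂ B +
      frob g.toBlocks₂₁ C + frob g.toBlocks₂₂ D := by
  simp only [frob_eq_sum, Fintype.sum_sum_type, fromBlocks_apply₁₁, fromBlocks_apply₁₂,
    fromBlocks_apply₂₁, fromBlocks_apply₂₂, Finset.sum_add_distrib, toBlocks₁₁, toBlocks₁₂,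
    toBlocks₂₁, toBlocks₂₂, Matrix.of_apply]
  ring

theorem frob_fromCols {m' : Type*} [Fintype m'] (g : Matrix l (m ⊕ m') ℝ) (A : Matrix l m ℝ)
    (B : Matrix l m' ℝ) : frob g (fromCols A B) = frob g.toCols₁ A + frob g.toCols₂ B := by
  simp only [frob_eq_sum, Fintype.sum_sum_type, Finset.sum_add_distrib, fromCols_apply_inl,
    fromCols_apply_inr, toCols₁_apply, toCols₂_apply]

theorem eq_zero_of_frob_self {g : Matrix m n ℝ} (h : frob g g = 0) : g = 0 := by
  rw [frob_eq_sum] at h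
  ext i j
  have h1 := (Finset.sum_eq_zero_iff_of_nonneg fun i _ =>
    Finset.sum_nonneg fun j _ => mul_self_nonneg (g i j)).1 h i (Finset.mem_univ i)
  have h2 := (Finset.sum_eq_zero_iff_of_nonneg fun j _ => mul_self_nonneg (g i j)).1 h1 j
    (Finset.mem_univ j)
  exact mul_self_eq_zero.1 h2

end FrobeniusPairing

/-! ### Commutation relations and the affine structure of the closed loop -/

theorem Jmat_transpose (k : ℕ) : (Jmat k)ᵀ = -Jmat k := by
  rw [Jmat, ← kroneckerMap_transpose, transpose_one]
  ext ⟨a, i⟩ ⟨b, j⟩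
  fin_cases i <;> fin_cases j <;> simp [kroneckerMap_apply]

theorem Jmat_mul_self (k : ℕ) : Jmat k * Jmat k = -1 := by
  rw [Jmat, ← mul_kronecker_mul, Matrix.one_mul]
  ext ⟨a, i⟩ ⟨b, j⟩
  fin_cases i <;> fin_cases j <;>
    simp [kroneckerMap_apply, Matrix.one_apply, Prod.ext_iff]

theorem transpose_congr_antisymm {m n : Type*} [Fintype m] {J : Matrix m m ℝ} (hJ : Jᵀ = -J)
    (M : Matrix m n ℝ) : (Mᵀ * J * M)ᵀ = -(Mᵀ * J * M) := by
  rw [transpose_mul, transpose_mul, transpose_transpose, hJ, Matrix.neg_mul, Matrix.mul_neg,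
    Matrix.mul_assoc]

/-- A Hamiltonian matrix and its coupling terms in the commutator balance. -/
theorem commutator_balance {n : Type*} [Fintype n] {Θ R P : Matrix n n ℝ} (hΘ : Θᵀ = -Θ)
    (hR : Rᵀ = R) (hP : Pᵀ = -P) :
    (2 : ℝ) • (Θ * (R + P)) * Θ + Θ * ((2 : ℝ) • (Θ * (R + P)))ᵀ = (4 : ℝ) • (Θ * P * Θ) := by
  rw [transpose_smul, transpose_mul, transpose_add, hΘ, hR, hP]
  simp only [Matrix.smul_mul, Matrix.mul_smul, Matrix.mul_add, Matrix.add_mul, Matrix.neg_mul,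
    Matrix.mul_neg, Matrix.mul_assoc, smul_add, smul_neg]
  module

namespace Setup

variable {n ν k₁ k₂ q₁ q₂ r : ℕ} (S : Setup n ν k₁ k₂ q₁ q₂ r)

theorem J_transpose (k₁ k₂ : ℕ) : (J k₁ k₂)ᵀ = -J k₁ k₂ := by
  rw [J, fromBlocks_transpose, fromBlocks_neg, Jmat_transpose, Jmat_transpose]
  simp

theorem J_mul_self (k₁ k₂ : ℕ) : J k₁ k₂ * J k₁ k₂ = -1 := by
  rw [J, fromBlocks_multiply, Jmat_mul_self, Jmat_mul_self, ← fromBlocks_one, fromBlocks_neg]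
  simp

theorem Jt₁_transpose : (S.Jt₁)ᵀ = -S.Jt₁ := by
  simpa [Jt₁] using transpose_congr_antisymm (Jmat_transpose k₁) S.Dᵀ

theorem Jt₂_transpose : (S.Jt₂)ᵀ = -S.Jt₂ := by
  simpa [Jt₂] using transpose_congr_antisymm (Jmat_transpose k₂) S.dᵀ

/-- Preservation of the canonical commutation relations by the closed-loop system. -/
theorem physical_realizability (u : Controller ν k₂ q₁) :
    S.𝒜 u * S.Θ + S.Θ * (S.𝒜 u)ᵀ + S.ℬ u * J k₁ k₂ * (S.ℬ u)ᵀ = 0 := by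
  have h1 := commutator_balance S.Θ₁_antisymm S.R₁_symm
    (P := S.M₁ᵀ * Jmat k₁ * S.M₁ + S.L₁ᵀ * S.Jt₂ * S.L₁) (by
      rw [transpose_add, transpose_congr_antisymm (Jmat_transpose k₁),
        transpose_congr_antisymm S.Jt₂_transpose, neg_add])
  have h2 := commutator_balance S.Θ₂_antisymm u.1.2
    (P := u.2.1ᵀ * Jmat k₂ * u.2.1 + u.2.2ᵀ * S.Jt₁ * u.2.2) (by
      rw [transpose_add, transpose_congr_antisymm (Jmat_transpose k₂),
        transpose_congr_antisymm S.Jt₁_transpose, neg_add])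
  rw [← add_assoc] at h1 h2
  have hA : S.A * S.Θ₁ + S.Θ₁ * S.Aᵀ = _ := h1
  have ha : S.a u * S.Θ₂ + S.Θ₂ * (S.a u)ᵀ = _ := h2
  rw [𝒜, clA, ℬ, clB, Θ, J]
  simp only [fromBlocks_transpose, fromBlocks_multiply, fromBlocks_add, Matrix.mul_zero,
    Matrix.zero_mul, add_zero, zero_add]
  rw [← fromBlocks_zero, hA, ha]
  -- In the diagonal blocks the energy matrices have already cancelled, and the coupling terms 4ΘPΘ
  -- are compensated by the diffusion terms; in the off-diagonal blocks the interconnection terms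
  -- cancel against the shared noise.
  simp only [B, b, E, e, C, c, Jt₁, Jt₂, transpose_mul, transpose_smul, transpose_transpose,
    Jmat_transpose, S.Θ₁_antisymm, S.Θ₂_antisymm, Matrix.smul_mul, Matrix.mul_smul,
    Matrix.neg_mul, Matrix.mul_neg, Matrix.mul_add, Matrix.add_mul, Matrix.mul_assoc, smul_neg,
    smul_add]
  congr 1 <;> module

/-- The block matrix `[𝒜, ℬ; 𝒞, 0]` as a function of `a`, `b`, `c`, `e`. -/
def sysMat (a : Matrix (Fin ν) (Fin ν) ℝ) (b : Matrix (Fin ν) (Pair k₂) ℝ)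
    (c : Matrix (Pair q₂) (Fin ν) ℝ) (e : Matrix (Fin ν) (Pair q₁) ℝ) :
    Matrix ((Fin n ⊕ Fin ν) ⊕ Fin r) ((Fin n ⊕ Fin ν) ⊕ (Pair k₁ ⊕ Pair k₂)) ℝ :=
  fromBlocks (S.clA a c e) (S.clB b e) (S.clC c) 0

/-- The reason for Γ₁ and Γ₂: they carry the linear part of the dependence on the controller
matrices, so their transposes carry gradients back. -/
theorem sysMat_eq (a : Matrix (Fin ν) (Fin ν) ℝ) (b : Matrix (Fin ν) (Pair k₂) ℝ)
    (c : Matrix (Pair q₂) (Fin ν) ℝ) (e : Matrix (Fin ν) (Pair q₁) ℝ) :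
    S.sysMat a b c e = S.sysMat 0 0 0 0 +
      S.Γ₁ * fromBlocks a (fromCols b e) c 0 * S.Γ₂ := by
  simp only [Γ₁, Γ₂, Matrix.mul_assoc, fromBlocks_mul_fromRows, fromCols_mul_fromRows, fromRows_mul,
    mul_fromCols, Matrix.mul_zero, Matrix.zero_mul, Matrix.mul_one, Matrix.one_mul, add_zero,
    zero_add, sysMat, clA, clB, clC]
  ext ((i | i) | i) ((j | j) | (j | j)) <;> simp

end Setup

/-! ### Chain rule, Frobenius gradients and stationarity -/

section Gradients

open scoped Matrix.Norms.Frobenius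

theorem differentiableAt_matrix_transpose {E : Type*} [NormedAddCommGroup E] [NormedSpace ℝ E]
    {m n : Type*} [Fintype m] [Fintype n] {A : E → Matrix m n ℝ} {x : E}
    (hA : DifferentiableAt ℝ A x) : DifferentiableAt ℝ (fun s => (A s)ᵀ) x := by
  rw [differentiableAt_matrix_iff] at *
  intro i j
  exact hA j i

theorem differentiableAt_fromBlocks {E : Type*} [NormedAddCommGroup E] [NormedSpace ℝ E]
    {l m n o : Type*} [Fintype l] [Fintype m] [Fintype n] [Fintype o] {A : E → Matrix n l ℝ}
    {B : E → Matrix n m ℝ} {C : E → Matrix o l ℝ} {D : E → Matrix o m ℝ} {x : E}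
    (hA : DifferentiableAt ℝ A x) (hB : DifferentiableAt ℝ B x) (hC : DifferentiableAt ℝ C x)
    (hD : DifferentiableAt ℝ D x) :
    DifferentiableAt ℝ (fun s => fromBlocks (A s) (B s) (C s) (D s)) x := by
  rw [differentiableAt_matrix_iff] at *
  rintro (i | i) (j | j)
  exacts [hA i j, hB i j, hC i j, hD i j]

theorem differentiableAt_fromCols {E : Type*} [NormedAddCommGroup E] [NormedSpace ℝ E]
    {l m n : Type*} [Fintype l] [Fintype m] [Fintype n] {A : E → Matrix n l ℝ}
    {B : E → Matrix n m ℝ} {x : E} (hA : DifferentiableAt ℝ A x) (hB : DifferentiableAt ℝ B x) :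
    DifferentiableAt ℝ (fun s => fromCols (A s) (B s)) x := by
  rw [differentiableAt_matrix_iff] at *
  rintro i (j | j)
  exacts [hA i j, hB i j]

/-- The derivative of a composite function along a line on which the inner function is
quadratic. -/
theorem exists_hasFDerivAt_comp {E F : Type*} [NormedAddCommGroup E] [NormedSpace ℝ E]
    [NormedAddCommGroup F] [NormedSpace ℝ F] {f : F → ℝ} {D : F →L[ℝ] ℝ} {h : E → F} {x : E}
    (hf : HasFDerivAt f D (h x)) (hh : DifferentiableAt ℝ h x) :
    ∃ L : E →L[ℝ] ℝ, HasFDerivAt (fun y => f (h y)) L x ∧ ∀ (δ : E) (v w : F),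
      (∀ s : ℝ, h (x + s • δ) = h x + s • v + s ^ 2 • w) → L δ = D v := by
  refine ⟨D.comp (fderiv ℝ h x), hf.comp x hh.hasFDerivAt, fun δ v w hline => ?_⟩
  have h1 := hasDerivAt_add_smul x δ 0
  have h2 : HasFDerivAt h (fderiv ℝ h x) ((fun s : ℝ => x + s • δ) 0) := by
    simpa using hh.hasFDerivAt
  have h3 : HasDerivAt (fun s : ℝ => h (x + s • δ)) (fderiv ℝ h x δ) 0 :=
    HasFDerivAt.comp_hasDerivAt (l := h) (f := fun s : ℝ => x + s • δ) 0 h2 h1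
  simp only [hline] at h3
  have h4 : HasDerivAt (fun s : ℝ => h x + s • v + s ^ 2 • w) v 0 := by
    refine ((hasDerivAt_add_smul (h x) v 0).add
      (((hasDerivAt_id (0 : ℝ)).pow 2).smul_const w)).congr_deriv ?_
    simp
  rw [ContinuousLinearMap.comp_apply, h3.unique h4]

variable {m n : Type*} [Fintype m] [Fintype n]

theorem HasFrobGradAt.exists_hasFDerivAt_comp {E : Type*} [NormedAddCommGroup E]
    [NormedSpace ℝ E] {f : Matrix m n ℝ → ℝ} {g X : Matrix m n ℝ} {h : E → Matrix m n ℝ} {x : E}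
    (hf : HasFrobGradAt f g X) (hx : h x = X) (hh : DifferentiableAt ℝ h x) :
    ∃ L : E →L[ℝ] ℝ, HasFDerivAt (fun y => f (h y)) L x ∧ ∀ (δ : E) (v w : Matrix m n ℝ),
      (∀ s : ℝ, h (x + s • δ) = h x + s • v + s ^ 2 • w) → L δ = frob g v := by
  subst hx
  exact CoherentQEF.exists_hasFDerivAt_comp hf hh

theorem hasFrobGradAt_of_hasFDerivAt {f : Matrix m n ℝ → ℝ} {g X : Matrix m n ℝ}
    {L : Matrix m n ℝ →L[ℝ] ℝ} (h : HasFDerivAt f L X) (hL : ∀ δ, L δ = frob g δ) :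
    HasFrobGradAt f g X := by
  have e : L = frob g := ContinuousLinearMap.ext hL
  rw [e] at h
  exact h

theorem hasSymGradAt_of_hasFDerivAt {f : symMat n → ℝ} {g : Matrix n n ℝ} {X : symMat n}
    (hg : g ∈ symMat n) {L : symMat n →L[ℝ] ℝ} (h : HasFDerivAt f L X)
    (hL : ∀ δ : symMat n, L δ = frob g δ) : HasSymGradAt f g X := by
  have e : L = (frob g).comp (symMat n).subtypeL := ContinuousLinearMap.ext hL
  rw [e] at h
  exact ⟨hg, h⟩

theorem HasFrobGradAt.eq_zero_of_isLocalMin {f : Matrix m n ℝ → ℝ} {g X : Matrix m n ℝ}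
    (h : HasFrobGradAt f g X) (hmin : IsLocalMin f X) : g = 0 := by
  have h1 : frob g = 0 := hmin.hasFDerivAt_eq_zero h
  exact eq_zero_of_frob_self (by rw [h1]; rfl)

theorem HasSymGradAt.eq_zero_of_isLocalMin {f : symMat n → ℝ} {g : Matrix n n ℝ} {X : symMat n}
    (h : HasSymGradAt f g X) (hmin : IsLocalMin f X) : g = 0 := by
  have h1 : (frob g).comp (symMat n).subtypeL = 0 := hmin.hasFDerivAt_eq_zero h.2
  have h2 := DFunLike.congr_fun h1 ⟨g, h.1⟩
  exact eq_zero_of_frob_self h2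

theorem symPart_mem (A : Matrix n n ℝ) : symPart A ∈ symMat n := by
  change (symPart A)ᵀ = symPart A
  rw [symPart, transpose_smul, transpose_add, transpose_transpose, add_comm]

/-- Antisymmetric matrices are orthogonal to symmetric ones; hence the symmetrizer in the gradient
with respect to the energy matrix. -/
theorem frob_symPart (A : Matrix n n ℝ) (X : symMat n) : frob (symPart A) X = frob A X := by
  have h : frob Aᵀ (X : Matrix n n ℝ) = frob A X := by
    have hX : (X : Matrix n n ℝ)ᵀ = X := X.2
    rw [← frob_transpose, hX]
  rw [symPart, frob_smul_left, frob_add_left, h]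
  ring

/-- The gradient of the quadratic coupling term of the Hamiltonian matrix. -/
theorem frob_coupling {J : Matrix m m ℝ} (hJ : Jᵀ = -J) {Θ : Matrix n n ℝ} (hΘ : Θᵀ = -Θ)
    (g : Matrix n n ℝ) (M X : Matrix m n ℝ) :
    frob g ((2 : ℝ) • (Θ * (Xᵀ * J * M + Mᵀ * J * X))) =
      frob ((4 : ℝ) • (J * M * asymPart (Θ * g))) X := by
  have h1 : frob g (Θ * (Mᵀ * J * X)) = frob (J * M * (Θ * g)) X := by
    rw [frob_const_mul, Matrix.mul_assoc, frob_const_mul, frob_const_mul, hΘ, hJ,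
      transpose_transpose]
    simp only [Matrix.neg_mul, Matrix.mul_neg, neg_neg, Matrix.mul_assoc]
  have h2 : frob g (Θ * (Xᵀ * J * M)) = frob (-(J * M * (Θ * g)ᵀ)) X := by
    rw [frob_const_mul, Matrix.mul_assoc, frob_mul_const, frob_transpose, hΘ]
    simp only [transpose_mul, transpose_transpose, Matrix.neg_mul, Matrix.mul_neg, transpose_neg,
      Matrix.mul_assoc, hΘ]
  -- The two variations of the quadratic term contribute Θg and -(Θg)ᵀ, which add up to twice the
  -- antisymmetric part.
  have h3 : (4 : ℝ) • (J * M * asymPart (Θ * g)) =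
      (2 : ℝ) • (-(J * M * (Θ * g)ᵀ) + J * M * (Θ * g)) := by
    rw [asymPart, Matrix.mul_smul, Matrix.mul_sub]
    module
  rw [map_smul, Matrix.mul_add, map_add, h1, h2, h3, frob_smul_left, frob_add_left, smul_eq_mul]

end Gradients

section RateGradient

open scoped Matrix.Norms.Frobenius

variable {x w r : Type*} [Fintype x] [DecidableEq x] [Fintype w] [DecidableEq w] [Fintype r]
  [DecidableEq r]

/-- The QEF rate as a function of the block matrix `[𝒜, ℬ; 𝒞, *]`. -/
def rateMat (J : Matrix w w ℝ) (θ : ℝ) (p : Matrix (x ⊕ r) (x ⊕ w) ℝ) : ℝ :=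
  rateTf J θ p.toBlocks₁₁ p.toBlocks₁₂ p.toBlocks₂₁

theorem hasFrobGradAt_rateMat {J : Matrix w w ℝ} {θ c : ℝ} (hJ : Jᵀ = -J) (hJ2 : J * J = -1)
    (hc0 : 0 < c) (hc : c ≤ 1) {p : Matrix (x ⊕ r) (x ⊕ w) ℝ} (hp : StableBelow J θ c p) :
    HasFrobGradAt (rateMat J θ)
      (θ • core J θ p.toBlocks₁₁ p.toBlocks₁₂ p.toBlocks₂₁) p :=
  hasFDerivAt_rateTf hJ hJ2 hc0 hc hp

end RateGradient

/-! ### Partial derivatives with respect to a, b, c, e -/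

namespace Setup

open scoped Matrix.Norms.Frobenius

variable {n ν k₁ k₂ q₁ q₂ r : ℕ} (S : Setup n ν k₁ k₂ q₁ q₂ r)

/-- The block matrix `[a, b, e; c, 0, 0]`. -/
def controllerMat (a : Matrix (Fin ν) (Fin ν) ℝ) (b : Matrix (Fin ν) (Pair k₂) ℝ)
    (c : Matrix (Pair q₂) (Fin ν) ℝ) (e : Matrix (Fin ν) (Pair q₁) ℝ) :
    Matrix (Fin ν ⊕ Pair q₂) (Fin ν ⊕ (Pair k₂ ⊕ Pair q₁)) ℝ :=
  fromBlocks a (fromCols b e) c 0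

/-- Moving Γ₁ and Γ₂ to the other side of the pairing produces their transposes; the starred blocks
meet the zero blocks of the controller matrix. -/
theorem frob_derMat (θ : ℝ) (u : Controller ν k₂ q₁) (a : Matrix (Fin ν) (Fin ν) ℝ)
    (b : Matrix (Fin ν) (Pair k₂) ℝ) (c : Matrix (Pair q₂) (Fin ν) ℝ)
    (e : Matrix (Fin ν) (Pair q₁) ℝ) :
    frob (θ • core (J k₁ k₂) θ (S.𝒜 u) (S.ℬ u) (S.𝒞 u)) (S.Γ₁ * controllerMat a b c e * S.Γ₂) =
      frob (S.da θ u) a + frob (S.db θ u) b + frob (S.dc θ u) c + frob (S.de θ u) e := by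
  have h : (S.Γ₁)ᵀ * (θ • core (J k₁ k₂) θ (S.𝒜 u) (S.ℬ u) (S.𝒞 u) * (S.Γ₂)ᵀ) = S.derMat θ u := by
    rw [derMat, Matrix.smul_mul, Matrix.mul_smul, Matrix.mul_assoc]
  rw [frob_mul_const, frob_const_mul, h, controllerMat, frob_fromBlocks, frob_fromCols, map_zero,
    da, db, dc, de]
  ring

/-- The quadratic term is allowed in a alone, because a is quadratic in the coupling matrices while
b, c, e are linear in them. -/
theorem sysMat_add (a₀ a₁ a₂ : Matrix (Fin ν) (Fin ν) ℝ) (b₀ b₁ : Matrix (Fin ν) (Pair k₂) ℝ)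
    (c₀ c₁ : Matrix (Pair q₂) (Fin ν) ℝ) (e₀ e₁ : Matrix (Fin ν) (Pair q₁) ℝ) (s : ℝ) :
    S.sysMat (a₀ + s • a₁ + s ^ 2 • a₂) (b₀ + s • b₁) (c₀ + s • c₁) (e₀ + s • e₁) =
      S.sysMat a₀ b₀ c₀ e₀ + s • (S.Γ₁ * controllerMat a₁ b₁ c₁ e₁ * S.Γ₂) +
        s ^ 2 • (S.Γ₁ * controllerMat (k₂ := k₂) (q₁ := q₁) (q₂ := q₂) a₂ 0 0 0 * S.Γ₂) := by
  have h : controllerMat (a₀ + s • a₁ + s ^ 2 • a₂) (b₀ + s • b₁) (c₀ + s • c₁) (e₀ + s • e₁) =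
      controllerMat a₀ b₀ c₀ e₀ + s • controllerMat a₁ b₁ c₁ e₁ +
        s ^ 2 • controllerMat (k₂ := k₂) (q₁ := q₁) (q₂ := q₂) a₂ 0 0 0 := by
    ext (i | i) (j | (j | j)) <;> simp [controllerMat]
  rw [sysMat_eq, ← controllerMat, h, S.sysMat_eq a₀, ← controllerMat]
  simp only [Matrix.mul_add, Matrix.add_mul, Matrix.mul_smul, Matrix.smul_mul, add_assoc]

theorem differentiableAt_sysMat {E : Type*} [NormedAddCommGroup E] [NormedSpace ℝ E]
    {a : E → Matrix (Fin ν) (Fin ν) ℝ} {b : E → Matrix (Fin ν) (Pair k₂) ℝ}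
    {c : E → Matrix (Pair q₂) (Fin ν) ℝ} {e : E → Matrix (Fin ν) (Pair q₁) ℝ} {x : E}
    (ha : DifferentiableAt ℝ a x) (hb : DifferentiableAt ℝ b x) (hc : DifferentiableAt ℝ c x)
    (he : DifferentiableAt ℝ e x) :
    DifferentiableAt ℝ (fun y => S.sysMat (a y) (b y) (c y) (e y)) x := by
  refine differentiableAt_fromBlocks
    (differentiableAt_fromBlocks (differentiableAt_const _)
      (differentiableAt_matrix_mul (differentiableAt_const _) hc)
      (differentiableAt_matrix_mul he (differentiableAt_const _)) ha)
    (differentiableAt_fromBlocks (differentiableAt_const _) (differentiableAt_const _)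
      (differentiableAt_matrix_mul he (differentiableAt_const _)) hb)
    (differentiableAt_fromCols (differentiableAt_const _)
      (differentiableAt_matrix_mul (differentiableAt_const _) hc)) (differentiableAt_const _)

/-- The matrix `[𝒜, ℬ; 𝒞, 0]` for a given controller. -/
def sys (u : Controller ν k₂ q₁) :
    Matrix ((Fin n ⊕ Fin ν) ⊕ Fin r) ((Fin n ⊕ Fin ν) ⊕ (Pair k₁ ⊕ Pair k₂)) ℝ :=
  S.sysMat (S.a u) (S.b u) (S.c u) (S.e u)

theorem sys_toBlocks₁₁ (u : Controller ν k₂ q₁) : (S.sys u).toBlocks₁₁ = S.𝒜 u := rfl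

theorem sys_toBlocks₁₂ (u : Controller ν k₂ q₁) : (S.sys u).toBlocks₁₂ = S.ℬ u := rfl

theorem sys_toBlocks₂₁ (u : Controller ν k₂ q₁) : (S.sys u).toBlocks₂₁ = S.𝒞 u := rfl

variable {θ κ : ℝ} {u : Controller ν k₂ q₁}

/-- The chain rule for the QEF rate and a parametrization of the controller matrices. -/
theorem exists_hasFDerivAt_UpsTf (hκ0 : 0 < κ) (hκ : κ ≤ 1)
    (hp : StableBelow (J k₁ k₂) θ κ (S.sys u)) {E : Type*} [NormedAddCommGroup E]
    [NormedSpace ℝ E] {a : E → Matrix (Fin ν) (Fin ν) ℝ} {b : E → Matrix (Fin ν) (Pair k₂) ℝ}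
    {c : E → Matrix (Pair q₂) (Fin ν) ℝ} {e : E → Matrix (Fin ν) (Pair q₁) ℝ} {x : E}
    (hax : a x = S.a u) (hbx : b x = S.b u) (hcx : c x = S.c u) (hex : e x = S.e u)
    (ha : DifferentiableAt ℝ a x) (hb : DifferentiableAt ℝ b x) (hc : DifferentiableAt ℝ c x)
    (he : DifferentiableAt ℝ e x) :
    ∃ L : E →L[ℝ] ℝ, HasFDerivAt (fun y => S.UpsTf θ (a y) (b y) (c y) (e y)) L x ∧
      ∀ δ a₁ a₂ b₁ c₁ e₁, (∀ s : ℝ, a (x + s • δ) = a x + s • a₁ + s ^ 2 • a₂) →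
        (∀ s : ℝ, b (x + s • δ) = b x + s • b₁) → (∀ s : ℝ, c (x + s • δ) = c x + s • c₁) →
        (∀ s : ℝ, e (x + s • δ) = e x + s • e₁) →
        L δ = frob (S.da θ u) a₁ + frob (S.db θ u) b₁ + frob (S.dc θ u) c₁ +
          frob (S.de θ u) e₁ := by
  have hx : S.sysMat (a x) (b x) (c x) (e x) = S.sys u := by rw [hax, hbx, hcx, hex, sys]
  have h1 : HasFrobGradAt (rateMat (J k₁ k₂) θ)
      (θ • core (J k₁ k₂) θ (S.𝒜 u) (S.ℬ u) (S.𝒞 u)) (S.sys u) := by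
    have := hasFrobGradAt_rateMat (J_transpose k₁ k₂) (J_mul_self k₁ k₂) hκ0 hκ hp
    rwa [sys_toBlocks₁₁, sys_toBlocks₁₂, sys_toBlocks₂₁] at this
  obtain ⟨L, hL, hLδ⟩ := h1.exists_hasFDerivAt_comp
    (h := fun y => S.sysMat (a y) (b y) (c y) (e y)) (x := x) hx (S.differentiableAt_sysMat ha hb hc he)
  refine ⟨L, hL, fun δ a₁ a₂ b₁ c₁ e₁ ha1 hb1 hc1 he1 => ?_⟩
  have h3 := hLδ δ (S.Γ₁ * controllerMat a₁ b₁ c₁ e₁ * S.Γ₂)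
    (S.Γ₁ * controllerMat (k₂ := k₂) (q₁ := q₁) (q₂ := q₂) a₂ 0 0 0 * S.Γ₂) fun s => by
      simp only [ha1, hb1, hc1, he1]
      exact S.sysMat_add _ _ a₂ _ _ _ _ _ _ s
  rw [h3]
  exact S.frob_derMat θ u a₁ b₁ c₁ e₁

theorem hasFrobGradAt_a (hκ0 : 0 < κ) (hκ : κ ≤ 1) (hp : StableBelow (J k₁ k₂) θ κ (S.sys u)) :
    HasFrobGradAt (fun a => S.UpsTf θ a (S.b u) (S.c u) (S.e u)) (S.da θ u) (S.a u) := by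
  obtain ⟨L, hL, h⟩ := S.exists_hasFDerivAt_UpsTf hκ0 hκ hp (a := fun y => y)
    (b := fun _ => S.b u) (c := fun _ => S.c u) (e := fun _ => S.e u) rfl rfl rfl rfl
    differentiableAt_id (differentiableAt_const _) (differentiableAt_const _)
    (differentiableAt_const _)
  refine hasFrobGradAt_of_hasFDerivAt hL fun δ => ?_
  refine (h δ δ 0 0 0 0 ?_ ?_ ?_ ?_).trans ?_ <;> simp

theorem hasFrobGradAt_b (hκ0 : 0 < κ) (hκ : κ ≤ 1) (hp : StableBelow (J k₁ k₂) θ κ (S.sys u)) :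
    HasFrobGradAt (fun b => S.UpsTf θ (S.a u) b (S.c u) (S.e u)) (S.db θ u) (S.b u) := by
  obtain ⟨L, hL, h⟩ := S.exists_hasFDerivAt_UpsTf hκ0 hκ hp (a := fun _ => S.a u)
    (b := fun y => y) (c := fun _ => S.c u) (e := fun _ => S.e u) rfl rfl rfl rfl
    (differentiableAt_const _) differentiableAt_id (differentiableAt_const _)
    (differentiableAt_const _)
  refine hasFrobGradAt_of_hasFDerivAt hL fun δ => ?_
  refine (h δ 0 0 δ 0 0 ?_ ?_ ?_ ?_).trans ?_ <;> simp

theorem hasFrobGradAt_c (hκ0 : 0 < κ) (hκ : κ ≤ 1) (hp : StableBelow (J k₁ k₂) θ κ (S.sys u)) :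
    HasFrobGradAt (fun c => S.UpsTf θ (S.a u) (S.b u) c (S.e u)) (S.dc θ u) (S.c u) := by
  obtain ⟨L, hL, h⟩ := S.exists_hasFDerivAt_UpsTf hκ0 hκ hp (a := fun _ => S.a u)
    (b := fun _ => S.b u) (c := fun y => y) (e := fun _ => S.e u) rfl rfl rfl rfl
    (differentiableAt_const _) (differentiableAt_const _) differentiableAt_id
    (differentiableAt_const _)
  refine hasFrobGradAt_of_hasFDerivAt hL fun δ => ?_
  refine (h δ 0 0 0 δ 0 ?_ ?_ ?_ ?_).trans ?_ <;> simp

theorem hasFrobGradAt_e (hκ0 : 0 < κ) (hκ : κ ≤ 1) (hp : StableBelow (J k₁ k₂) θ κ (S.sys u)) :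
    HasFrobGradAt (fun e => S.UpsTf θ (S.a u) (S.b u) (S.c u) e) (S.de θ u) (S.e u) := by
  obtain ⟨L, hL, h⟩ := S.exists_hasFDerivAt_UpsTf hκ0 hκ hp (a := fun _ => S.a u)
    (b := fun _ => S.b u) (c := fun _ => S.c u) (e := fun y => y) rfl rfl rfl rfl
    (differentiableAt_const _) (differentiableAt_const _) (differentiableAt_const _)
    differentiableAt_id
  refine hasFrobGradAt_of_hasFDerivAt hL fun δ => ?_
  refine (h δ 0 0 0 0 δ ?_ ?_ ?_ ?_).trans ?_ <;> simp

end Setup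

/-! ### Gradients in the energy and coupling matrices, and optimality -/

namespace Setup

open scoped Matrix.Norms.Frobenius

variable {n ν k₁ k₂ q₁ q₂ r : ℕ} (S : Setup n ν k₁ k₂ q₁ q₂ r) {θ κ : ℝ}
  {u : Controller ν k₂ q₁}

theorem Phi_eq (hu : IsHurwitz (S.𝒜 u)) : S.Phi u = PhiTf (S.𝒜 u) (S.ℬ u) (S.𝒞 u) :=
  hu.fourierMat_kernelP _ _

theorem Psi_eq (hu : IsHurwitz (S.𝒜 u)) :
    S.Psi u = PsiTf (J k₁ k₂) (S.𝒜 u) (S.ℬ u) (S.𝒞 u) :=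
  hu.fourierMat_kernelLam (S.physical_realizability u) _

theorem Ups_eq (hu : IsHurwitz (S.𝒜 u)) :
    S.Ups θ u = S.UpsTf θ (S.a u) (S.b u) (S.c u) (S.e u) := by
  rw [Ups, S.Phi_eq hu, S.Psi_eq hu]
  rfl

theorem Feasible.exists_stableBelow {S : Setup n ν k₁ k₂ q₁ q₂ r} (hθ : 0 < θ)
    (h : S.Feasible θ u) : ∃ κ, 0 < κ ∧ κ < 1 ∧ StableBelow (J k₁ k₂) θ κ (S.sys u) := by
  have h2 := h.2
  rw [S.Phi_eq h.1, S.Psi_eq h.1] at h2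
  rw [← sys_toBlocks₁₁, ← sys_toBlocks₁₂, ← sys_toBlocks₂₁] at h2
  exact stableBelow_of_specConstraint hθ h.1 h2

theorem feasible_of_stableBelow (hθ : 0 < θ) (hκ : κ < 1)
    (h : StableBelow (J k₁ k₂) θ κ (S.sys u)) : S.Feasible θ u := by
  have h1 : IsHurwitz (S.𝒜 u) := h.1
  refine ⟨h1, ?_⟩
  have h2 := h.specConstraint hθ hκ
  rw [sys_toBlocks₁₁, sys_toBlocks₁₂, sys_toBlocks₂₁] at h2
  rwa [S.Phi_eq h1, S.Psi_eq h1]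

theorem differentiableAt_energy (u : Controller ν k₂ q₁) : DifferentiableAt ℝ
    (fun u : Controller ν k₂ q₁ => (u.1 : Matrix (Fin ν) (Fin ν) ℝ)) u :=
  (symMat (Fin ν)).subtypeL.differentiableAt.comp u differentiableAt_fst

theorem differentiableAt_a (u : Controller ν k₂ q₁) : DifferentiableAt ℝ (fun u => S.a u) u := by
  have hM : DifferentiableAt ℝ (fun u : Controller ν k₂ q₁ => u.2.1) u := by fun_prop
  have hL : DifferentiableAt ℝ (fun u : Controller ν k₂ q₁ => u.2.2) u := by fun_prop
  have hMt := differentiableAt_matrix_transpose hM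
  have hLt := differentiableAt_matrix_transpose hL
  exact (differentiableAt_matrix_mul (differentiableAt_const S.Θ₂)
    (((differentiableAt_energy u).add (differentiableAt_matrix_mul
      (differentiableAt_matrix_mul hMt (differentiableAt_const (Jmat k₂))) hM)).add
      (differentiableAt_matrix_mul
        (differentiableAt_matrix_mul hLt (differentiableAt_const S.Jt₁)) hL))).const_smul (2 : ℝ)

theorem differentiableAt_b (u : Controller ν k₂ q₁) : DifferentiableAt ℝ (fun u => S.b u) u := by
  have hM : DifferentiableAt ℝ (fun u : Controller ν k₂ q₁ => u.2.1) u := by fun_prop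
  exact (differentiableAt_matrix_mul (differentiableAt_const S.Θ₂)
    (differentiableAt_matrix_transpose hM)).const_smul (2 : ℝ)

theorem differentiableAt_c (u : Controller ν k₂ q₁) : DifferentiableAt ℝ (fun u => S.c u) u := by
  have hM : DifferentiableAt ℝ (fun u : Controller ν k₂ q₁ => u.2.1) u := by fun_prop
  exact (differentiableAt_matrix_mul (differentiableAt_const (S.d * Jmat k₂)) hM).const_smul (2 : ℝ)

theorem differentiableAt_e (u : Controller ν k₂ q₁) : DifferentiableAt ℝ (fun u => S.e u) u := by
  have hL : DifferentiableAt ℝ (fun u : Controller ν k₂ q₁ => u.2.2) u := by fun_prop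
  exact (differentiableAt_matrix_mul (differentiableAt_const S.Θ₂)
    (differentiableAt_matrix_transpose hL)).const_smul (2 : ℝ)

theorem eventually_stableBelow (hκ0 : 0 < κ) (hp : StableBelow (J k₁ k₂) θ κ (S.sys u)) :
    ∀ᶠ v in 𝓝 u, StableBelow (J k₁ k₂) θ κ (S.sys v) := by
  have h : DifferentiableAt ℝ (fun v => S.sys v) u :=
    S.differentiableAt_sysMat (S.differentiableAt_a u) (S.differentiableAt_b u)
      (S.differentiableAt_c u) (S.differentiableAt_e u)
  exact h.continuousAt.eventually (hp.eventually (J_transpose k₁ k₂) hκ0)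

theorem a_add_smul (u δ : Controller ν k₂ q₁) (s : ℝ) : S.a (u + s • δ) = S.a u +
    s • ((2 : ℝ) • (S.Θ₂ * (δ.1 : Matrix (Fin ν) (Fin ν) ℝ)) +
      (2 : ℝ) • (S.Θ₂ * (δ.2.1ᵀ * Jmat k₂ * u.2.1 + u.2.1ᵀ * Jmat k₂ * δ.2.1)) +
      (2 : ℝ) • (S.Θ₂ * (δ.2.2ᵀ * S.Jt₁ * u.2.2 + u.2.2ᵀ * S.Jt₁ * δ.2.2))) +
    s ^ 2 • ((2 : ℝ) • (S.Θ₂ * (δ.2.1ᵀ * Jmat k₂ * δ.2.1 + δ.2.2ᵀ * S.Jt₁ * δ.2.2))) := by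
  simp only [a, Prod.fst_add, Prod.snd_add, Prod.smul_fst, Prod.smul_snd, Submodule.coe_add,
    Submodule.coe_smul, transpose_add, transpose_smul, Matrix.mul_add, Matrix.add_mul,
    Matrix.smul_mul, Matrix.mul_smul, smul_add]
  module

theorem b_add_smul (u δ : Controller ν k₂ q₁) (s : ℝ) : S.b (u + s • δ) = S.b u + s • S.b δ := by
  simp only [b, Prod.fst_add, Prod.snd_add, Prod.smul_fst, Prod.smul_snd, transpose_add,
    transpose_smul, Matrix.mul_add, Matrix.mul_smul, smul_add]
  module

theorem c_add_smul (u δ : Controller ν k₂ q₁) (s : ℝ) : S.c (u + s • δ) = S.c u + s • S.c δ := by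
  simp only [c, Prod.fst_add, Prod.snd_add, Prod.smul_fst, Prod.smul_snd, Matrix.mul_add,
    Matrix.mul_smul, smul_add]
  module

theorem e_add_smul (u δ : Controller ν k₂ q₁) (s : ℝ) : S.e (u + s • δ) = S.e u + s • S.e δ := by
  simp only [e, Prod.snd_add, Prod.smul_snd, transpose_add,
    transpose_smul, Matrix.mul_add, Matrix.mul_smul, smul_add]
  module

/-- The gradient of the QEF rate with respect to the energy matrix. -/
def gradR (θ : ℝ) (u : Controller ν k₂ q₁) : Matrix (Fin ν) (Fin ν) ℝ :=
  (-2 : ℝ) • symPart (S.Θ₂ * S.da θ u)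

/-- The gradient of the QEF rate with respect to the coupling with the fields. -/
def gradM (θ : ℝ) (u : Controller ν k₂ q₁) : Matrix (Pair k₂) (Fin ν) ℝ :=
  (2 : ℝ) • ((2 : ℝ) • (Jmat k₂ * u.2.1 * asymPart (S.Θ₂ * S.da θ u)) + (S.db θ u)ᵀ * S.Θ₂ -
    Jmat k₂ * (S.d)ᵀ * S.dc θ u)

/-- The gradient of the QEF rate with respect to the coupling with the plant. -/
def gradL (θ : ℝ) (u : Controller ν k₂ q₁) : Matrix (Pair q₁) (Fin ν) ℝ :=
  (2 : ℝ) • ((2 : ℝ) • (S.Jt₁ * u.2.2 * asymPart (S.Θ₂ * S.da θ u)) + (S.de θ u)ᵀ * S.Θ₂)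

theorem frob_two_smul_mul_transpose {m : Type*} [Fintype m] (g : Matrix (Fin ν) m ℝ)
    (X : Matrix m (Fin ν) ℝ) :
    frob g ((2 : ℝ) • (S.Θ₂ * Xᵀ)) = frob ((2 : ℝ) • (gᵀ * S.Θ₂)) X := by
  rw [map_smul, frob_const_mul, frob_transpose, frob_smul_left, transpose_mul, transpose_transpose,
    smul_eq_mul]

/-- Collects the first-order variations of a, b, c, e by direction: the energy matrix enters through
a alone, M₂ through a, b and c, and L₂ through a and e. -/
theorem frob_gradients (u δ : Controller ν k₂ q₁) :
    frob (S.da θ u) ((2 : ℝ) • (S.Θ₂ * (δ.1 : Matrix (Fin ν) (Fin ν) ℝ)) +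
      (2 : ℝ) • (S.Θ₂ * (δ.2.1ᵀ * Jmat k₂ * u.2.1 + u.2.1ᵀ * Jmat k₂ * δ.2.1)) +
      (2 : ℝ) • (S.Θ₂ * (δ.2.2ᵀ * S.Jt₁ * u.2.2 + u.2.2ᵀ * S.Jt₁ * δ.2.2))) +
      frob (S.db θ u) (S.b δ) + frob (S.dc θ u) (S.c δ) + frob (S.de θ u) (S.e δ) =
    frob (S.gradR θ u) δ.1 + frob (S.gradM θ u) δ.2.1 + frob (S.gradL θ u) δ.2.2 := by
  have hR : frob (S.da θ u) ((2 : ℝ) • (S.Θ₂ * (δ.1 : Matrix (Fin ν) (Fin ν) ℝ))) =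
      frob (S.gradR θ u) δ.1 := by
    rw [gradR, frob_smul_left, frob_symPart, map_smul, frob_const_mul, S.Θ₂_antisymm,
      Matrix.neg_mul, ← neg_one_smul ℝ (S.Θ₂ * _), frob_smul_left, smul_eq_mul]
    ring
  -- The minus sign in front of the c term comes from transposing the antisymmetric J₂.
  have hM : S.gradM θ u = (4 : ℝ) • (Jmat k₂ * u.2.1 * asymPart (S.Θ₂ * S.da θ u)) +
      ((2 : ℝ) • ((S.db θ u)ᵀ * S.Θ₂) + (2 : ℝ) • ((S.d * Jmat k₂)ᵀ * S.dc θ u)) := by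
    rw [gradM, transpose_mul, Jmat_transpose, Matrix.neg_mul, Matrix.neg_mul]
    module
  have hL : S.gradL θ u = (4 : ℝ) • (S.Jt₁ * u.2.2 * asymPart (S.Θ₂ * S.da θ u)) +
      (2 : ℝ) • ((S.de θ u)ᵀ * S.Θ₂) := by
    rw [gradL]
    module
  have hc : frob (S.dc θ u) (S.c δ) = frob ((2 : ℝ) • ((S.d * Jmat k₂)ᵀ * S.dc θ u)) δ.2.1 := by
    rw [c, map_smul, frob_const_mul, frob_smul_left, smul_eq_mul]
  rw [map_add, map_add, hR, frob_coupling (Jmat_transpose k₂) S.Θ₂_antisymm,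
    frob_coupling S.Jt₁_transpose S.Θ₂_antisymm, hc, b, e, frob_two_smul_mul_transpose,
    frob_two_smul_mul_transpose, hM, hL, frob_add_left, frob_add_left, frob_add_left]
  ring

/-- The cost is identified with the composite function for stabilizing controllers, so the chain
rule is transferred through equality on a neighbourhood. -/
theorem exists_hasFDerivAt_Ups (hκ0 : 0 < κ) (hκ : κ ≤ 1)
    (hp : StableBelow (J k₁ k₂) θ κ (S.sys u)) : ∃ L : Controller ν k₂ q₁ →L[ℝ] ℝ,
      HasFDerivAt (S.Ups θ) L u ∧ ∀ δ : Controller ν k₂ q₁, L δ =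
        frob (S.gradR θ u) δ.1 + frob (S.gradM θ u) δ.2.1 + frob (S.gradL θ u) δ.2.2 := by
  obtain ⟨L, hL, h⟩ := S.exists_hasFDerivAt_UpsTf hκ0 hκ hp (a := fun v => S.a v)
    (b := fun v => S.b v) (c := fun v => S.c v) (e := fun v => S.e v) rfl rfl rfl rfl
    (S.differentiableAt_a u) (S.differentiableAt_b u) (S.differentiableAt_c u)
    (S.differentiableAt_e u)
  refine ⟨L, hL.congr_of_eventuallyEq ?_, fun δ => ?_⟩
  · filter_upwards [S.eventually_stableBelow hκ0 hp] with v hv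
    exact S.Ups_eq hv.1
  · rw [← S.frob_gradients u δ]
    exact h δ _ _ _ _ _ (S.a_add_smul u δ) (S.b_add_smul u δ) (S.c_add_smul u δ)
      (S.e_add_smul u δ)

variable {R : symMat (Fin ν)} {M : Matrix (Pair k₂) (Fin ν) ℝ} {L : Matrix (Pair q₁) (Fin ν) ℝ}

theorem hasFDerivAt_energy (R : symMat (Fin ν)) (w : Matrix (Pair k₂) (Fin ν) ℝ ×
    Matrix (Pair q₁) (Fin ν) ℝ) : HasFDerivAt (fun R => ((R, w) : Controller ν k₂ q₁))
      (ContinuousLinearMap.inl ℝ _ _) R := hasFDerivAt_prodMk_left R w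

theorem hasFDerivAt_fieldCoupling (R : symMat (Fin ν)) (M : Matrix (Pair k₂) (Fin ν) ℝ)
    (L : Matrix (Pair q₁) (Fin ν) ℝ) : HasFDerivAt (fun M => ((R, M, L) : Controller ν k₂ q₁))
      ((ContinuousLinearMap.inr ℝ _ _).comp (ContinuousLinearMap.inl ℝ _ _)) M :=
  (hasFDerivAt_prodMk_right R (M, L)).comp M (hasFDerivAt_prodMk_left M L)

theorem hasFDerivAt_plantCoupling (R : symMat (Fin ν)) (M : Matrix (Pair k₂) (Fin ν) ℝ)
    (L : Matrix (Pair q₁) (Fin ν) ℝ) : HasFDerivAt (fun L => ((R, M, L) : Controller ν k₂ q₁))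
      ((ContinuousLinearMap.inr ℝ _ _).comp (ContinuousLinearMap.inr ℝ _ _)) L :=
  (hasFDerivAt_prodMk_right R (M, L)).comp L (hasFDerivAt_prodMk_right M L)

theorem hasSymGradAt_energy (hκ0 : 0 < κ) (hκ : κ ≤ 1)
    (hp : StableBelow (J k₁ k₂) θ κ (S.sys (R, M, L))) :
    HasSymGradAt (fun R => S.Ups θ (R, M, L)) (S.gradR θ (R, M, L)) R := by
  obtain ⟨D, hD, h⟩ := S.exists_hasFDerivAt_Ups hκ0 hκ hp
  refine hasSymGradAt_of_hasFDerivAt (Submodule.smul_mem _ _ (symPart_mem _))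
    (HasFDerivAt.comp (g := S.Ups θ) (f := fun R => ((R, M, L) : Controller ν k₂ q₁)) R hD
      (hasFDerivAt_energy R (M, L))) fun δ => ?_
  refine (h (δ, 0, 0)).trans ?_
  simp

theorem hasFrobGradAt_fieldCoupling (hκ0 : 0 < κ) (hκ : κ ≤ 1)
    (hp : StableBelow (J k₁ k₂) θ κ (S.sys (R, M, L))) :
    HasFrobGradAt (fun M => S.Ups θ (R, M, L)) (S.gradM θ (R, M, L)) M := by
  obtain ⟨D, hD, h⟩ := S.exists_hasFDerivAt_Ups hκ0 hκ hp
  refine hasFrobGradAt_of_hasFDerivAt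
    (HasFDerivAt.comp (g := S.Ups θ) (f := fun M => ((R, M, L) : Controller ν k₂ q₁)) M hD
      (hasFDerivAt_fieldCoupling R M L)) fun δ => ?_
  refine (h (0, δ, 0)).trans ?_
  simp

theorem hasFrobGradAt_plantCoupling (hκ0 : 0 < κ) (hκ : κ ≤ 1)
    (hp : StableBelow (J k₁ k₂) θ κ (S.sys (R, M, L))) :
    HasFrobGradAt (fun L => S.Ups θ (R, M, L)) (S.gradL θ (R, M, L)) L := by
  obtain ⟨D, hD, h⟩ := S.exists_hasFDerivAt_Ups hκ0 hκ hp
  refine hasFrobGradAt_of_hasFDerivAt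
    (HasFDerivAt.comp (g := S.Ups θ) (f := fun L => ((R, M, L) : Controller ν k₂ q₁)) L hD
      (hasFDerivAt_plantCoupling R M L)) fun δ => ?_
  refine (h (0, 0, δ)).trans ?_
  simp

theorem gradients_eq_zero_of_isLocalMinOn (hθ : 0 < θ) (hκ0 : 0 < κ) (hκ : κ < 1)
    (hp : StableBelow (J k₁ k₂) θ κ (S.sys (R, M, L)))
    (hmin : IsLocalMinOn (S.Ups θ) {u | S.Feasible θ u} (R, M, L)) :
    S.gradR θ (R, M, L) = 0 ∧ S.gradM θ (R, M, L) = 0 ∧ S.gradL θ (R, M, L) = 0 := by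
  -- Feasibility is an open condition, so the constrained minimum is an unconstrained local one and
  -- Fermat's rule applies to each partial gradient.
  have hnhds : {u | S.Feasible θ u} ∈ 𝓝 (R, M, L) := by
    filter_upwards [S.eventually_stableBelow hκ0 hp] with v hv
    exact S.feasible_of_stableBelow hθ hκ hv
  have hloc : IsLocalMin (S.Ups θ) (R, M, L) := hmin.isLocalMin hnhds
  refine ⟨(S.hasSymGradAt_energy hκ0 hκ.le hp).eq_zero_of_isLocalMin ?_,
    (S.hasFrobGradAt_fieldCoupling hκ0 hκ.le hp).eq_zero_of_isLocalMin ?_,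
    (S.hasFrobGradAt_plantCoupling hκ0 hκ.le hp).eq_zero_of_isLocalMin ?_⟩
  · exact IsLocalMin.comp_continuous (g := fun R => ((R, M, L) : Controller ν k₂ q₁)) hloc
      (hasFDerivAt_energy R (M, L)).continuousAt
  · exact IsLocalMin.comp_continuous (g := fun M => ((R, M, L) : Controller ν k₂ q₁)) hloc
      (hasFDerivAt_fieldCoupling R M L).continuousAt
  · exact IsLocalMin.comp_continuous (g := fun L => ((R, M, L) : Controller ν k₂ q₁)) hloc
      (hasFDerivAt_plantCoupling R M L).continuousAt

end Setup

end CoherentQEF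

end

theorem theorem5p1 {n ν k₁ k₂ q₁ q₂ r : ℕ} (S : CoherentQEF.Setup n ν k₁ k₂ q₁ q₂ r)
    (θ : ℝ) (hθ : 0 < θ)
    (R₂ : CoherentQEF.symMat (Fin ν))
    (M₂ : Matrix (CoherentQEF.Pair k₂) (Fin ν) ℝ)
    (L₂ : Matrix (CoherentQEF.Pair q₁) (Fin ν) ℝ)
    (hadm : S.Admissible θ (R₂, M₂, L₂)) :
    -- the integrals and the logarithm below are meaningful
    (∀ lam : ℝ,
      (CoherentQEF.Dmat θ (S.Phi (R₂, M₂, L₂)) (S.Psi (R₂, M₂, L₂)) lam).det.im = 0 ∧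
      0 < (CoherentQEF.Dmat θ (S.Phi (R₂, M₂, L₂)) (S.Psi (R₂, M₂, L₂)) lam).det.re) ∧
    MeasureTheory.Integrable
      (CoherentQEF.logDetD θ (S.Phi (R₂, M₂, L₂)) (S.Psi (R₂, M₂, L₂))) ∧
    (∀ i j, MeasureTheory.Integrable fun lam : ℝ =>
      CoherentQEF.coreIntegrand (CoherentQEF.Setup.J k₁ k₂) θ
        (S.𝒜 (R₂, M₂, L₂)) (S.ℬ (R₂, M₂, L₂)) (S.𝒞 (R₂, M₂, L₂)) lam i j) ∧
    -- for every stabilizing controller, the rate is the composite function of (a, b, c, e)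
    (∀ u : CoherentQEF.Controller ν k₂ q₁, CoherentQEF.IsHurwitz (S.𝒜 u) →
      S.Ups θ u = S.UpsTf θ (S.a u) (S.b u) (S.c u) (S.e u)) ∧
    -- partial Frechet derivatives with respect to a, b, c, e as independent variables
    CoherentQEF.HasFrobGradAt
      (fun a => S.UpsTf θ a (S.b (R₂, M₂, L₂)) (S.c (R₂, M₂, L₂)) (S.e (R₂, M₂, L₂)))
      (S.da θ (R₂, M₂, L₂)) (S.a (R₂, M₂, L₂)) ∧
    CoherentQEF.HasFrobGradAt
      (fun b => S.UpsTf θ (S.a (R₂, M₂, L₂)) b (S.c (R₂, M₂, L₂)) (S.e (R₂, M₂, L₂)))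
      (S.db θ (R₂, M₂, L₂)) (S.b (R₂, M₂, L₂)) ∧
    CoherentQEF.HasFrobGradAt
      (fun c => S.UpsTf θ (S.a (R₂, M₂, L₂)) (S.b (R₂, M₂, L₂)) c (S.e (R₂, M₂, L₂)))
      (S.dc θ (R₂, M₂, L₂)) (S.c (R₂, M₂, L₂)) ∧
    CoherentQEF.HasFrobGradAt
      (fun e => S.UpsTf θ (S.a (R₂, M₂, L₂)) (S.b (R₂, M₂, L₂)) (S.c (R₂, M₂, L₂)) e)
      (S.de θ (R₂, M₂, L₂)) (S.e (R₂, M₂, L₂)) ∧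
    -- Frechet derivatives with respect to the energy and coupling matrices
    DifferentiableAt ℝ (S.Ups θ) (R₂, M₂, L₂) ∧
    CoherentQEF.HasSymGradAt (fun R => S.Ups θ (R, M₂, L₂))
      ((-2 : ℝ) • CoherentQEF.symPart (S.Θ₂ * S.da θ (R₂, M₂, L₂))) R₂ ∧
    CoherentQEF.HasFrobGradAt (fun M => S.Ups θ (R₂, M, L₂))
      ((2 : ℝ) • ((2 : ℝ) • (CoherentQEF.Jmat k₂ * M₂ *
            CoherentQEF.asymPart (S.Θ₂ * S.da θ (R₂, M₂, L₂)))
          + (S.db θ (R₂, M₂, L₂))ᵀ * S.Θ₂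
          - CoherentQEF.Jmat k₂ * (S.d)ᵀ * S.dc θ (R₂, M₂, L₂))) M₂ ∧
    CoherentQEF.HasFrobGradAt (fun L => S.Ups θ (R₂, M₂, L))
      ((2 : ℝ) • ((2 : ℝ) • (S.Jt₁ * L₂ *
            CoherentQEF.asymPart (S.Θ₂ * S.da θ (R₂, M₂, L₂)))
          + (S.de θ (R₂, M₂, L₂))ᵀ * S.Θ₂)) L₂ ∧
    -- first-order necessary conditions of optimality
    (IsLocalMinOn (S.Ups θ) {u | S.Feasible θ u} (R₂, M₂, L₂) →
      CoherentQEF.symPart (S.Θ₂ * S.da θ (R₂, M₂, L₂)) = 0 ∧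
      (2 : ℝ) • (CoherentQEF.Jmat k₂ * M₂ *
            CoherentQEF.asymPart (S.Θ₂ * S.da θ (R₂, M₂, L₂)))
          + (S.db θ (R₂, M₂, L₂))ᵀ * S.Θ₂
          - CoherentQEF.Jmat k₂ * (S.d)ᵀ * S.dc θ (R₂, M₂, L₂) = 0 ∧
      (2 : ℝ) • (S.Jt₁ * L₂ *
            CoherentQEF.asymPart (S.Θ₂ * S.da θ (R₂, M₂, L₂)))
          + (S.de θ (R₂, M₂, L₂))ᵀ * S.Θ₂ = 0) := by
  -- The supremum in the constraint is strictly below 1, which leaves room for a bound κ in (0, 1)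
  -- that persists under perturbation.
  open CoherentQEF CoherentQEF.Setup in
  obtain ⟨κ, hκ0, hκ, hp⟩ := hadm.1.exists_stableBelow hθ
  have hH := hadm.1.1
  have hJ := J_transpose k₁ k₂
  have hJ2 := J_mul_self k₁ k₂
  refine ⟨fun lam => ?_, ?_, ?_, fun u hu => S.Ups_eq hu, S.hasFrobGradAt_a hκ0 hκ.le hp,
    S.hasFrobGradAt_b hκ0 hκ.le hp, S.hasFrobGradAt_c hκ0 hκ.le hp, S.hasFrobGradAt_e hκ0 hκ.le hp,
    ?_, S.hasSymGradAt_energy hκ0 hκ.le hp, S.hasFrobGradAt_fieldCoupling hκ0 hκ.le hp,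
    S.hasFrobGradAt_plantCoupling hκ0 hκ.le hp, fun hmin => ?_⟩
  · rw [S.Phi_eq hH, S.Psi_eq hH]
    exact det_dX_pos hJ hκ.le (hp.2 lam)
  · rw [S.Phi_eq hH, S.Psi_eq hH]
    have h := integrable_logDetD hJ hJ2 hκ0 hκ.le hp
    rwa [sys_toBlocks₁₁, sys_toBlocks₁₂, sys_toBlocks₂₁] at h
  · have h := integrable_coreIntegrand hJ hJ2 hκ0 hκ.le hp
    rwa [sys_toBlocks₁₁, sys_toBlocks₁₂, sys_toBlocks₂₁] at h
  · obtain ⟨L, hL, -⟩ := S.exists_hasFDerivAt_Ups hκ0 hκ.le hp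
    exact ⟨L, hL⟩
  · obtain ⟨h1, h2, h3⟩ := S.gradients_eq_zero_of_isLocalMinOn hθ hκ0 hκ hp hmin
    exact ⟨(smul_eq_zero.1 h1).resolve_left (by norm_num),
      (smul_eq_zero.1 h2).resolve_left (by norm_num),
      (smul_eq_zero.1 h3).resolve_left (by norm_num)⟩
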